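/- A (abstract) polyhedron is an abstract polytope of rank $3$: a ranked poset with a unique face of rank $-1$, a unique face of rank $3$, and faces of ranks $0,1,2$ (vertices, edges, facets), which is strongly flag-connected and satisfies the diamond property. It is regular if its automorphism group acts transitively on its flags, and has type $\{p,q\}$ if each facet has $p$ vertices and each vertex lies on $q$ edges. A regular polyhedron is vertex-faithful if the identity is its only automorphism that fixes every vertex. For $s\ge 3$ let $\{4,4\}_{(s,0)}$ be the toroidal map obtained from the tessellation of the plane by unit squares, with vertex set $\mathbb Z^2$, as its quotient by the translations by $(s,0)$ and $(0,s)$. Let $\mathcal P^{\pi}$ be the Petrial of $\mathcal P$ (same vertices and edges, with the Petrie polygons of $\mathcal P$ as facets) and $\mathcal P^{\delta}$ the dual of $\mathcal P$ (reversed order), and write $\mathcal P^{\pi\delta}=(\mathcal P^{\pi})^{\delta}$. (1) Let $\mathcal P$ be a vertex-faithful regular polyhedron of type $\{p,q\}$ with a finite number $v$ of vertices, and suppose that $q=v$. Then $q\ge 6$, $q$ is even, $q/2$ is odd, and $\mathcal P$ is isomorphic to $(\{4,4\}_{(q/2,0)})^{\pi\delta}$. (2) Conversely, for every even integer $q\ge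 6$ with $q/2$ odd, $(\{4,4\}_{(q/2,0)})^{\pi\delta}$ is a vertex-faithful regular polyhedron of type $\{4,q\}$ with exactly $q$ vertices. -/

import Mathlib

universe u v

/-- A partially ordered set of faces together with a strictly monotone integer-valued rank. -/
structure RankedPoset where
  /-- The faces. -/
  Face : Type u
  [partialOrder : PartialOrder Face]
  /-- The rank of a face. -/
  rank : Face → ℤ
  rank_strictMono : StrictMono rank

attribute [instance] RankedPoset.partialOrder

namespace RankedPoset

/-- Two flags (maximal chains) are `i`-adjacent if they differ exactly in their faces of
rank `i`. -/
def FlagAdj (P : RankedPoset.{u}) (i : ℤ) (Φ Ψ : Flag P.Face) : Prop :=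
  Φ ≠ Ψ ∧ ∀ x : P.Face, P.rank x ≠ i → (x ∈ Φ ↔ x ∈ Ψ)

/-- Abstract polyhedra (abstract polytopes of rank 3). Flags are the maximal chains. -/
structure IsPolyhedron (P : RankedPoset.{u}) : Prop where
  rank_mem : ∀ x : P.Face, P.rank x ∈ Set.Icc (-1 : ℤ) 3
  existsUnique_least : ∃! x : P.Face, P.rank x = -1
  existsUnique_greatest : ∃! x : P.Face, P.rank x = 3
  flag_rank : ∀ (Φ : Flag P.Face), ∀ i ∈ Set.Icc (-1 : ℤ) 3, ∃! x : P.Face, x ∈ Φ ∧ P.rank x = i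
  strongly_connected : ∀ Φ Ψ : Flag P.Face,
    Relation.ReflTransGen
      (fun A B : Flag P.Face =>
        (∃ i : ℤ, P.FlagAdj i A B) ∧ ∀ x : P.Face, x ∈ Φ → x ∈ Ψ → x ∈ B) Φ Ψ
  diamond : ∀ F G : P.Face, F < G → P.rank F = P.rank G - 2 →
    {H : P.Face | F < H ∧ H < G}.encard = 2

/-- The group of rank-preserving order automorphisms. -/
def autGroup (P : RankedPoset.{u}) : Subgroup (P.Face ≃o P.Face) where
  carrier := {g | ∀ x, P.rank (g x) = P.rank x}
  mul_mem' := by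
    intro a b ha hb x
    exact (ha (b x)).trans (hb x)
  one_mem' := fun _ => rfl
  inv_mem' := by
    intro a ha x
    have h := ha (a⁻¹ x)
    have h2 : a (a⁻¹ x) = x := a.apply_symm_apply x
    rw [h2] at h
    exact h.symm

/-- Regularity: the automorphism group is transitive on the flags. -/
def IsRegular (P : RankedPoset.{u}) : Prop :=
  ∀ Φ Ψ : Flag P.Face, ∃ g ∈ P.autGroup, ∀ x : P.Face, x ∈ Φ ↔ g x ∈ Ψ

/-- The vertices are the faces of rank `0`. -/
def vertices (P : RankedPoset.{u}) : Set P.Face := {x | P.rank x = 0}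

/-- Only the identity automorphism fixes every vertex. -/
def IsVertexFaithful (P : RankedPoset.{u}) : Prop :=
  ∀ g ∈ P.autGroup, (∀ x ∈ P.vertices, g x = x) → g = 1

/-- Type `{p, q}`: each facet has exactly `p` vertices and each vertex lies on exactly `q`
edges. -/
def HasType (P : RankedPoset.{u}) (p q : ℕ∞) : Prop :=
  (∀ F : P.Face, P.rank F = 2 → {x : P.Face | P.rank x = 0 ∧ x < F}.encard = p) ∧
  (∀ x : P.Face, P.rank x = 0 → {e : P.Face | P.rank e = 1 ∧ x < e}.encard = q)

/-- Isomorphism: a bijection preserving the order (both ways) and the rank. -/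
def IsIsomorphic (P : RankedPoset.{u}) (Q : RankedPoset.{v}) : Prop :=
  ∃ e : P.Face ≃o Q.Face, ∀ x, Q.rank (e x) = P.rank x

/-- The dual: the order is reversed, so that vertices and facets are exchanged. -/
def dual (P : RankedPoset.{u}) : RankedPoset.{u} where
  Face := P.Faceᵒᵈ
  rank := fun x => 2 - P.rank (OrderDual.ofDual x)
  rank_strictMono := by
    intro a b h
    have := P.rank_strictMono (OrderDual.ofDual_lt_ofDual.mpr h)
    simp only
    omega

/-- One elementary step along a Petrie polygon: from a flag `Φ` to its `1`-adjacent flag, or to the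
flag obtained from it by changing first the vertex and then the facet. -/
def PetrieStep (P : RankedPoset.{u}) (Φ Ψ : Flag P.Face) : Prop :=
  P.FlagAdj 1 Φ Ψ ∨ ∃ Χ : Flag P.Face, P.FlagAdj 0 Φ Χ ∧ P.FlagAdj 2 Χ Ψ

/-- The Petrie polygons. Walking along a polygon of a polyhedron amounts to changing alternately the
vertex and the edge of a flag; if the facet is changed at each change of the vertex, then each
two successive edges, but no three, are taken along a common facet. So a Petrie polygon is
given by the class of flags that are met in such a walk. -/
def PetriePolygon (P : RankedPoset.{u}) : Type u :=
  Quot P.PetrieStep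

/-- The vertices and edges on a Petrie polygon `Z` (and the least face): those below a vertex or an
edge of a flag in the class `Z`. -/
def OnPetrie (P : RankedPoset.{u}) (x : P.Face) (Z : P.PetriePolygon) : Prop :=
  ∃ (Φ : Flag P.Face) (y : P.Face),
    Quot.mk P.PetrieStep Φ = Z ∧ y ∈ Φ ∧ P.rank y < 2 ∧ x ≤ y

/-- The faces of the Petrial: the old faces other than the facets, and the Petrie polygons. -/
inductive PetrialFace (P : RankedPoset.{u}) : Type u
  | old (x : P.Face) (hx : P.rank x ≠ 2)
  | polygon (Z : P.PetriePolygon)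

/-- The order of the Petrial. -/
def PetrialFace.le (P : RankedPoset.{u}) : P.PetrialFace → P.PetrialFace → Prop
  | .old x _, .old y _ => x ≤ y
  | .old x _, .polygon Z => P.OnPetrie x Z
  | .polygon _, .old y _ => IsTop y ∧ 2 < P.rank y
  | .polygon Z, .polygon W => Z = W

theorem OnPetrie.rank_lt {P : RankedPoset.{u}} {x : P.Face} {Z : P.PetriePolygon}
    (h : P.OnPetrie x Z) : P.rank x < 2 := by
  obtain ⟨Φ, y, -, -, hy, hxy⟩ := h
  exact lt_of_le_of_lt (P.rank_strictMono.monotone hxy) hy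

theorem OnPetrie.of_le {P : RankedPoset.{u}} {x y : P.Face} {Z : P.PetriePolygon}
    (hxy : x ≤ y) (h : P.OnPetrie y Z) : P.OnPetrie x Z := by
  obtain ⟨Φ, z, h1, h2, h3, h4⟩ := h
  exact ⟨Φ, z, h1, h2, h3, hxy.trans h4⟩

instance petrialOrder (P : RankedPoset.{u}) : PartialOrder P.PetrialFace where
  le := PetrialFace.le P
  le_refl := by
    rintro (⟨x, hx⟩ | Z)
    · exact le_refl x
    · exact rfl
  le_trans := by
    rintro (⟨x, hx⟩ | X) (⟨y, hy⟩ | Y) (⟨z, hz⟩ | Z) h1 h2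
    · exact le_trans (α := P.Face) h1 h2
    · exact OnPetrie.of_le h1 h2
    · exact h2.1 x
    · cases (show Y = Z from h2)
      exact h1
    · exact ⟨fun w => (h1.1 w).trans h2, lt_of_lt_of_le h1.2 (P.rank_strictMono.monotone h2)⟩
    · exact absurd (h1.2.trans (OnPetrie.rank_lt h2)) (lt_irrefl _)
    · cases (show X = Y from h1)
      exact h2
    · exact Eq.trans (α := P.PetriePolygon) h1 h2
  le_antisymm := by
    rintro (⟨x, hx⟩ | X) (⟨y, hy⟩ | Y) h1 h2
    · cases (le_antisymm (α := P.Face) h1 h2)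
      rfl
    · exact absurd (h2.2.trans (OnPetrie.rank_lt h1)) (lt_irrefl _)
    · exact absurd (h1.2.trans (OnPetrie.rank_lt h2)) (lt_irrefl _)
    · cases (show X = Y from h1)
      rfl

/-- The rank in the Petrial: the Petrie polygons are the facets. -/
def petrialRank (P : RankedPoset.{u}) : P.PetrialFace → ℤ
  | .old x _ => P.rank x
  | .polygon _ => 2

/-- The Petrial (Petrie dual): the same vertices and edges, with the Petrie polygons as facets. -/
def petrial (P : RankedPoset.{u}) : RankedPoset.{u} where
  Face := P.PetrialFace
  rank := P.petrialRank
  rank_strictMono := by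
    rintro (⟨x, hx⟩ | X) (⟨y, hy⟩ | Y) h
    · refine P.rank_strictMono (lt_of_le_not_ge h.1 h.2)
    · exact OnPetrie.rank_lt h.1
    · exact h.1.2
    · exact absurd (Eq.symm (α := P.PetriePolygon) h.1) h.2

end RankedPoset

/-- The faces of the toroidal map `{4,4}_(s,0)`, the quotient of the tessellation of the plane by
unit squares with vertex set `ℤ × ℤ` by the translations by `(s,0)` and `(0,s)`. -/
inductive TorusFace (s : ℕ) : Type
  | empty
  /-- The point `(i, j)`. -/
  | vertex (i j : ZMod s)
  /-- The segment from `(i, j)` to `(i + 1, j)`. -/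
  | hEdge (i j : ZMod s)
  /-- The segment from `(i, j)` to `(i, j + 1)`. -/
  | vEdge (i j : ZMod s)
  /-- The square with the corners `(i, j)`, `(i + 1, j)`, `(i, j + 1)`, `(i + 1, j + 1)`. -/
  | square (i j : ZMod s)
  | whole

namespace TorusFace

/-- The dimension of a face. -/
def rank {s : ℕ} : TorusFace s → ℤ
  | empty => -1
  | vertex _ _ => 0
  | hEdge _ _ => 1
  | vEdge _ _ => 1
  | square _ _ => 2
  | whole => 3

/-- Incidence of a face with a face of larger dimension. -/
def lt {s : ℕ} : TorusFace s → TorusFace s → Prop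
  | empty, y => y ≠ empty
  | x, whole => x ≠ whole
  | vertex i j, hEdge k l => (i = k ∨ i = k + 1) ∧ j = l
  | vertex i j, vEdge k l => i = k ∧ (j = l ∨ j = l + 1)
  | vertex i j, square k l => (i = k ∨ i = k + 1) ∧ (j = l ∨ j = l + 1)
  | hEdge i j, square k l => i = k ∧ (j = l ∨ j = l + 1)
  | vEdge i j, square k l => (i = k ∨ i = k + 1) ∧ j = l
  | _, _ => False

theorem rank_lt_of_lt {s : ℕ} {x y : TorusFace s} (h : x.lt y) : x.rank < y.rank := by
  cases x <;> cases y <;> simp_all [lt, rank]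

theorem lt_trans' {s : ℕ} {x y z : TorusFace s} (h : x.lt y) (h' : y.lt z) : x.lt z := by
  cases x <;> cases y <;> cases z <;> simp only [lt] at h h' ⊢ <;> grind

instance (s : ℕ) : PartialOrder (TorusFace s) where
  le x y := x = y ∨ x.lt y
  le_refl x := Or.inl rfl
  le_trans := by
    rintro x y z (rfl | h) (rfl | h')
    · exact Or.inl rfl
    · exact Or.inr h'
    · exact Or.inr h
    · exact Or.inr (lt_trans' h h')
  le_antisymm := by
    rintro x y (rfl | h) (h' | h')
    · rfl
    · rfl
    · exact h'.symm
    · exact absurd ((rank_lt_of_lt h).trans (rank_lt_of_lt h')) (lt_irrefl _)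

end TorusFace

/-- The toroidal map `{4,4}_(s,0)`. -/
def toroidalMap44 (s : ℕ) : RankedPoset.{0} where
  Face := TorusFace s
  rank := TorusFace.rank
  rank_strictMono := by
    rintro x y h
    rcases h.1 with rfl | h1
    · exact absurd (Or.inl rfl) h.2
    · exact TorusFace.rank_lt_of_lt h1

/-! Let r₀, r₁, r₂ carry a base flag to its adjacent flags, and let R = r₁r₂ be the rotation about
the base vertex v. An automorphism fixing a flag is trivial, so R permutes the q edges at v simply
transitively and the stabilizer of v consists of the elements Rⁱ and Rⁱr₂. Vertex-faithfulness
allows all of this to be computed in the permutations of the q vertices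
(`IsGenerators.isRegularVertexAction`).

The neighbours Rⁱ(r₀v) of v recur with a period d dividing q. Since v is not its own neighbour, d +
1 ≤ q, so T = Rᵈ is nontrivial, while it fixes v and all neighbours of v. If r₀Tr₀ were a power of
T, the group ⟨T⟩ would be normal, and having the fixed point v it would be trivial by
vertex-transitivity. As r₀Tr₀ fixes v and r₀v, the stabilizer leaves only r₀Tr₀ = Tr₂ with T² = 1.
So q = 2k with k = d (`exists_half`).

Now count. The k neighbours of v and their k images under r₀ share at most one vertex, so they miss
at most one of the 2k vertices. Hence T moves only images r₀Rⁱ(r₀v) (`exists_of_half_ne`), and R²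
fixes every vertex that T moves (`rot_sq_of_half_ne`). For even k, T is a power of R² and would be
trivial; k = 1 fails as well. So k is odd and at least 3, the two sets are disjoint and exhaust the
vertices, and the generators become explicit permutations of `Bool × ZMod k` (`exists_equiv`). A
vertex-faithful regular polyhedron is determined by the action of its generators on the vertices
(`isIsomorphic_of_vertices`), so only one polyhedron is possible for each k, the model `biMap k`.

The model is the dual of the Petrial of the torus map in coordinates: its facets are the points of
the torus, its edges the segments, and its vertices the Petrie polygons, which are the diagonal
zigzags, one family indexed by i − j and the other by i + j (`biMap_isIsomorphic`). The converse is
verified on the model; oddness of k enters it only through faithfulness, where 2x = 0 must imply x =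
0. -/

namespace RankedPoset

/-! ### Flags, adjacency and generators of a regular polyhedron -/

section Flags

variable {P : RankedPoset.{u}}

theorem flag_eq_of_rank_eq {Φ : Flag P.Face} {x y : P.Face} (hx : x ∈ Φ) (hy : y ∈ Φ)
    (h : P.rank x = P.rank y) : x = y := by
  rcases Φ.le_or_le hx hy with h' | h'
  · exact h'.eq_or_lt.resolve_right fun hlt => (P.rank_strictMono hlt).ne h
  · exact (h'.eq_or_lt.resolve_right fun hlt => (P.rank_strictMono hlt).ne' h).symm

theorem flag_lt_of_rank_lt {Φ : Flag P.Face} {x y : P.Face} (hx : x ∈ Φ) (hy : y ∈ Φ)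
    (h : P.rank x < P.rank y) : x < y := by
  rcases Φ.le_or_le hx hy with h' | h'
  · exact lt_of_le_of_ne h' (by rintro rfl; exact lt_irrefl _ h)
  · exact absurd (P.rank_strictMono.monotone h') (not_le.2 h)

theorem flag_le_of_rank_le {Φ : Flag P.Face} {x y : P.Face} (hx : x ∈ Φ) (hy : y ∈ Φ)
    (h : P.rank x ≤ P.rank y) : x ≤ y := by
  rcases h.lt_or_eq with h' | h'
  · exact (flag_lt_of_rank_lt hx hy h').le
  · exact (flag_eq_of_rank_eq hx hy h').le

theorem flag_eq_of_subset {Φ Ψ : Flag P.Face} (h : ∀ x ∈ Φ, x ∈ Ψ) : Φ = Ψ :=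
  SetLike.coe_injective (Φ.maxChain.2 Ψ.chain_le h)

theorem rank_apply {g : P.Face ≃o P.Face} (hg : g ∈ P.autGroup) (x : P.Face) :
    P.rank (g x) = P.rank x := hg x

/-- The poset conditions on a polyhedron that concern single flags. -/
structure IsFlagGraded (P : RankedPoset.{u}) : Prop where
  rank_mem : ∀ x : P.Face, P.rank x ∈ Set.Icc (-1 : ℤ) 3
  existsUnique_least : ∃! x : P.Face, P.rank x = -1
  existsUnique_greatest : ∃! x : P.Face, P.rank x = 3
  flag_rank : ∀ (Φ : Flag P.Face), ∀ i ∈ Set.Icc (-1 : ℤ) 3, ∃! x : P.Face, x ∈ Φ ∧ P.rank x = i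

theorem IsPolyhedron.isFlagGraded (hP : P.IsPolyhedron) : P.IsFlagGraded :=
  ⟨hP.rank_mem, hP.existsUnique_least, hP.existsUnique_greatest, hP.flag_rank⟩

namespace IsFlagGraded

theorem exists_mem (hP : P.IsFlagGraded) (Φ : Flag P.Face) {i : ℤ} (h0 : -1 ≤ i) (h3 : i ≤ 3) :
    ∃ x ∈ Φ, P.rank x = i :=
  (hP.flag_rank Φ i ⟨h0, h3⟩).exists

theorem least_mem (hP : P.IsFlagGraded) {x : P.Face}
    (hx : P.rank x = -1) (Φ : Flag P.Face) : x ∈ Φ := by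
  obtain ⟨y, hy, hy'⟩ := hP.exists_mem Φ (i := -1) (by norm_num) (by norm_num)
  rwa [hP.existsUnique_least.unique hx hy']

theorem greatest_mem (hP : P.IsFlagGraded) {x : P.Face}
    (hx : P.rank x = 3) (Φ : Flag P.Face) : x ∈ Φ := by
  obtain ⟨y, hy, hy'⟩ := hP.exists_mem Φ (i := 3) (by norm_num) (by norm_num)
  rwa [hP.existsUnique_greatest.unique hx hy']

theorem flag_ext (hP : P.IsFlagGraded) {Φ Ψ : Flag P.Face}
    (h : ∀ x ∈ Φ, 0 ≤ P.rank x → P.rank x ≤ 2 → x ∈ Ψ) : Φ = Ψ := by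
  refine flag_eq_of_subset fun x hx => ?_
  have := hP.rank_mem x
  by_cases h1 : P.rank x = -1
  · exact hP.least_mem h1 Ψ
  by_cases h2 : P.rank x = 3
  · exact hP.greatest_mem h2 Ψ
  · exact h x hx (by have := this.1; omega) (by have := this.2; omega)

theorem _root_.RankedPoset.exists_flag {x y z : P.Face} (hxy : x ≤ y) (hyz : y ≤ z) :
    ∃ Φ : Flag P.Face, x ∈ Φ ∧ y ∈ Φ ∧ z ∈ Φ := by
  have hc : IsChain (· ≤ ·) ({x, y, z} : Set P.Face) := by
    have hxz := hxy.trans hyz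
    rintro a (rfl | rfl | rfl) b (rfl | rfl | rfl) _ <;> simp_all
  obtain ⟨Φ, hΦ⟩ := hc.exists_subset_flag
  exact ⟨Φ, hΦ (by simp), hΦ (by simp), hΦ (by simp)⟩

/-- The faces of ranks −1 and 3 lie in every flag, so distinct flags can differ only at ranks 0, 1,
2. -/
theorem flagAdj_rank (hP : P.IsFlagGraded) {i : ℤ} {A B : Flag P.Face}
    (h : P.FlagAdj i A B) : 0 ≤ i ∧ i ≤ 2 := by
  by_contra hi
  refine h.1 (hP.flag_ext fun x hx h0 h2 => ?_)
  exact (h.2 x (by rintro rfl; exact hi ⟨h0, h2⟩)).1 hx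

theorem _root_.RankedPoset.FlagAdj.ne_of_mem {i : ℤ} {A B : Flag P.Face} (h : P.FlagAdj i A B)
    {a b : P.Face}
    (ha : a ∈ A) (hb : b ∈ B) (hai : P.rank a = i) : a ≠ b := by
  rintro rfl
  refine h.1 (flag_eq_of_subset fun x hx => ?_)
  by_cases hxi : P.rank x = i
  · rwa [flag_eq_of_rank_eq hx ha (hxi.trans hai.symm)]
  · exact (h.2 x hxi).1 hx

theorem flagAdj_of (hP : P.IsFlagGraded) {i : ℤ} {A B : Flag P.Face} {a : P.Face} (ha : a ∈ A)
    (hb : a ∉ B)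
    (h : ∀ x ∈ A, P.rank x ≠ i → x ∈ B) : P.FlagAdj i A B := by
  refine ⟨by rintro rfl; exact hb ha, fun x hx => ⟨fun hxA => h x hxA hx, fun hxB => ?_⟩⟩
  obtain ⟨y, hy, hyx⟩ := hP.exists_mem A (hP.rank_mem x).1 (hP.rank_mem x).2
  rwa [← flag_eq_of_rank_eq (h y hy (hyx ▸ hx)) hxB hyx]

theorem _root_.RankedPoset.FlagAdj.symm {i : ℤ} {A B : Flag P.Face}
    (h : P.FlagAdj i A B) : P.FlagAdj i B A :=
  ⟨h.1.symm, fun x hx => (h.2 x hx).symm⟩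

end IsFlagGraded

namespace IsPolyhedron

/-- A diamond has two middle faces, one of which is `a`; both `x` and `y` are the other one. This is
the uniqueness of the `i`-adjacent flag, in a form that applies to images under automorphisms. -/
theorem eq_of_between (hP : P.IsPolyhedron) {A : Flag P.Face} {i : ℤ} (h0 : 0 ≤ i) (h2 : i ≤ 2)
    {a x y : P.Face}
    (ha : a ∈ A) (hai : P.rank a = i)
    (hx : ∀ c ∈ A, (P.rank c = i - 1 → c < x) ∧ (P.rank c = i + 1 → x < c)) (hxa : x ≠ a)
    (hy : ∀ c ∈ A, (P.rank c = i - 1 → c < y) ∧ (P.rank c = i + 1 → y < c)) (hya : y ≠ a) :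
    x = y := by
  obtain ⟨F, hF, hFi⟩ := hP.isFlagGraded.exists_mem A (i := i - 1) (by omega) (by omega)
  obtain ⟨G, hG, hGi⟩ := hP.isFlagGraded.exists_mem A (i := i + 1) (by omega) (by omega)
  have h := hP.diamond F G (flag_lt_of_rank_lt hF hG (by omega)) (by omega)
  obtain ⟨p, q, -, hpq⟩ := Set.encard_eq_two.1 h
  have h1 : a ∈ ({p, q} : Set P.Face) := hpq ▸
    ⟨flag_lt_of_rank_lt hF ha (by omega), flag_lt_of_rank_lt ha hG (by omega)⟩
  have h2 : x ∈ ({p, q} : Set P.Face) := hpq ▸ ⟨(hx F hF).1 hFi, (hx G hG).2 hGi⟩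
  have h3 : y ∈ ({p, q} : Set P.Face) := hpq ▸ ⟨(hy F hF).1 hFi, (hy G hG).2 hGi⟩
  simp only [Set.mem_insert_iff, Set.mem_singleton_iff] at h1 h2 h3
  grind

theorem _root_.RankedPoset.flag_between_of_mem {A B : Flag P.Face} {i : ℤ}
    (hAB : ∀ x ∈ A, P.rank x ≠ i → x ∈ B)
    {b : P.Face} (hb : b ∈ B) (hbi : P.rank b = i) :
    ∀ c ∈ A, (P.rank c = i - 1 → c < b) ∧ (P.rank c = i + 1 → b < c) := fun c hc =>
  ⟨fun h => flag_lt_of_rank_lt (hAB c hc (by omega)) hb (by omega),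
    fun h => flag_lt_of_rank_lt hb (hAB c hc (by omega)) (by omega)⟩

theorem exists_flagAdj (hP : P.IsPolyhedron) (A : Flag P.Face) {i : ℤ} (h0 : 0 ≤ i) (h2 : i ≤ 2) :
    ∃ B, P.FlagAdj i A B := by
  have hG := hP.isFlagGraded
  obtain ⟨a, ha, hai⟩ := hG.exists_mem A (i := i) (by omega) (by omega)
  obtain ⟨F, hF, hFi⟩ := hG.exists_mem A (i := i - 1) (by omega) (by omega)
  obtain ⟨G, hG', hGi⟩ := hG.exists_mem A (i := i + 1) (by omega) (by omega)
  have h := hP.diamond F G (flag_lt_of_rank_lt hF hG' (by omega)) (by omega)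
  obtain ⟨b, hb, hba⟩ : ∃ b ∈ {H : P.Face | F < H ∧ H < G}, b ≠ a :=
    Set.exists_ne_of_one_lt_encard (by rw [h]; norm_num) a
  have hbi : P.rank b = i := by
    have := P.rank_strictMono hb.1
    have := P.rank_strictMono hb.2
    omega
  -- Exchange `a` for the other middle face `b` of its diamond; the new chain extends to a flag.
  have hc : IsChain (· ≤ ·) (insert b {x | x ∈ A ∧ P.rank x ≠ i}) := by
    refine IsChain.insert (A.chain_le.mono fun x hx => hx.1) fun x hx _ => ?_
    rcases lt_or_gt_of_ne hx.2 with hlt | hgt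
    · exact Or.inr ((flag_le_of_rank_le hx.1 hF (by omega)).trans hb.1.le)
    · exact Or.inl (hb.2.le.trans (flag_le_of_rank_le hG' hx.1 (by omega)))
  obtain ⟨B, hB⟩ := hc.exists_subset_flag
  refine ⟨B, hG.flagAdj_of ha (fun haB => hba ?_) fun x hx hxi => hB (Or.inr ⟨hx, hxi⟩)⟩
  exact flag_eq_of_rank_eq (hB (Or.inl rfl)) haB (hbi.trans hai.symm)

/-- An automorphism that fixes a flag is the identity. -/
theorem eq_one_of_fix_flag (hP : P.IsPolyhedron) {Φ : Flag P.Face} {g : P.Face ≃o P.Face}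
    (h : ∀ x ∈ Φ, g x = x) : g = 1 := by
  have hG := hP.isFlagGraded
  have key : ∀ Ψ : Flag P.Face, ∀ x ∈ Ψ, g x = x := by
    intro Ψ
    have hpath : Relation.ReflTransGen (fun A B : Flag P.Face => ∃ i : ℤ, P.FlagAdj i A B) Φ Ψ :=
      Relation.ReflTransGen.mono (fun _ _ h => h.1) _ _ (hP.strongly_connected Φ Ψ)
    induction hpath with
    | refl => exact h
    | @tail A B _ hAB ih =>
      obtain ⟨i, hi⟩ := hAB
      obtain ⟨h0, h2⟩ := hG.flagAdj_rank hi
      intro x hx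
      by_cases hxi : P.rank x = i
      · obtain ⟨a, ha, hai⟩ := hG.exists_mem A (i := i) (by omega) (by omega)
        have hbt := flag_between_of_mem (fun y hy hyi => (hi.2 y hyi).1 hy) hx hxi
        -- `g` fixes `a` and the faces next to it in `A`, so `g x` and `x` are both the second
        -- middle face of one diamond.
        refine hP.eq_of_between h0 h2 ha hai (fun c hc => ?_) ?_ hbt
          (hi.ne_of_mem ha hx hai).symm
        · obtain ⟨h1, h2⟩ := hbt c hc
          exact ⟨fun hr => by simpa only [ih c hc] using g.lt_iff_lt.2 (h1 hr),
            fun hr => by simpa only [ih c hc] using g.lt_iff_lt.2 (h2 hr)⟩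
        · intro hgx
          exact hi.ne_of_mem ha hx hai (g.injective ((ih a ha).trans hgx.symm))
      · exact ih x ((hi.2 x hxi).2 hx)
  ext x
  obtain ⟨Ψ, hΨ⟩ := Flag.exists_mem x
  exact key Ψ x hΨ

end IsPolyhedron

/-- The automorphisms `r i` carry the flag `Φ` to its adjacent flags. -/
structure IsGenerators (P : RankedPoset.{u}) (Φ : Flag P.Face)
    (r : Fin 3 → (P.Face ≃o P.Face)) : Prop where
  mem : ∀ i, r i ∈ P.autGroup
  fix : ∀ i : Fin 3, ∀ x ∈ Φ, P.rank x ≠ (i : ℕ) → r i x = x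
  move : ∀ i : Fin 3, ∀ x ∈ Φ, P.rank x = (i : ℕ) → r i x ≠ x

variable {Φ : Flag P.Face} {r : Fin 3 → (P.Face ≃o P.Face)}

theorem IsRegular.exists_isGenerators (hP : P.IsPolyhedron) (hR : P.IsRegular)
    (Φ : Flag P.Face) : ∃ r, P.IsGenerators Φ r := by
  have : ∀ i : Fin 3, ∃ g ∈ P.autGroup, (∀ x ∈ Φ, P.rank x ≠ (i : ℕ) → g x = x) ∧
      ∀ x ∈ Φ, P.rank x = (i : ℕ) → g x ≠ x := by
    intro i
    obtain ⟨Ψ, hΨ⟩ := hP.exists_flagAdj Φ (i := (i : ℕ)) (by omega) (by omega)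
    obtain ⟨g, hg, hgΨ⟩ := hR Φ Ψ
    refine ⟨g, hg, fun x hx hxi => ?_, fun x hx hxi => ?_⟩
    · exact flag_eq_of_rank_eq ((hgΨ x).1 hx) ((hΨ.2 x hxi).1 hx) (hg x)
    · exact (hΨ.ne_of_mem hx ((hgΨ x).1 hx) hxi).symm
  choose r h1 h2 h3 using this
  exact ⟨r, h1, h2, h3⟩

namespace IsGenerators

/-- A subgroup that contains the generators which fix the face `x₀` of the base flag is transitive
on the flags through `x₀`. -/
theorem exists_map_eq (hP : P.IsPolyhedron) (hr : P.IsGenerators Φ r)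
    {H : Subgroup (P.Face ≃o P.Face)} {x₀ : P.Face} (hx₀ : x₀ ∈ Φ)
    (hH : ∀ i : Fin 3, P.rank x₀ ≠ (i : ℕ) → r i ∈ H) {Ψ : Flag P.Face} (hΨ : x₀ ∈ Ψ) :
    ∃ h ∈ H, h ∈ P.autGroup ∧ ∀ x ∈ Φ, h x ∈ Ψ := by
  have hG := hP.isFlagGraded
  have hpath := hP.strongly_connected Φ Ψ
  suffices hs : ∀ B : Flag P.Face, Relation.ReflTransGen (fun A B : Flag P.Face =>
        (∃ i : ℤ, P.FlagAdj i A B) ∧ ∀ x : P.Face, x ∈ Φ → x ∈ Ψ → x ∈ B) Φ B →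
      x₀ ∈ B ∧ ∃ h ∈ H, h ∈ P.autGroup ∧ ∀ x ∈ Φ, h x ∈ B from (hs Ψ hpath).2
  intro B hB
  induction hB with
  | refl => exact ⟨hx₀, 1, H.one_mem, P.autGroup.one_mem, fun x hx => hx⟩
  | @tail A B _ hAB ih =>
    obtain ⟨hxA, h, hh, hha, hA⟩ := ih
    obtain ⟨⟨i, hi⟩, hB⟩ := hAB
    have hxB := hB x₀ hx₀ hΨ
    refine ⟨hxB, ?_⟩
    obtain ⟨h0, h2⟩ := hG.flagAdj_rank hi
    -- Strong connectivity keeps `x₀` in every flag of the path, so only generators in `H` are used.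
    have hne : P.rank x₀ ≠ i := fun hxi => hi.ne_of_mem hxA hxB hxi rfl
    obtain ⟨j, rfl⟩ : ∃ j : Fin 3, i = ((j : ℕ) : ℤ) :=
      ⟨⟨i.toNat, by omega⟩, by simp only; omega⟩
    -- The `j`-adjacent flag of `h Φ` is the image under `h` of the `j`-adjacent flag of `Φ`, so the
    -- new generator enters on the right.
    refine ⟨h * r j, H.mul_mem hh (hH j hne), P.autGroup.mul_mem hha (hr.mem j), fun x hx => ?_⟩
    change h (r j x) ∈ B
    by_cases hxj : P.rank x = (j : ℕ)
    · obtain ⟨b, hb, hbj⟩ := hG.exists_mem B (i := (j : ℕ)) (by omega) (by omega)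
      have hhx : P.rank (h x) = (j : ℕ) := (hha x).trans hxj
      have : h (r j x) = b := by
        refine hP.eq_of_between h0 h2 (hA x hx) hhx (fun c hc => ?_) ?_
          (flag_between_of_mem (fun y hy hyi => (hi.2 y hyi).1 hy) hb hbj)
          (hi.ne_of_mem (hA x hx) hb hhx).symm
        · obtain ⟨d, hd, hdc⟩ := hG.exists_mem Φ (hG.rank_mem c).1 (hG.rank_mem c).2
          obtain rfl : h d = c := flag_eq_of_rank_eq (hA d hd) hc ((hha d).trans hdc)
          rw [h.lt_iff_lt, h.lt_iff_lt]
          refine ⟨fun hr' => ?_, fun hr' => ?_⟩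
          · have : P.rank d ≠ (j : ℕ) := by omega
            have h3 := (r j).lt_iff_lt.2 (flag_lt_of_rank_lt hd hx (by omega))
            rwa [hr.fix j d hd this] at h3
          · have : P.rank d ≠ (j : ℕ) := by omega
            have h3 := (r j).lt_iff_lt.2 (flag_lt_of_rank_lt hx hd (by omega))
            rwa [hr.fix j d hd this] at h3
        · exact fun he => hr.move j x hx hxj (h.injective he)
      rwa [this]
    · rw [hr.fix j x hx hxj]
      exact (hi.2 _ (by rwa [hha x])).1 (hA x hx)

/-- The flag `g Φ` passes through `x₀`, so some `h` in `H` carries `Φ` to it; then `h⁻¹ * g` fixes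
`Φ`. In other words, face stabilizers are generated by the distinguished generators they contain. -/
theorem mem_of_fix (hP : P.IsPolyhedron) (hr : P.IsGenerators Φ r)
    {H : Subgroup (P.Face ≃o P.Face)} {x₀ : P.Face} (hx₀ : x₀ ∈ Φ)
    (hH : ∀ i : Fin 3, P.rank x₀ ≠ (i : ℕ) → r i ∈ H) {g : P.Face ≃o P.Face}
    (hg : g ∈ P.autGroup) (hgx : g x₀ = x₀) : g ∈ H := by
  obtain ⟨h, hh, hha, hm⟩ := hr.exists_map_eq hP hx₀ hH (Ψ := Flag.map g Φ) ⟨x₀, hx₀, hgx⟩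
  have : h⁻¹ * g = 1 := by
    refine hP.eq_one_of_fix_flag (Φ := Φ) fun x hx => ?_
    have : h x = g x := flag_eq_of_rank_eq (hm x hx) ⟨x, hx, rfl⟩ ((hha x).trans (hg x).symm)
    change h.symm (g x) = x
    rw [← this, h.symm_apply_apply]
  rwa [← inv_mul_eq_one.1 this]

theorem exists_aut (hP : P.IsPolyhedron) (hr : P.IsGenerators Φ r) (Ψ : Flag P.Face) :
    ∃ h ∈ P.autGroup, ∀ x ∈ Φ, h x ∈ Ψ := by
  obtain ⟨x, hx, -⟩ := hP.existsUnique_least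
  obtain ⟨h, -, h1, h2⟩ := hr.exists_map_eq hP (H := ⊤) (hP.isFlagGraded.least_mem hx Φ)
    (fun i _ => Subgroup.mem_top _) (hP.isFlagGraded.least_mem hx Ψ)
  exact ⟨h, h1, h2⟩

theorem isRegular (hP : P.IsPolyhedron) (hr : P.IsGenerators Φ r) : P.IsRegular := by
  intro A B
  obtain ⟨g, hg, hgA⟩ := hr.exists_aut hP A
  obtain ⟨h, hh, hhB⟩ := hr.exists_aut hP B
  have h1 : Flag.map g Φ = A := flag_eq_of_subset (by rintro _ ⟨x, hx, rfl⟩; exact hgA x hx)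
  have h2 : Flag.map h Φ = B := flag_eq_of_subset (by rintro _ ⟨x, hx, rfl⟩; exact hhB x hx)
  subst h1 h2
  refine ⟨h * g⁻¹, P.autGroup.mul_mem hh (P.autGroup.inv_mem hg), fun x => ⟨?_, ?_⟩⟩
  · rintro ⟨y, hy, rfl⟩
    refine ⟨y, hy, ?_⟩
    change h y = h (g.symm (g y))
    rw [g.symm_apply_apply]
  · rintro ⟨y, hy, hyx⟩
    refine ⟨y, hy, ?_⟩
    have : y = g.symm x := h.injective hyx
    rw [this]
    exact g.apply_symm_apply x

end IsGenerators

end Flags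

end RankedPoset

namespace RankedPoset

/-! ### Reconstruction of a polyhedron from its generators on the vertices -/

section Iso

variable {P : RankedPoset.{u}} {Q : RankedPoset.{v}}

/-- The action of the automorphisms on the vertices. -/
def vertexPerm (P : RankedPoset.{u}) : P.autGroup →* Equiv.Perm P.vertices where
  toFun g := Equiv.Perm.subtypePerm g.1.toEquiv fun x => by
    change P.rank (g.1 x) = 0 ↔ P.rank x = 0
    rw [g.2 x]
  map_one' := rfl
  map_mul' _ _ := rfl

@[simp] theorem coe_vertexPerm (g : P.autGroup) (x : P.vertices) :
    (P.vertexPerm g x : P.Face) = g.1 x := rfl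

theorem IsVertexFaithful.vertexPerm_injective (h : P.IsVertexFaithful) :
    Function.Injective P.vertexPerm := by
  rw [injective_iff_map_eq_one]
  intro g hg
  refine Subtype.ext (h g.1 g.2 fun x hx => ?_)
  exact congrArg Subtype.val (DFunLike.congr_fun hg (⟨x, hx⟩ : P.vertices))

/-- The pairs of automorphisms that act in the same way on the vertices. -/
def matchedAut (f : P.vertices ≃ Q.vertices) : Subgroup (P.autGroup × Q.autGroup) where
  carrier := {g | ∀ x, f (P.vertexPerm g.1 x) = Q.vertexPerm g.2 (f x)}
  mul_mem' := by
    intro a b ha hb x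
    simp only [Prod.fst_mul, Prod.snd_mul, map_mul, Equiv.Perm.mul_apply]
    rw [ha, hb]
  one_mem' := fun x => rfl
  inv_mem' := by
    intro a ha x
    have := ha ((P.vertexPerm a.1).symm x)
    rw [Equiv.apply_symm_apply] at this
    simp only [Prod.fst_inv, Prod.snd_inv, map_inv]
    change f ((P.vertexPerm a.1).symm x) = (Q.vertexPerm a.2).symm (f x)
    rw [this, Equiv.symm_apply_apply]

theorem mem_matchedAut {f : P.vertices ≃ Q.vertices} {g : P.autGroup × Q.autGroup} :
    g ∈ matchedAut f ↔ ∀ x, f (P.vertexPerm g.1 x) = Q.vertexPerm g.2 (f x) := Iff.rfl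

theorem matchedAut_symm {f : P.vertices ≃ Q.vertices} {g : P.autGroup × Q.autGroup}
    (hg : g ∈ matchedAut f) : g.swap ∈ matchedAut f.symm := by
  rw [mem_matchedAut] at hg ⊢
  intro x
  have := hg (f.symm x)
  rw [f.apply_symm_apply] at this
  simp only [Prod.fst_swap, Prod.snd_swap]
  rw [← this, f.symm_apply_apply]

/-- The relation between the faces of two polyhedra that carries base faces to base faces and is
compatible with the matched pairs of automorphisms. -/
def MatchedFaces (Φ : Flag P.Face) (Ψ : Flag Q.Face) (f : P.vertices ≃ Q.vertices)
    (x : P.Face) (y : Q.Face) : Prop :=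
  ∃ g ∈ matchedAut f, ∃ x₀ ∈ Φ, ∃ y₀ ∈ Ψ, P.rank x₀ = Q.rank y₀ ∧ g.1.1 x₀ = x ∧ g.2.1 y₀ = y

variable {Φ : Flag P.Face} {Ψ : Flag Q.Face} {r : Fin 3 → (P.Face ≃o P.Face)}
  {s : Fin 3 → (Q.Face ≃o Q.Face)} {f : P.vertices ≃ Q.vertices}

theorem MatchedFaces.symm {x : P.Face} {y : Q.Face} (h : MatchedFaces Φ Ψ f x y) :
    MatchedFaces Ψ Φ f.symm y x := by
  obtain ⟨g, hg, x₀, hx, y₀, hy, h1, h2, h3⟩ := h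
  exact ⟨g.swap, matchedAut_symm hg, y₀, hy, x₀, hx, h1.symm, h3, h2⟩

theorem MatchedFaces.rank_eq {x : P.Face} {y : Q.Face} (h : MatchedFaces Φ Ψ f x y) :
    Q.rank y = P.rank x := by
  obtain ⟨g, hg, x₀, hx, y₀, hy, h1, rfl, rfl⟩ := h
  rw [rank_apply g.1.2, rank_apply g.2.2, h1]

/-- The first components of the matched pairs whose second component fixes `y₀` form a subgroup. It
contains each generator that fixes `x₀`, hence the whole stabilizer of `x₀`. -/
theorem exists_matched_fix (hP : P.IsPolyhedron) (hr : P.IsGenerators Φ r)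
    (hs : Q.IsGenerators Ψ s)
    (hf : ∀ i, (⟨⟨r i, hr.mem i⟩, ⟨s i, hs.mem i⟩⟩ : P.autGroup × Q.autGroup) ∈ matchedAut f)
    {x₀ : P.Face} {y₀ : Q.Face} (hx : x₀ ∈ Φ) (hy : y₀ ∈ Ψ) (hxy : P.rank x₀ = Q.rank y₀)
    {g : P.autGroup}
    (hg : g.1 x₀ = x₀) : ∃ h : Q.autGroup, (g, h) ∈ matchedAut f ∧ h.1 y₀ = y₀ := by
  let K : Subgroup (P.autGroup × Q.autGroup) :=
    matchedAut f ⊓ (MulAction.stabilizer (Q.Face ≃o Q.Face) y₀).comap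
      (Q.autGroup.subtype.comp (MonoidHom.snd _ _))
  have := hr.mem_of_fix hP (H := K.map (P.autGroup.subtype.comp (MonoidHom.fst _ _))) hx
    (fun i hi => ⟨(⟨r i, hr.mem i⟩, ⟨s i, hs.mem i⟩), ⟨hf i, hs.fix i y₀ hy
    (hxy ▸ hi)⟩, rfl⟩) g.2 hg
  obtain ⟨k, ⟨hk1, hk2⟩, hk⟩ := this
  obtain rfl : k.1 = g := Subtype.ext hk
  exact ⟨k.2, hk1, hk2⟩

/-- Faithfulness of `Q` makes the partner of an automorphism of `P` unique, so `g.2` is the partner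
that `exists_matched_fix` provides. -/
theorem matched_fix (hP : P.IsPolyhedron) (hQ : Q.IsVertexFaithful) (hr : P.IsGenerators Φ r)
    (hs : Q.IsGenerators Ψ s)
    (hf : ∀ i, (⟨⟨r i, hr.mem i⟩, ⟨s i, hs.mem i⟩⟩ : P.autGroup × Q.autGroup) ∈ matchedAut f)
    {x₀ : P.Face} {y₀ : Q.Face} (hx : x₀ ∈ Φ) (hy : y₀ ∈ Ψ) (hxy : P.rank x₀ = Q.rank y₀)
    {g : P.autGroup × Q.autGroup} (hg : g ∈ matchedAut f) (hgx : g.1.1 x₀ = x₀) :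
    g.2.1 y₀ = y₀ := by
  obtain ⟨h, hh, hhy⟩ := exists_matched_fix hP hr hs hf hx hy hxy hgx
  have : h = g.2 := by
    refine hQ.vertexPerm_injective (Equiv.ext fun y => ?_)
    obtain ⟨x, rfl⟩ := f.surjective y
    rw [← mem_matchedAut.1 hg, ← mem_matchedAut.1 hh]
  rwa [this] at hhy

/-- Every automorphism fixes the least face, so `exists_matched_fix` taken there gives each
automorphism a partner, in particular one that carries `Φ` to `A`. -/
theorem MatchedFaces.exists_right (hP : P.IsPolyhedron) (hQ : Q.IsPolyhedron)
    (hr : P.IsGenerators Φ r) (hs : Q.IsGenerators Ψ s)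
    (hf : ∀ i, (⟨⟨r i, hr.mem i⟩, ⟨s i, hs.mem i⟩⟩ : P.autGroup × Q.autGroup) ∈ matchedAut f)
    {A : Flag P.Face} : ∃ g ∈ matchedAut f, ∀ x ∈ A, ∃ x₀ ∈ Φ, ∃ y₀ ∈ Ψ,
      P.rank x₀ = Q.rank y₀ ∧ g.1.1 x₀ = x := by
  obtain ⟨g, hg, hgA⟩ := hr.exists_aut hP A
  obtain ⟨x₁, hx₁, -⟩ := hP.existsUnique_least
  obtain ⟨y₁, hy₁, -⟩ := hQ.existsUnique_least
  have hgx : g x₁ = x₁ := flag_eq_of_rank_eq (hgA x₁ (hP.isFlagGraded.least_mem hx₁ Φ))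
    (hP.isFlagGraded.least_mem hx₁ A) (hg x₁)
  obtain ⟨h, hh, -⟩ := exists_matched_fix hP hr hs hf (hP.isFlagGraded.least_mem hx₁ Φ)
    (hQ.isFlagGraded.least_mem hy₁ Ψ) (hx₁.trans hy₁.symm) (g := ⟨g, hg⟩) hgx
  refine ⟨_, hh, fun x hx => ?_⟩
  have hm := hP.rank_mem x
  obtain ⟨x₀, hx₀, hxr⟩ := hP.isFlagGraded.exists_mem Φ hm.1 hm.2
  obtain ⟨y₀, hy₀, hyr⟩ := hQ.isFlagGraded.exists_mem Ψ hm.1 hm.2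
  exact ⟨x₀, hx₀, y₀, hy₀, hxr.trans hyr.symm,
    flag_eq_of_rank_eq (hgA x₀ hx₀) hx ((hg x₀).trans hxr)⟩

/-- Two matched pairs that agree at `x₀` in their first components differ by a pair fixing `x₀`, and
by `matched_fix` this pair also fixes `y₀`. -/
theorem MatchedFaces.eq_of_left (hP : P.IsPolyhedron) (hQ : Q.IsVertexFaithful)
    (hr : P.IsGenerators Φ r) (hs : Q.IsGenerators Ψ s)
    (hf : ∀ i, (⟨⟨r i, hr.mem i⟩, ⟨s i, hs.mem i⟩⟩ : P.autGroup × Q.autGroup) ∈ matchedAut f)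
    {g : P.autGroup × Q.autGroup} (hg : g ∈ matchedAut f) {x₀ : P.Face} {y₀ y : Q.Face}
    (hx : x₀ ∈ Φ) (hy : y₀ ∈ Ψ) (hxy : P.rank x₀ = Q.rank y₀)
    (h : MatchedFaces Φ Ψ f (g.1.1 x₀) y) : y = g.2.1 y₀ := by
  obtain ⟨k, hk, x₁, hx₁, y₁, hy₁, h1, h2, rfl⟩ := h
  have hr' : P.rank x₁ = P.rank x₀ := by
    rw [← rank_apply k.1.2 x₁, ← rank_apply g.1.2 x₀, h2]
  obtain rfl := flag_eq_of_rank_eq hx₁ hx hr'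
  obtain rfl := flag_eq_of_rank_eq hy₁ hy (h1.symm.trans hxy)
  have := matched_fix hP hQ hr hs hf hx hy hxy
    ((matchedAut f).mul_mem ((matchedAut f).inv_mem hg) hk) (by
      change g.1.1.symm (k.1.1 x₁) = x₁
      rw [h2, OrderIso.symm_apply_apply])
  change g.2.1.symm (k.2.1 y₁) = y₁ at this
  rw [OrderIso.symm_apply_eq] at this
  exact this

/-- A flag through both faces is moved back to the base flag by a single matched pair, and within a
flag the order is that of the ranks. The case `x = x'`, used in both directions, also shows that the
relation is single-valued. -/
theorem MatchedFaces.le_of_le (hP : P.IsPolyhedron) (hQ : Q.IsPolyhedron)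
    (hQf : Q.IsVertexFaithful) (hr : P.IsGenerators Φ r) (hs : Q.IsGenerators Ψ s)
    (hf : ∀ i, (⟨⟨r i, hr.mem i⟩, ⟨s i, hs.mem i⟩⟩ : P.autGroup × Q.autGroup) ∈ matchedAut f)
    {x x' : P.Face} {y y' : Q.Face} (h : MatchedFaces Φ Ψ f x y) (h' : MatchedFaces Φ Ψ f x' y')
    (hx : x ≤ x') : y ≤ y' := by
  obtain ⟨A, hA, hA'⟩ := Flag.exists_mem_mem hx
  obtain ⟨g, hg, hgA⟩ := MatchedFaces.exists_right hP hQ hr hs hf (A := A)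
  obtain ⟨x₀, hx₀, y₀, hy₀, h1, rfl⟩ := hgA x hA
  obtain ⟨x₁, hx₁, y₁, hy₁, h2, rfl⟩ := hgA x' hA'
  rw [h.eq_of_left hP hQf hr hs hf hg hx₀ hy₀ h1, h'.eq_of_left hP hQf hr hs hf hg hx₁ hy₁ h2]
  rw [OrderIso.le_iff_le]
  refine flag_le_of_rank_le hy₀ hy₁ ?_
  rw [← h1, ← h2]
  exact P.rank_strictMono.monotone (g.1.1.le_iff_le.1 hx)

/-- Vertex-faithful polyhedra whose distinguished generators act in the same way on the vertices are
isomorphic. -/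
theorem isIsomorphic_of_vertices (hP : P.IsPolyhedron) (hQ : Q.IsPolyhedron)
    (hPf : P.IsVertexFaithful) (hQf : Q.IsVertexFaithful) (hr : P.IsGenerators Φ r)
    (hs : Q.IsGenerators Ψ s) (f : P.vertices ≃ Q.vertices)
    (hf : ∀ i x, f (P.vertexPerm ⟨r i, hr.mem i⟩ x) = Q.vertexPerm ⟨s i, hs.mem i⟩ (f x)) :
    P.IsIsomorphic Q := by
  replace hf : ∀ i, (⟨⟨r i, hr.mem i⟩, ⟨s i, hs.mem i⟩⟩ : P.autGroup × Q.autGroup) ∈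
      matchedAut f := fun i => mem_matchedAut.2 (hf i)
  have hf' : ∀ i, (⟨⟨s i, hs.mem i⟩, ⟨r i, hr.mem i⟩⟩ : Q.autGroup × P.autGroup) ∈
      matchedAut f.symm := fun i => matchedAut_symm (hf i)
  have h1 : ∀ x, ∃ y, MatchedFaces Φ Ψ f x y := by
    intro x
    obtain ⟨A, hA⟩ := Flag.exists_mem x
    obtain ⟨g, hg, hgA⟩ := MatchedFaces.exists_right hP hQ hr hs hf (A := A)
    obtain ⟨x₀, hx₀, y₀, hy₀, h1, rfl⟩ := hgA x hA
    exact ⟨_, g, hg, x₀, hx₀, y₀, hy₀, h1, rfl, rfl⟩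
  have h2 : ∀ y, ∃ x, MatchedFaces Φ Ψ f x y := by
    intro y
    obtain ⟨A, hA⟩ := Flag.exists_mem y
    obtain ⟨g, hg, hgA⟩ := MatchedFaces.exists_right hQ hP hs hr hf' (A := A)
    obtain ⟨x₀, hx₀, y₀, hy₀, h1, rfl⟩ := hgA y hA
    exact ⟨_, MatchedFaces.symm ⟨g, hg, x₀, hx₀, y₀, hy₀, h1, rfl, rfl⟩⟩
  choose F hF using h1
  choose G hG using h2
  refine ⟨⟨⟨F, G, fun x => ?_, fun y => ?_⟩, fun {x y} => ⟨fun h => ?_, fun h => ?_⟩⟩,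
    fun x => (hF x).rank_eq⟩
  · exact le_antisymm ((hG _).symm.le_of_le hQ hP hPf hs hr hf' (hF _).symm le_rfl)
      ((hF _).symm.le_of_le hQ hP hPf hs hr hf' (hG _).symm le_rfl)
  · exact le_antisymm ((hF _).le_of_le hP hQ hQf hr hs hf (hG _) le_rfl)
      ((hG _).le_of_le hP hQ hQf hr hs hf (hF _) le_rfl)
  · exact (hF x).symm.le_of_le hQ hP hPf hs hr hf' (hF y).symm h
  · exact (hF x).le_of_le hP hQ hQf hr hs hf (hF y) h

end Iso

/-! ### Invariance of all the properties under isomorphism -/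

section Transport

variable {P : RankedPoset.{u}} {Q : RankedPoset.{v}} {e : P.Face ≃o Q.Face}

theorem IsIsomorphic.symm (h : P.IsIsomorphic Q) : Q.IsIsomorphic P := by
  obtain ⟨e, he⟩ := h
  exact ⟨e.symm, fun x => by rw [← he, e.apply_symm_apply]⟩

theorem IsIsomorphic.trans {R : RankedPoset} (h : P.IsIsomorphic Q) (h' : Q.IsIsomorphic R) :
    P.IsIsomorphic R := by
  obtain ⟨e, he⟩ := h
  obtain ⟨e', he'⟩ := h'
  exact ⟨e.trans e', fun x => (he' _).trans (he x)⟩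

theorem rank_symm_apply (he : ∀ x, Q.rank (e x) = P.rank x) (y : Q.Face) :
    P.rank (e.symm y) = Q.rank y := by rw [← he, e.apply_symm_apply]

theorem mem_flagMap_iff {Φ : Flag P.Face} {y : Q.Face} : y ∈ Flag.map e Φ ↔ e.symm y ∈ Φ := by
  constructor
  · rintro ⟨x, hx, rfl⟩
    rwa [e.symm_apply_apply]
  · intro h
    exact ⟨_, h, e.apply_symm_apply y⟩

theorem existsUnique_rank (he : ∀ x, Q.rank (e x) = P.rank x) {i : ℤ}
    (h : ∃! x, P.rank x = i) : ∃! y, Q.rank y = i := by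
  obtain ⟨x, hx, hu⟩ := h
  refine ⟨e x, (he x).trans hx, fun y hy => ?_⟩
  rw [← hu (e.symm y) ((rank_symm_apply he y).trans hy), e.apply_symm_apply]

theorem IsIsomorphic.isPolyhedron (h : P.IsIsomorphic Q) (hP : P.IsPolyhedron) :
    Q.IsPolyhedron := by
  obtain ⟨e, he⟩ := h
  have he' := rank_symm_apply he
  refine ⟨fun y => he' y ▸ hP.rank_mem _, existsUnique_rank he hP.existsUnique_least,
    existsUnique_rank he hP.existsUnique_greatest, fun Φ i hi => ?_, fun Φ Ψ => ?_,
    fun F G hFG hr => ?_⟩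
  · obtain ⟨x, ⟨hx, hxi⟩, hu⟩ := hP.flag_rank (Flag.map e.symm Φ) i hi
    refine ⟨e x, ⟨mem_flagMap_iff.1 hx, (he x).trans hxi⟩, fun y hy => ?_⟩
    rw [← hu (e.symm y) ⟨⟨y, hy.1, rfl⟩, (he' y).trans hy.2⟩, e.apply_symm_apply]
  · have hp := hP.strongly_connected (Flag.map e.symm Φ) (Flag.map e.symm Ψ)
    have hΦ : ∀ Φ : Flag Q.Face, Flag.map e (Flag.map e.symm Φ) = Φ := fun Φ =>
      SetLike.ext fun y => by
        rw [mem_flagMap_iff, mem_flagMap_iff, OrderIso.symm_symm, e.apply_symm_apply]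
    rw [← hΦ Φ, ← hΦ Ψ]
    refine Relation.ReflTransGen.lift (Flag.map e) (fun A B hAB => ?_) _ _ hp
    obtain ⟨⟨i, hne, hi⟩, hB⟩ := hAB
    refine ⟨⟨i, (Flag.map e).injective.ne hne, fun y hy => ?_⟩, fun y h1 h2 => ?_⟩
    · rw [mem_flagMap_iff, mem_flagMap_iff]
      exact hi _ (by rwa [he'])
    · rw [mem_flagMap_iff] at h1 h2 ⊢
      exact hB _ h1 h2
  · have h := hP.diamond (e.symm F) (e.symm G) (e.symm.lt_iff_lt.2 hFG) (by rw [he', he', hr])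
    have : {H : Q.Face | F < H ∧ H < G} = e '' {H : P.Face | e.symm F < H ∧ H < e.symm G} := by
      ext y
      constructor
      · rintro ⟨h1, h2⟩
        exact ⟨e.symm y, ⟨e.symm.lt_iff_lt.2 h1, e.symm.lt_iff_lt.2 h2⟩, e.apply_symm_apply y⟩
      · rintro ⟨x, ⟨h1, h2⟩, rfl⟩
        exact ⟨e.symm_apply_lt.1 h1, e.lt_symm_apply.1 h2⟩
    rw [this, e.injective.encard_image, h]

theorem conj_mem_autGroup (he : ∀ x, Q.rank (e x) = P.rank x) {g : P.Face ≃o P.Face}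
    (hg : g ∈ P.autGroup) : (e.symm.trans g).trans e ∈ Q.autGroup := fun y => by
  change Q.rank (e (g (e.symm y))) = _
  rw [he, hg, rank_symm_apply he]

theorem IsIsomorphic.isRegular (h : P.IsIsomorphic Q) (hP : P.IsRegular) : Q.IsRegular := by
  obtain ⟨e, he⟩ := h
  intro Φ Ψ
  obtain ⟨g, hg, hgΦ⟩ := hP (Flag.map e.symm Φ) (Flag.map e.symm Ψ)
  refine ⟨_, conj_mem_autGroup he hg, fun y => ?_⟩
  have := hgΦ (e.symm y)
  rw [mem_flagMap_iff, mem_flagMap_iff, OrderIso.symm_symm, e.apply_symm_apply] at this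
  exact this

theorem IsIsomorphic.isVertexFaithful (h : P.IsIsomorphic Q) (hP : P.IsVertexFaithful) :
    Q.IsVertexFaithful := by
  obtain ⟨e, he⟩ := h
  have he' := rank_symm_apply he
  intro g hg hfix
  have h1 := hP _ (conj_mem_autGroup (e := e.symm) he' hg) fun x hx => by
    change e.symm (g (e x)) = x
    rw [hfix (e x) ((he x).trans hx), e.symm_apply_apply]
  ext y
  have h2 := congrArg e (DFunLike.congr_fun h1 (e.symm y))
  change e (e.symm (g (e (e.symm y)))) = e (e.symm y) at h2
  rw [OrderIso.apply_symm_apply, OrderIso.apply_symm_apply] at h2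
  exact h2

theorem IsIsomorphic.hasType {p q : ℕ∞} (h : P.IsIsomorphic Q) (hP : P.HasType p q) :
    Q.HasType p q := by
  obtain ⟨e, he⟩ := h
  have he' := rank_symm_apply he
  constructor
  · intro F hF
    rw [← hP.1 (e.symm F) ((he' F).trans hF), ← e.injective.encard_image]
    congr 1
    ext y
    constructor
    · rintro ⟨h1, h2⟩
      exact ⟨e.symm y, ⟨(he' y).trans h1, e.symm.lt_iff_lt.2 h2⟩, e.apply_symm_apply y⟩
    · rintro ⟨x, ⟨h1, h2⟩, rfl⟩
      exact ⟨(he x).trans h1, e.lt_symm_apply.1 h2⟩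
  · intro F hF
    rw [← hP.2 (e.symm F) ((he' F).trans hF), ← e.injective.encard_image]
    congr 1
    ext y
    constructor
    · rintro ⟨h1, h2⟩
      exact ⟨e.symm y, ⟨(he' y).trans h1, e.symm.lt_iff_lt.2 h2⟩, e.apply_symm_apply y⟩
    · rintro ⟨x, ⟨h1, h2⟩, rfl⟩
      exact ⟨(he x).trans h1, e.symm_apply_lt.1 h2⟩

theorem IsIsomorphic.encard_vertices (h : P.IsIsomorphic Q) :
    Q.vertices.encard = P.vertices.encard := by
  obtain ⟨e, he⟩ := h
  rw [← e.injective.encard_image]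
  congr 1
  ext y
  constructor
  · intro hy
    exact ⟨e.symm y, (rank_symm_apply he y).trans hy, e.apply_symm_apply y⟩
  · rintro ⟨x, hx, rfl⟩
    exact (he x).trans hx

end Transport

end RankedPoset

/-- Three permutations that act on a set of `q` points like the distinguished generators of a
vertex-faithful regular polyhedron of type `{p, q}` act on its vertices, the base vertex being
`v`. -/
structure IsRegularVertexAction {V : Type*} (r₀ r₁ r₂ : Equiv.Perm V) (v : V) (q : ℕ) : Prop where
  sq_zero : r₀ * r₀ = 1
  sq_one : r₁ * r₁ = 1
  sq_two : r₂ * r₂ = 1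
  comm : r₀ * r₂ = r₂ * r₀
  fix_one : r₁ v = v
  fix_two : r₂ v = v
  move_zero : r₀ v ≠ v
  stab : ∀ g ∈ Subgroup.closure {r₀, r₁, r₂}, g v = v →
    ∃ i : ℤ, g = (r₁ * r₂) ^ i ∨ g = (r₁ * r₂) ^ i * r₂
  trans : ∀ x, ∃ g ∈ Subgroup.closure {r₀, r₁, r₂}, g v = x
  orderOf_eq : orderOf (r₁ * r₂) = q
  card_eq : Nat.card V = q
  pos : 0 < q

/-! ### The permutation group on as many points as the valency -/

namespace IsRegularVertexAction

variable {V : Type*} {r₀ r₁ r₂ : Equiv.Perm V} {v : V} {q : ℕ}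

/-- The neighbours of the base vertex, in cyclic order. -/
def nbr (r₀ r₁ r₂ : Equiv.Perm V) (v : V) (i : ℤ) : V := ((r₁ * r₂) ^ i) (r₀ v)

theorem two_mul_rot (h : IsRegularVertexAction r₀ r₁ r₂ v q) (i : ℤ) :
    r₂ * (r₁ * r₂) ^ i = (r₁ * r₂) ^ (-i) * r₂ := by
  have h1 : SemiconjBy r₂ (r₁ * r₂) (r₁ * r₂)⁻¹ := by
    have e1 : (r₁ * r₂)⁻¹ = r₂ * r₁ := by
      rw [mul_inv_rev, eq_comm, ← mul_eq_one_iff_eq_inv.1 h.sq_one,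
        ← mul_eq_one_iff_eq_inv.1 h.sq_two]
    rw [e1, SemiconjBy, mul_assoc]
  have := h1.zpow_right i
  rwa [inv_zpow, ← zpow_neg] at this

theorem two_rot_apply (h : IsRegularVertexAction r₀ r₁ r₂ v q) (i : ℤ) (x : V) :
    r₂ (((r₁ * r₂) ^ i) x) = ((r₁ * r₂) ^ (-i)) (r₂ x) :=
  DFunLike.congr_fun (h.two_mul_rot i) x

theorem rot_fix (h : IsRegularVertexAction r₀ r₁ r₂ v q) (i : ℤ) : ((r₁ * r₂) ^ i) v = v := by
  have : r₁ * r₂ ∈ MulAction.stabilizer (Equiv.Perm V) v := by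
    change r₁ (r₂ v) = v
    rw [h.fix_two, h.fix_one]
  exact Subgroup.zpow_mem _ this i

theorem zero_zero (h : IsRegularVertexAction r₀ r₁ r₂ v q) (x : V) : r₀ (r₀ x) = x :=
  DFunLike.congr_fun h.sq_zero x

theorem two_zero (h : IsRegularVertexAction r₀ r₁ r₂ v q) (x : V) : r₂ (r₀ x) = r₀ (r₂ x) :=
  (DFunLike.congr_fun h.comm x).symm

theorem two_nbr (h : IsRegularVertexAction r₀ r₁ r₂ v q) (i : ℤ) :
    r₂ (nbr r₀ r₁ r₂ v i) = nbr r₀ r₁ r₂ v (-i) := by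
  rw [nbr, h.two_rot_apply, h.two_zero, h.fix_two, nbr]

theorem rot_nbr (i j : ℤ) :
    ((r₁ * r₂) ^ i) (nbr r₀ r₁ r₂ v j) = nbr r₀ r₁ r₂ v (i + j) := by
  rw [nbr, nbr, zpow_add, Equiv.Perm.mul_apply]

theorem nbr_ne (h : IsRegularVertexAction r₀ r₁ r₂ v q) (i : ℤ) : nbr r₀ r₁ r₂ v i ≠ v := by
  intro he
  rw [nbr] at he
  exact h.move_zero (((r₁ * r₂) ^ i).injective (he.trans (h.rot_fix i).symm))

/-- The exponents whose rotation fixes `r₀ v` form a subgroup of ℤ. It contains `q > 0`, so its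
generator is nonzero and divides `q`. -/
theorem exists_period (h : IsRegularVertexAction r₀ r₁ r₂ v q) :
    ∃ d : ℕ, 0 < d ∧ d ∣ q ∧ ∀ i j, nbr r₀ r₁ r₂ v i = nbr r₀ r₁ r₂ v j ↔ (d : ℤ) ∣ i - j := by
  let p : AddSubgroup ℤ :=
    { carrier := {i | ((r₁ * r₂) ^ i) (r₀ v) = r₀ v}
      zero_mem' := rfl
      add_mem' := by
        intro a b ha hb
        simp only [Set.mem_ofPred_eq] at *
        rw [zpow_add, Equiv.Perm.mul_apply, hb, ha]
      neg_mem' := by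
        intro a ha
        simp only [Set.mem_ofPred_eq] at *
        conv_lhs => rw [← ha]
        rw [← Equiv.Perm.mul_apply, ← zpow_add, neg_add_cancel]
        rfl }
  obtain ⟨c, hc⟩ := Int.subgroup_cyclic p
  have hmem : ∀ i, i ∈ p ↔ c ∣ i := fun i => by
    rw [hc, ← AddSubgroup.zmultiples_eq_closure, Int.mem_zmultiples_iff]
  have hq : c ∣ (q : ℤ) := by
    rw [← hmem]
    change ((r₁ * r₂) ^ (q : ℤ)) (r₀ v) = r₀ v
    rw [zpow_natCast, ← h.orderOf_eq, pow_orderOf_eq_one]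
    rfl
  refine ⟨c.natAbs, Int.natAbs_pos.2 ?_, Int.natCast_dvd_natCast.1 (by rwa [Int.natAbs_dvd]),
    fun i j => ?_⟩
  · rintro rfl
    have := h.pos
    rw [zero_dvd_iff] at hq
    omega
  · rw [Int.natAbs_dvd, ← hmem]
    change _ ↔ ((r₁ * r₂) ^ (i - j)) (r₀ v) = r₀ v
    rw [nbr, nbr, sub_eq_neg_add, zpow_add, Equiv.Perm.mul_apply, zpow_neg,
      Equiv.Perm.inv_eq_iff_eq, eq_comm]

/-- The cyclic group of `T` is normalized by the generators, hence normal in a transitive group;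
having one fixed point, it fixes every point. -/
theorem eq_one_of_conj_mem (h : IsRegularVertexAction r₀ r₁ r₂ v q) {T : Equiv.Perm V}
    (hv : ∀ i : ℤ, (T ^ i) v = v) (h0 : r₀ * T * r₀ ∈ Subgroup.zpowers T)
    (h1 : r₁ * T * r₁ ∈ Subgroup.zpowers T) (h2 : r₂ * T * r₂ ∈ Subgroup.zpowers T) : T = 1 := by
  have key : ∀ r : Equiv.Perm V, r * r = 1 → r * T * r ∈ Subgroup.zpowers T →
      r ∈ Subgroup.normalizer (Subgroup.zpowers T : Set (Equiv.Perm V)) := by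
    intro r hr hT
    have hinv : r⁻¹ = r := (mul_eq_one_iff_eq_inv.1 hr).symm
    have hall : ∀ g ∈ Subgroup.zpowers T, r * g * r⁻¹ ∈ Subgroup.zpowers T := by
      rintro _ ⟨i, rfl⟩
      change r * T ^ i * r⁻¹ ∈ _
      rw [← conj_zpow, hinv]
      exact Subgroup.zpow_mem _ hT i
    rw [Subgroup.mem_normalizer_iff]
    refine fun g => ⟨hall g, fun hg => ?_⟩
    have := hall _ hg
    rw [hinv] at this
    have e : r * (r * g * r) * r = g := by
      rw [mul_assoc r g r, ← mul_assoc r r, hr, one_mul, mul_assoc, hr, mul_one]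
    rwa [e] at this
  have hle : Subgroup.closure {r₀, r₁, r₂} ≤
      Subgroup.normalizer (Subgroup.zpowers T : Set (Equiv.Perm V)) := by
    rw [Subgroup.closure_le]
    rintro _ (rfl | rfl | rfl)
    exacts [key _ h.sq_zero h0, key _ h.sq_one h1, key _ h.sq_two h2]
  ext x
  obtain ⟨g, hg, rfl⟩ := h.trans x
  have hg' := Subgroup.inv_mem _ (hle hg)
  rw [Subgroup.mem_normalizer_iff] at hg'
  obtain ⟨i, hi⟩ := (hg' T).1 (Subgroup.mem_zpowers T)
  have h3 : (T ^ i) v = (g⁻¹ * T * g⁻¹⁻¹) v := DFunLike.congr_fun hi v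
  rw [hv, inv_inv, Equiv.Perm.mul_apply, Equiv.Perm.mul_apply, eq_comm,
    Equiv.Perm.inv_eq_iff_eq] at h3
  exact h3

/-- The base vertex and its `d` distinct neighbours are `d + 1` of the `q` points. So equality of
valency and number of vertices forces multiple edges. -/
theorem lt_of_period (h : IsRegularVertexAction r₀ r₁ r₂ v q) {d : ℕ}
    (hd : ∀ i j, nbr r₀ r₁ r₂ v i = nbr r₀ r₁ r₂ v j ↔ (d : ℤ) ∣ i - j) : d < q := by
  have : Finite V := Nat.finite_of_card_ne_zero (by rw [h.card_eq]; exact h.pos.ne')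
  let f : Option (Fin d) → V := fun o => o.elim v fun i => nbr r₀ r₁ r₂ v (i : ℕ)
  have hf : Function.Injective f := by
    rintro (_ | i) (_ | j) hij
    · rfl
    · exact absurd hij.symm (h.nbr_ne _)
    · exact absurd hij (h.nbr_ne _)
    · have h2 := Int.emod_eq_emod_iff_emod_sub_eq_zero.2 (Int.emod_eq_zero_of_dvd ((hd _ _).1 hij))
      rw [Int.emod_eq_of_lt (by omega) (by omega), Int.emod_eq_of_lt (by omega) (by omega)] at h2
      exact congrArg some (Fin.ext (by omega))
  have := Nat.card_le_card_of_injective f hf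
  rw [h.card_eq, Nat.card_eq_fintype_card, Fintype.card_option, Fintype.card_fin] at this
  omega

/-- Each vertex is joined to each of its neighbours by exactly two edges. -/
theorem exists_half (h : IsRegularVertexAction r₀ r₁ r₂ v q) :
    ∃ k : ℕ, 0 < k ∧ q = 2 * k ∧
      (∀ i j, nbr r₀ r₁ r₂ v i = nbr r₀ r₁ r₂ v j ↔ (k : ℤ) ∣ i - j) ∧
      r₀ * (r₁ * r₂) ^ k * r₀ = (r₁ * r₂) ^ k * r₂ := by
  obtain ⟨d, hd0, hdq, hd⟩ := h.exists_period
  have hlt := h.lt_of_period hd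
  set T := (r₁ * r₂) ^ d with hT
  have hTz : T = (r₁ * r₂) ^ (d : ℤ) := (zpow_natCast _ _).symm
  have hTne : T ≠ 1 := fun he => by
    have := orderOf_dvd_of_pow_eq_one he
    rw [h.orderOf_eq] at this
    exact absurd (Nat.le_of_dvd hd0 this) (not_le.2 hlt)
  have hTv : ∀ i : ℤ, (T ^ i) v = v := fun i => by
    rw [hTz, ← zpow_mul]
    exact h.rot_fix _
  have hTw : T (r₀ v) = r₀ v := by
    have := (hd d 0).2 (by simp)
    rw [nbr, nbr, zpow_zero] at this
    rw [hTz]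
    exact this
  have h2T : r₂ * T * r₂ = T⁻¹ := by
    rw [hTz, h.two_mul_rot, mul_assoc, h.sq_two, mul_one, zpow_neg]
  have h1T : r₁ * T * r₁ = T⁻¹ := by
    have e : r₁ = r₁ * r₂ * r₂ := by rw [mul_assoc, h.sq_two, mul_one]
    have e' : r₁ = r₂ * (r₁ * r₂)⁻¹ := by
      rw [mul_inv_rev, ← mul_eq_one_iff_eq_inv.1 h.sq_one, ← mul_eq_one_iff_eq_inv.1 h.sq_two,
        ← mul_assoc, h.sq_two, one_mul]
    have e2 : (r₁ * r₂)⁻¹ * T * (r₁ * r₂) = T := by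
      rw [hT, ((Commute.refl (r₁ * r₂)).pow_right d).inv_left.eq, inv_mul_cancel_right]
    calc r₁ * T * r₁ = r₂ * (r₁ * r₂)⁻¹ * T * (r₁ * r₂ * r₂) := by rw [← e, ← e']
      _ = r₂ * ((r₁ * r₂)⁻¹ * T * (r₁ * r₂)) * r₂ := by group
      _ = T⁻¹ := by rw [e2, h2T]
  -- Both `r₁` and `r₂` invert `T`, so only conjugation by `r₀` can prevent its cyclic group from
  -- being normal.
  have hnot : r₀ * T * r₀ ∉ Subgroup.zpowers T := fun hmem =>
    hTne (h.eq_one_of_conj_mem hTv hmem (h1T ▸ Subgroup.inv_mem _ (Subgroup.mem_zpowers T))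
      (h2T ▸ Subgroup.inv_mem _ (Subgroup.mem_zpowers T)))
  have hcl : r₀ * T * r₀ ∈ Subgroup.closure {r₀, r₁, r₂} := by
    have m0 : r₀ ∈ Subgroup.closure {r₀, r₁, r₂} := Subgroup.subset_closure (by simp)
    have m1 : r₁ ∈ Subgroup.closure {r₀, r₁, r₂} := Subgroup.subset_closure (by simp)
    have m2 : r₂ ∈ Subgroup.closure {r₀, r₁, r₂} := Subgroup.subset_closure (by simp)
    exact mul_mem (mul_mem m0 (pow_mem (mul_mem m1 m2) d)) m0
  obtain ⟨i, hi⟩ := h.stab _ hcl (by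
    rw [Equiv.Perm.mul_apply, Equiv.Perm.mul_apply, hTw, h.zero_zero])
  have hiw : ((r₁ * r₂) ^ i) (r₀ v) = r₀ v := by
    have e : (r₀ * T * r₀) (r₀ v) = r₀ v := by
      have := hTv 1
      rw [zpow_one] at this
      rw [Equiv.Perm.mul_apply, Equiv.Perm.mul_apply, h.zero_zero, this]
    rcases hi with hi | hi
    · rwa [hi] at e
    · rwa [hi, Equiv.Perm.mul_apply, h.two_zero, h.fix_two] at e
  -- The conjugate fixes `r₀ v` as well as `v`, which makes its rotation part a power of `T`.
  have hdi : (d : ℤ) ∣ i := by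
    have := (hd i 0).1 (by rw [nbr, nbr, hiw, zpow_zero]; rfl)
    rwa [sub_zero] at this
  obtain ⟨j, rfl⟩ := hdi
  rw [zpow_mul, ← hTz] at hi
  rcases hi with hi | hi
  · exact absurd ⟨j, hi.symm⟩ hnot
  -- `T` is conjugate to the reflection `T ^ j * r₂`, hence an involution.
  have hTT : T * T = 1 := by
    have e1 : (r₀ * T * r₀) * (r₀ * T * r₀) = r₀ * (T * T) * r₀ := by
      calc _ = r₀ * T * (r₀ * r₀) * T * r₀ := by group
        _ = _ := by rw [h.sq_zero]; group
    have e2 : (T ^ j * r₂) * (T ^ j * r₂) = 1 := by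
      have : r₂ * T ^ j = T ^ (-j) * r₂ := by
        rw [hTz, ← zpow_mul, h.two_mul_rot, ← zpow_mul, mul_neg]
      rw [mul_assoc, ← mul_assoc r₂, this, ← mul_assoc, ← mul_assoc, ← zpow_add, add_neg_cancel,
        zpow_zero, one_mul, h.sq_two]
    rw [hi, e2] at e1
    have e3 : r₀ * r₀ * (T * T) * (r₀ * r₀) = r₀ * (r₀ * (T * T) * r₀) * r₀ := by group
    rw [← e1, h.sq_zero, mul_one, one_mul, mul_one, h.sq_zero] at e3
    exact e3
  have hq : q = 2 * d := by
    have h1 : q ∣ 2 * d := by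
      rw [← h.orderOf_eq]
      refine orderOf_dvd_of_pow_eq_one ?_
      rw [two_mul, pow_add, ← hT, hTT]
    obtain ⟨m, rfl⟩ := hdq
    have h2 : m ∣ 2 := by
      rw [mul_comm] at h1
      exact Nat.dvd_of_mul_dvd_mul_right hd0 h1
    have hm := Nat.le_of_dvd two_pos h2
    have : m ≠ 0 := by rintro rfl; omega
    have : m ≠ 1 := by rintro rfl; omega
    have : m = 2 := by omega
    rw [this, mul_comm]
  refine ⟨d, hd0, hq, hd, ?_⟩
  rw [← hT, hi]
  obtain ⟨c, rfl | rfl⟩ := Int.even_or_odd' j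
  -- For even `j` the conjugate is `r₂`, which commutes with `r₀`; then `T` equals `r₂` and is its
  -- own conjugate, against `hnot`.
  · exfalso
    rw [zpow_mul, zpow_ofNat, pow_two, hTT, one_zpow, one_mul] at hi
    have : T = r₂ := by
      have e3 : r₀ * r₀ * T * (r₀ * r₀) = r₀ * (r₀ * T * r₀) * r₀ := by group
      rw [hi, h.sq_zero, mul_one, one_mul, h.comm, mul_assoc, h.sq_zero, mul_one] at e3
      exact e3
    exact hnot (hi ▸ this ▸ Subgroup.mem_zpowers _)
  · rw [zpow_add, zpow_mul, zpow_ofNat, pow_two, hTT, one_zpow, one_mul, zpow_one]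

section Half

variable {k : ℕ} (h : IsRegularVertexAction r₀ r₁ r₂ v q) (hk : 0 < k) (hq : q = 2 * k)
  (hper : ∀ i j, nbr r₀ r₁ r₂ v i = nbr r₀ r₁ r₂ v j ↔ (k : ℤ) ∣ i - j)
  (hz : r₀ * (r₁ * r₂) ^ k * r₀ = (r₁ * r₂) ^ k * r₂)
include hper

theorem half_nbr (i : ℤ) : ((r₁ * r₂) ^ k) (nbr r₀ r₁ r₂ v i) = nbr r₀ r₁ r₂ v i := by
  rw [← zpow_natCast, rot_nbr, hper]
  simp

include h hz

/-- Write T for the half rotation. The relation `hz` says T r₀ = r₀ T r₂; here r₂ reverses the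
cyclic order of the neighbours and T fixes each of them. -/
theorem half_zero_nbr (i : ℤ) :
    ((r₁ * r₂) ^ k) (r₀ (nbr r₀ r₁ r₂ v i)) = r₀ (nbr r₀ r₁ r₂ v (-i)) := by
  have e : (r₁ * r₂) ^ k * r₀ = r₀ * ((r₁ * r₂) ^ k * r₂) := by
    rw [← hz, mul_assoc r₀, ← mul_assoc r₀ r₀, h.sq_zero, one_mul]
  have := DFunLike.congr_fun e (nbr r₀ r₁ r₂ v i)
  rw [Equiv.Perm.mul_apply, Equiv.Perm.mul_apply, Equiv.Perm.mul_apply, h.two_nbr,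
    half_nbr hper] at this
  exact this

/-- The half rotation fixes neighbours, so here the indices `i` and `-i` give the same one; and `i`
is not 0 modulo `k`, because `r₀` takes neighbour 0 to `v`, which is no neighbour. -/
theorem dvd_of_zero_nbr_eq {i j : ℤ} (hij : r₀ (nbr r₀ r₁ r₂ v i) = nbr r₀ r₁ r₂ v j) :
    (k : ℤ) ∣ 2 * i ∧ ¬ (k : ℤ) ∣ i := by
  constructor
  · have h1 := half_nbr hper j
    rw [← hij, half_zero_nbr h hper hz] at h1
    have := (hper _ _).1 (r₀.injective h1)
    obtain ⟨c, hc⟩ := this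
    exact ⟨-c, by linear_combination -hc⟩
  · intro hd
    have : nbr r₀ r₁ r₂ v i = nbr r₀ r₁ r₂ v 0 := (hper _ _).2 (by rwa [sub_zero])
    rw [this, nbr, zpow_zero, Equiv.Perm.one_apply, h.zero_zero] at hij
    exact h.nbr_ne j hij.symm

include hq

/-- The neighbours and their images under `r₀` cover at least 2k − 1 of the 2k points. A point
outside the images that the half rotation moves would bring along its own image, a second point
outside both sets, which is one point too many. -/
theorem exists_of_half_ne {x : V} (hx : ((r₁ * r₂) ^ k) x ≠ x) :
    ∃ i, x = r₀ (nbr r₀ r₁ r₂ v i) := by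
  classical
  have : Finite V := Nat.finite_of_card_ne_zero (by rw [h.card_eq]; exact h.pos.ne')
  have := Fintype.ofFinite V
  by_contra hno
  push Not at hno
  set z := (r₁ * r₂) ^ k with hzdef
  have hzz : ∀ y, z (z y) = y := fun y => by
    have : z * z = 1 := by
      rw [hzdef, ← pow_add, ← two_mul, ← hq, ← h.orderOf_eq, pow_orderOf_eq_one]
    exact DFunLike.congr_fun this y
  have hinj : ∀ i j : ℕ, i < k → j < k → nbr r₀ r₁ r₂ v i = nbr r₀ r₁ r₂ v j → i = j := by
    intro i j hi hj hij
    have h2 := Int.emod_eq_emod_iff_emod_sub_eq_zero.2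
      (Int.emod_eq_zero_of_dvd ((hper _ _).1 hij))
    rw [Int.emod_eq_of_lt (by omega) (by omega), Int.emod_eq_of_lt (by omega) (by omega)] at h2
    omega
  let B := (Finset.range k).image fun i : ℕ => nbr r₀ r₁ r₂ v i
  let A := (Finset.range k).image fun i : ℕ => r₀ (nbr r₀ r₁ r₂ v i)
  have hB : B.card = k := by
    rw [Finset.card_image_of_injOn, Finset.card_range]
    intro i hi j hj hij
    exact hinj i j (by simpa using hi) (by simpa using hj) hij
  have hA : A.card = k := by
    rw [Finset.card_image_of_injOn, Finset.card_range]
    intro i hi j hj hij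
    exact hinj i j (by simpa using hi) (by simpa using hj) (r₀.injective hij)
  have hAB : (A ∩ B).card ≤ 1 := by
    rw [Finset.card_le_one]
    intro y hy y' hy'
    simp only [A, B, Finset.mem_inter, Finset.mem_image] at hy hy'
    obtain ⟨⟨i, -, rfl⟩, j, -, hj⟩ := hy
    obtain ⟨⟨i', -, rfl⟩, j', -, hj'⟩ := hy'
    obtain ⟨⟨m, hm⟩, hni⟩ := dvd_of_zero_nbr_eq h hper hz hj.symm
    obtain ⟨⟨m', hm'⟩, hni'⟩ := dvd_of_zero_nbr_eq h hper hz hj'.symm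
    congr 1
    rw [hper]
    -- A common point has an index whose double is an odd multiple of `k`; any two such indices are
    -- congruent modulo `k`.
    have hodd : ∀ {n l : ℤ}, 2 * n = k * l → ¬ (k : ℤ) ∣ n → ∃ c, l = 2 * c + 1 := by
      intro n l hnl hn
      obtain ⟨c, rfl | rfl⟩ := Int.even_or_odd' l
      · exact absurd ⟨c, by linarith⟩ hn
      · exact ⟨c, rfl⟩
    obtain ⟨c, rfl⟩ := hodd hm hni
    obtain ⟨c', rfl⟩ := hodd hm' hni'
    exact ⟨c - c', by linarith⟩
  have hxB : ∀ y, z y ≠ y → y ∉ B := by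
    intro y hy hyB
    obtain ⟨i, -, rfl⟩ := Finset.mem_image.1 hyB
    exact hy (half_nbr hper i)
  have hxA : x ∉ A := by
    intro hxA
    obtain ⟨i, -, rfl⟩ := Finset.mem_image.1 hxA
    exact hno i rfl
  have hzxA : z x ∉ A := by
    intro hxA
    obtain ⟨i, -, hi⟩ := Finset.mem_image.1 hxA
    refine hno (-i) ?_
    have h1 := half_zero_nbr h hper hz i
    rw [hi, ← hzdef, hzz] at h1
    exact h1
  have hzxB : z x ∉ B := hxB _ (by rw [hzz]; exact hx.symm)
  have hdis : Disjoint (A ∪ B) {x, z x} := by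
    rw [Finset.disjoint_right]
    intro y hy
    rw [Finset.mem_insert, Finset.mem_singleton] at hy
    rw [Finset.mem_union]
    rcases hy with rfl | rfl
    · exact fun hor => hor.elim hxA (hxB _ hx)
    · exact fun hor => hor.elim hzxA hzxB
  have h1 := Finset.card_union_add_card_inter A B
  have h2 := Finset.card_le_univ ((A ∪ B) ∪ {x, z x})
  rw [Finset.card_union_of_disjoint hdis, Finset.card_pair hx.symm, ← Nat.card_eq_fintype_card,
    h.card_eq] at h2
  omega

/-- At every point moved by the half rotation T, the reflection `r₂` agrees with T. Apply this to x
and to R⁻¹x, where R = r₁r₂: since r₂R⁻¹ = Rr₂, it gives RTx = TR⁻¹x, and T commutes with R. -/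
theorem rot_sq_of_half_ne {x : V} (hx : ((r₁ * r₂) ^ k) x ≠ x) : ((r₁ * r₂) ^ 2) x = x := by
  have hcomm : ∀ (i : ℤ) (y : V), ((r₁ * r₂) ^ k) (((r₁ * r₂) ^ i) y) =
      ((r₁ * r₂) ^ i) (((r₁ * r₂) ^ k) y) := fun i y => by
    rw [← Equiv.Perm.mul_apply, ← Equiv.Perm.mul_apply, ← zpow_natCast, ← zpow_add, ← zpow_add,
      add_comm]
  have key : ∀ y, ((r₁ * r₂) ^ k) y ≠ y → r₂ y = ((r₁ * r₂) ^ k) y := by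
    intro y hy
    obtain ⟨i, rfl⟩ := exists_of_half_ne h hq hper hz hy
    rw [half_zero_nbr h hper hz, h.two_zero, h.two_nbr]
  have h1 := key _ hx
  have h2 := key (((r₁ * r₂) ^ (-1 : ℤ)) x) (by
    rw [hcomm]
    exact fun he => hx (Equiv.injective _ he))
  rw [h.two_rot_apply, h1, hcomm, ← hcomm, ← hcomm] at h2
  have h3 := congrArg ((r₁ * r₂) ^ (1 : ℤ)) (Equiv.injective _ h2)
  rw [← Equiv.Perm.mul_apply, ← Equiv.Perm.mul_apply, ← zpow_add, ← zpow_add] at h3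
  exact h3

include hk

/-- For even `k` the half rotation is a power of the squared rotation, which fixes every point that
the half rotation moves. It would then be the identity, although the rotation has order `2 * k`. -/
theorem odd_half : Odd k := by
  rw [← Nat.not_even_iff_odd]
  rintro ⟨m, rfl⟩
  have hne : (r₁ * r₂) ^ (m + m) ≠ 1 := fun he => by
    have := orderOf_dvd_of_pow_eq_one he
    rw [h.orderOf_eq] at this
    have := Nat.le_of_dvd hk this
    omega
  refine hne (Equiv.ext fun x => ?_)
  by_contra hx
  have h2 : (r₁ * r₂) ^ 2 ∈ MulAction.stabilizer (Equiv.Perm V) x :=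
    rot_sq_of_half_ne h hq hper hz hx
  have := pow_mem h2 m
  rw [← pow_mul, two_mul] at this
  exact hx this

/-- For `k = 1` all indices are congruent, so the half rotation fixes even the points it could move.
-/
theorem three_le_half : 3 ≤ k := by
  obtain ⟨m, hm⟩ := odd_half h hk hq hper hz
  by_contra hlt
  obtain rfl : k = 1 := by omega
  have hne : (r₁ * r₂) ^ 1 ≠ 1 := fun he => by
    have := orderOf_dvd_of_pow_eq_one he
    rw [h.orderOf_eq] at this
    have := Nat.le_of_dvd hk this
    omega
  refine hne (Equiv.ext fun x => ?_)
  by_contra hx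
  obtain ⟨i, rfl⟩ := exists_of_half_ne h hq hper hz hx
  refine hx ?_
  rw [half_zero_nbr h hper hz, (hper (-i) i).2 (by simp)]
  rfl

/-- As `k` is odd, the half rotation is the rotation times a power of its square, so the two agree
wherever the half rotation moves a point. The only point of this form that the half rotation fixes
is `v`. -/
theorem rot_zero_nbr (i : ℤ) :
    (r₁ * r₂) (r₀ (nbr r₀ r₁ r₂ v i)) = r₀ (nbr r₀ r₁ r₂ v (-i)) := by
  obtain ⟨m, hm⟩ := odd_half h hk hq hper hz
  by_cases hx : ((r₁ * r₂) ^ k) (r₀ (nbr r₀ r₁ r₂ v i)) = r₀ (nbr r₀ r₁ r₂ v i)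
  · have h1 := hx
    rw [half_zero_nbr h hper hz] at h1
    have hd := (hper _ _).1 (r₀.injective h1)
    have hki : (k : ℤ) ∣ i := by
      obtain ⟨c, hc⟩ := hd
      -- Modulo `2 * m + 1`, multiplication by `-m` undoes doubling; this yields the quotient below.
      have hm' : (k : ℤ) = 2 * m + 1 := by exact_mod_cast hm
      exact ⟨i + m * c, by rw [hm'] at hc ⊢; linear_combination (m : ℤ) * hc⟩
    have h0 : nbr r₀ r₁ r₂ v i = nbr r₀ r₁ r₂ v 0 := (hper _ _).2 (by rwa [sub_zero])
    have := h.rot_fix 1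
    rw [zpow_one] at this
    rw [h1, h0, nbr, zpow_zero, Equiv.Perm.one_apply, h.zero_zero, this]
  · have h2 : (r₁ * r₂) ^ 2 ∈ MulAction.stabilizer (Equiv.Perm V) (r₀ (nbr r₀ r₁ r₂ v i)) :=
      rot_sq_of_half_ne h hq hper hz hx
    have h3 : ((r₁ * r₂) ^ (2 * m)) (r₀ (nbr r₀ r₁ r₂ v i)) = r₀ (nbr r₀ r₁ r₂ v i) := by
      rw [pow_mul]
      exact pow_mem h2 m
    rw [← half_zero_nbr h hper hz, hm, pow_succ', Equiv.Perm.mul_apply _ ((r₁ * r₂) ^ (2 * m)), h3]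

end Half

/-- The action is the one on a doubled complete bipartite graph with two parts of odd size. -/
theorem exists_equiv (h : IsRegularVertexAction r₀ r₁ r₂ v q) :
    ∃ k : ℕ, q = 2 * k ∧ Odd k ∧ 3 ≤ k ∧ ∃ e : Bool × ZMod k ≃ V,
      (∀ s i, r₀ (e (s, i)) = e (!s, i)) ∧ (∀ s i, r₂ (e (s, i)) = e (s, -i)) ∧
      (∀ i, r₁ (e (false, i)) = e (false, i)) ∧ ∀ i, r₁ (e (true, i)) = e (true, 1 - i) := by
  obtain ⟨k, hk, hq, hper, hz⟩ := h.exists_half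
  have hodd := odd_half h hk hq hper hz
  refine ⟨k, hq, hodd, three_le_half h hk hq hper hz, ?_⟩
  have : NeZero k := ⟨hk.ne'⟩
  let b : ZMod k → V := fun i => nbr r₀ r₁ r₂ v (i.cast : ℤ)
  have hb : ∀ i : ℤ, b i = nbr r₀ r₁ r₂ v i := fun i => by
    simp only [b]
    rw [hper, ZMod.coe_intCast, dvd_sub_comm]
    exact Int.dvd_self_sub_emod
  have hbi : Function.Injective b := by
    intro i j hij
    obtain ⟨i, rfl⟩ := ZMod.intCast_surjective i
    obtain ⟨j, rfl⟩ := ZMod.intCast_surjective j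
    rw [hb, hb, hper] at hij
    rw [eq_comm, ZMod.intCast_eq_intCast_iff_dvd_sub]
    exact hij
  -- The class `true` consists of the neighbours of `v` and `false` of their images, so `v` itself
  -- is `(false, 0)`.
  let F : Bool × ZMod k → V := fun x => bif x.1 then b x.2 else r₀ (b x.2)
  have hdisj : ∀ i j, r₀ (b i) ≠ b j := by
    intro i j hij
    obtain ⟨⟨c, hc⟩, hn⟩ := dvd_of_zero_nbr_eq h hper hz hij
    obtain ⟨m, hm⟩ := hodd
    have hm' : (k : ℤ) = 2 * m + 1 := by exact_mod_cast hm
    exact hn ⟨i.cast - m * c, by rw [hm'] at hc ⊢; linear_combination (-(m : ℤ)) * hc⟩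
  have hF : Function.Injective F := by
    rintro ⟨s, i⟩ ⟨t, j⟩ hij
    cases s <;> cases t <;> simp only [F, cond_true, cond_false] at hij
    · rw [hbi (r₀.injective hij)]
    · exact absurd hij (hdisj _ _)
    · exact absurd hij.symm (hdisj _ _)
    · rw [hbi hij]
  have : Finite V := Nat.finite_of_card_ne_zero (by rw [h.card_eq]; exact h.pos.ne')
  have hbij : Function.Bijective F := by
    rw [Nat.bijective_iff_injective_and_card]
    refine ⟨hF, ?_⟩
    rw [Nat.card_prod, Nat.card_zmod, h.card_eq, hq]
    simp
  have h2b : ∀ i, r₂ (b i) = b (-i) := fun i => by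
    obtain ⟨i, rfl⟩ := ZMod.intCast_surjective i
    rw [← Int.cast_neg, hb, hb, h.two_nbr]
  have hR : r₁ = r₁ * r₂ * r₂ := by rw [mul_assoc, h.sq_two, mul_one]
  refine ⟨Equiv.ofBijective F hbij, ?_, ?_, ?_, ?_⟩
  · rintro (_ | _) i
    · exact h.zero_zero _
    · rfl
  · rintro (_ | _) i
    · change r₂ (r₀ (b i)) = r₀ (b (-i))
      rw [h.two_zero, h2b]
    · exact h2b i
  · intro i
    change r₁ (r₀ (b i)) = r₀ (b i)
    obtain ⟨i, rfl⟩ := ZMod.intCast_surjective i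
    rw [hR, Equiv.Perm.mul_apply, h.two_zero, h2b, ← Int.cast_neg, hb, hb,
      rot_zero_nbr h hk hq hper hz, neg_neg]
  · intro i
    change r₁ (b i) = b (1 - i)
    obtain ⟨i, rfl⟩ := ZMod.intCast_surjective i
    rw [hR, Equiv.Perm.mul_apply, h2b, ← Int.cast_neg, hb, ← Int.cast_one, ← Int.cast_sub, hb,
      ← zpow_one (r₁ * r₂), rot_nbr, sub_eq_add_neg]

end IsRegularVertexAction

namespace RankedPoset

/-! ### Criteria for polyhedra of rank 3 -/

section Criteria

variable {P : RankedPoset.{u}}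

/-- If a flag skipped a rank, a face interpolated between the members on either side of the gap
would be comparable with every member, and maximality would put it into the flag. -/
theorem isFlagGraded_of_interpolation (hrank : ∀ x : P.Face, P.rank x ∈ Set.Icc (-1 : ℤ) 3)
    {x₀ x₁ : P.Face} (h₀ : ∀ x, x₀ ≤ x) (h₁ : ∀ x, x ≤ x₁) (hr₀ : P.rank x₀ = -1)
    (hr₁ : P.rank x₁ = 3)
    (hint : ∀ x y : P.Face, x < y → P.rank x + 2 ≤ P.rank y →
      ∃ z, x < z ∧ z < y ∧ P.rank z = P.rank x + 1) : P.IsFlagGraded := by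
  have hmem : ∀ (Φ : Flag P.Face) (z : P.Face), (∀ w ∈ Φ, z ≤ w ∨ w ≤ z) → z ∈ Φ :=
    fun Φ z hz => (Flag.mem_iff_forall_le_or_ge).2 fun w hw => (hz w hw)
  have hex : ∀ (Φ : Flag P.Face) (n : ℕ), n ≤ 4 → ∃ x ∈ Φ, P.rank x = -1 + n := by
    intro Φ n
    induction n with
    | zero => exact fun _ => ⟨x₀, hmem Φ _ fun w _ => Or.inl (h₀ w), by simpa using hr₀⟩
    | succ n ih =>
      intro hn
      obtain ⟨x, hx, hxn⟩ := ih (by omega)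
      -- The rank of `x` is `n - 1`, so these are the members above `x`; the least `m` gives the
      -- next one.
      have hS : ∃ m : ℕ, ∃ y ∈ Φ, P.rank y = n + m :=
        ⟨(3 - n : ℤ).toNat, x₁, hmem Φ _ fun w _ => Or.inr (h₁ w), by omega⟩
      classical
      obtain ⟨y, hy, hym⟩ := Nat.find_spec hS
      have hmin : ∀ w ∈ Φ, P.rank x < P.rank w → P.rank y ≤ P.rank w := by
        intro w hw hxw
        have := Nat.find_min' hS (m := (P.rank w - n).toNat) ⟨w, hw, by omega⟩
        omega
      by_cases h0 : P.rank y = n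
      · exact ⟨y, hy, by push_cast; omega⟩
      obtain ⟨z, hxz, hzy, hz⟩ := hint x y (flag_lt_of_rank_lt hx hy (by omega)) (by omega)
      refine ⟨z, hmem Φ z fun w hw => ?_, by push_cast; omega⟩
      by_cases hxw : P.rank x < P.rank w
      · exact Or.inl (hzy.le.trans (flag_le_of_rank_le hy hw (hmin w hw hxw)))
      · exact Or.inr ((flag_le_of_rank_le hw hx (not_lt.1 hxw)).trans hxz.le)
  refine ⟨hrank, ⟨x₀, hr₀, fun y hy => ?_⟩, ⟨x₁, hr₁, fun y hy => ?_⟩, fun Φ i hi => ?_⟩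
  · exact ((h₀ y).eq_or_lt.resolve_right fun h => by
      have := P.rank_strictMono h
      omega).symm
  · exact (h₁ y).eq_or_lt.resolve_right fun h => by
      have := P.rank_strictMono h
      omega
  · obtain ⟨x, hx, hxi⟩ := hex Φ (i + 1).toNat (by have := hi.2; omega)
    have hxi' : P.rank x = i := by have := hi.1; omega
    exact ⟨x, ⟨hx, hxi'⟩, fun y hy => flag_eq_of_rank_eq hy.1 hx (hy.2.trans hxi'.symm)⟩

namespace IsFlagGraded

theorem flag_eq_of_mem (hP : P.IsFlagGraded) {A B : Flag P.Face} {x y z : P.Face}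
    (hx : P.rank x = 0) (hy : P.rank y = 1) (hz : P.rank z = 2) (hxA : x ∈ A) (hyA : y ∈ A)
    (hzA : z ∈ A) (hxB : x ∈ B) (hyB : y ∈ B) (hzB : z ∈ B) : A = B := by
  refine hP.flag_ext fun w hw h0 h2 => ?_
  rcases (by omega : P.rank w = 0 ∨ P.rank w = 1 ∨ P.rank w = 2) with h | h | h
  · rwa [flag_eq_of_rank_eq hw hxA (h.trans hx.symm)]
  · rwa [flag_eq_of_rank_eq hw hyA (h.trans hy.symm)]
  · rwa [flag_eq_of_rank_eq hw hzA (h.trans hz.symm)]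

/-- Two flags that agree in two of the three ranks `0, 1, 2` are equal or adjacent. -/
theorem eq_or_flagAdj (hP : P.IsFlagGraded) {A B : Flag P.Face} (i : ℤ)
    (h : ∀ x ∈ A, 0 ≤ P.rank x → P.rank x ≤ 2 → P.rank x ≠ i → x ∈ B) :
    A = B ∨ P.FlagAdj i A B := by
  by_cases hAB : A = B
  · exact Or.inl hAB
  obtain ⟨x, hx, hxB⟩ : ∃ x ∈ A, x ∉ B := by
    by_contra hno
    push Not at hno
    exact hAB (flag_eq_of_subset hno)
  refine Or.inr (hP.flagAdj_of hx hxB fun y hy hyi => ?_)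
  have := hP.rank_mem y
  by_cases h1 : P.rank y = -1
  · exact hP.least_mem h1 B
  by_cases h2 : P.rank y = 3
  · exact hP.greatest_mem h2 B
  · exact h y hy (by have := this.1; omega) (by have := this.2; omega) hyi

/-- The cases are the sets of proper faces common to both flags. With at least two, the flags are
equal or adjacent; with only the edge, changing the vertex and then the facet suffices; the
remaining cases are the hypotheses. -/
theorem strongly_connected_of (hP : P.IsFlagGraded)
    (hV : ∀ (Φ Ψ : Flag P.Face) (x : P.Face), P.rank x = 0 → x ∈ Φ → x ∈ Ψ →
      Relation.ReflTransGen (fun A B => (∃ i, P.FlagAdj i A B) ∧ x ∈ B) Φ Ψ)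
    (hF : ∀ (Φ Ψ : Flag P.Face) (x : P.Face), P.rank x = 2 → x ∈ Φ → x ∈ Ψ →
      Relation.ReflTransGen (fun A B => (∃ i, P.FlagAdj i A B) ∧ x ∈ B) Φ Ψ)
    (hA : ∀ Φ Ψ : Flag P.Face, Relation.ReflTransGen (fun A B => ∃ i, P.FlagAdj i A B) Φ Ψ)
    (Φ Ψ : Flag P.Face) :
    Relation.ReflTransGen (fun A B : Flag P.Face =>
        (∃ i : ℤ, P.FlagAdj i A B) ∧ ∀ x : P.Face, x ∈ Φ → x ∈ Ψ → x ∈ B) Φ Ψ := by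
  obtain ⟨a, ha, ha'⟩ := hP.exists_mem Φ (i := 0) (by norm_num) (by norm_num)
  obtain ⟨b, hb, hb'⟩ := hP.exists_mem Φ (i := 1) (by norm_num) (by norm_num)
  obtain ⟨c, hc, hc'⟩ := hP.exists_mem Φ (i := 2) (by norm_num) (by norm_num)
  have hcase : ∀ x ∈ Φ, 0 ≤ P.rank x → P.rank x ≤ 2 → x = a ∨ x = b ∨ x = c := by
    intro x hx h0 h2
    rcases (by omega : P.rank x = 0 ∨ P.rank x = 1 ∨ P.rank x = 2) with h | h | h
    · exact Or.inl (flag_eq_of_rank_eq hx ha (h.trans ha'.symm))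
    · exact Or.inr (Or.inl (flag_eq_of_rank_eq hx hb (h.trans hb'.symm)))
    · exact Or.inr (Or.inr (flag_eq_of_rank_eq hx hc (h.trans hc'.symm)))
  have direct : ∀ i : ℤ, (∀ x ∈ Φ, 0 ≤ P.rank x → P.rank x ≤ 2 → P.rank x ≠ i → x ∈ Ψ) →
      Relation.ReflTransGen (fun A B : Flag P.Face =>
        (∃ i : ℤ, P.FlagAdj i A B) ∧ ∀ x : P.Face, x ∈ Φ → x ∈ Ψ → x ∈ B) Φ Ψ := by
    intro i hi
    rcases hP.eq_or_flagAdj i hi with rfl | h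
    · exact .refl
    · exact .single ⟨⟨i, h⟩, fun x _ hx => hx⟩
  have weaken : ∀ {r : Flag P.Face → Flag P.Face → Prop}, Relation.ReflTransGen r Φ Ψ →
      (∀ A B, r A B → (∃ i, P.FlagAdj i A B) ∧ ∀ x ∈ Φ, 0 ≤ P.rank x → P.rank x ≤ 2 →
        x ∈ Ψ → x ∈ B) →
      Relation.ReflTransGen (fun A B : Flag P.Face =>
        (∃ i : ℤ, P.FlagAdj i A B) ∧ ∀ x : P.Face, x ∈ Φ → x ∈ Ψ → x ∈ B) Φ Ψ := by
    intro r h hr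
    refine Relation.ReflTransGen.mono (fun A B hAB => ⟨(hr A B hAB).1, fun x hx hx' => ?_⟩) _ _ h
    have := hP.rank_mem x
    by_cases h1 : P.rank x = -1
    · exact hP.least_mem h1 B
    by_cases h2 : P.rank x = 3
    · exact hP.greatest_mem h2 B
    · exact (hr A B hAB).2 x hx (by have := this.1; omega) (by have := this.2; omega) hx'
  by_cases haΨ : a ∈ Ψ
  · by_cases hbΨ : b ∈ Ψ
    · refine direct 2 fun x hx h0 h2 h => ?_
      rcases hcase x hx h0 h2 with rfl | rfl | rfl
      exacts [haΨ, hbΨ, absurd hc' h]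
    by_cases hcΨ : c ∈ Ψ
    · refine direct 1 fun x hx h0 h2 h => ?_
      rcases hcase x hx h0 h2 with rfl | rfl | rfl
      exacts [haΨ, absurd hb' h, hcΨ]
    · refine weaken (hV Φ Ψ a ha' ha haΨ) fun A B hAB => ⟨hAB.1, fun x hx h0 h2 hx' => ?_⟩
      rcases hcase x hx h0 h2 with rfl | rfl | rfl
      exacts [hAB.2, absurd hx' hbΨ, absurd hx' hcΨ]
  by_cases hcΨ : c ∈ Ψ
  · by_cases hbΨ : b ∈ Ψ
    · refine direct 0 fun x hx h0 h2 h => ?_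
      rcases hcase x hx h0 h2 with rfl | rfl | rfl
      exacts [absurd ha' h, hbΨ, hcΨ]
    · refine weaken (hF Φ Ψ c hc' hc hcΨ) fun A B hAB => ⟨hAB.1, fun x hx h0 h2 hx' => ?_⟩
      rcases hcase x hx h0 h2 with rfl | rfl | rfl
      exacts [absurd hx' haΨ, absurd hx' hbΨ, hAB.2]
  by_cases hbΨ : b ∈ Ψ
  · obtain ⟨d, hd, hd'⟩ := hP.exists_mem Ψ (i := 0) (by norm_num) (by norm_num)
    -- The intermediate flag takes its vertex from `Ψ` and its facet from `Φ`.
    obtain ⟨A, h1, h2, h3⟩ := exists_flag (flag_le_of_rank_le hd hbΨ (by omega))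
      (flag_le_of_rank_le hb hc (by omega))
    have hstep : ∀ B : Flag P.Face, b ∈ B → ∀ x, x ∈ Φ → 0 ≤ P.rank x → P.rank x ≤ 2 →
        x ∈ Ψ → x ∈ B := by
      intro B hbB x hx h0 h2 hx'
      rcases hcase x hx h0 h2 with rfl | rfl | rfl
      exacts [absurd hx' haΨ, hbB, absurd hx' hcΨ]
    have e1 : Φ = A ∨ P.FlagAdj 0 Φ A := hP.eq_or_flagAdj 0 fun x hx h0 h2' h => by
      rcases hcase x hx h0 h2' with rfl | rfl | rfl
      exacts [absurd ha' h, h2, h3]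
    have e2 : Ψ = A ∨ P.FlagAdj 2 Ψ A := hP.eq_or_flagAdj 2 fun x hx h0 h2' h => by
      rcases (by omega : P.rank x = 0 ∨ P.rank x = 1) with h | h
      · rwa [flag_eq_of_rank_eq hx hd (h.trans hd'.symm)]
      · rwa [flag_eq_of_rank_eq hx hbΨ (h.trans hb'.symm)]
    refine weaken (r := fun A B => (∃ i, P.FlagAdj i A B) ∧ b ∈ B) ?_
      fun A B hAB => ⟨hAB.1, hstep B hAB.2⟩
    rcases e1 with rfl | e1 <;> rcases e2 with rfl | e2
    · exact .refl
    · exact .single ⟨⟨2, e2.symm⟩, hbΨ⟩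
    · exact .single ⟨⟨0, e1⟩, hbΨ⟩
    · exact .head ⟨⟨0, e1⟩, h2⟩ (.single ⟨⟨2, e2.symm⟩, hbΨ⟩)
  · refine weaken (hA Φ Ψ) fun A B hAB => ⟨hAB, fun x hx h0 h2 hx' => ?_⟩
    rcases hcase x hx h0 h2 with rfl | rfl | rfl
    exacts [absurd hx' haΨ, absurd hx' hbΨ, absurd hx' hcΨ]

end IsFlagGraded

end Criteria

end RankedPoset

theorem TorusFace.lt_iff {s : ℕ} {x y : TorusFace s} : x < y ↔ x.lt y := by
  rw [lt_iff_le_and_ne]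
  constructor
  · rintro ⟨rfl | h, hne⟩
    · exact absurd rfl hne
    · exact h
  · exact fun h => ⟨Or.inr h, fun he => (TorusFace.rank_lt_of_lt h).ne (congrArg _ he)⟩

/-- The faces of a polyhedron of type `{4, 2s}` on two classes of `s` vertices, with each vertex of
a class joined to each vertex of the other class by two edges. The class of a vertex and the kind
of an edge are given by a truth value. -/
inductive BiFace (s : ℕ) : Type
  | empty
  | vertex (t : Bool) (c : ZMod s)
  | edge (o : Bool) (i j : ZMod s)
  | facet (i j : ZMod s)
  | whole

/-! ### The model in coordinates and its corners -/

namespace BiFace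

/-- The dimension of a face. -/
def rank {s : ℕ} : BiFace s → ℤ
  | empty => -1
  | vertex _ _ => 0
  | edge _ _ _ => 1
  | facet _ _ => 2
  | whole => 3

/-- The end of the given class of the edge `edge o i j`. -/
def endpoint {s : ℕ} : Bool → Bool → ZMod s → ZMod s → ZMod s
  | false, false, i, j => i - j
  | false, true, i, j => i - j - 1
  | true, _, i, j => i + j

/-- Incidence of a face with a face of larger dimension. -/
def lt {s : ℕ} : BiFace s → BiFace s → Prop
  | empty, y => y ≠ empty
  | x, whole => x ≠ whole
  | vertex t c, edge o i j => c = endpoint t o i j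
  | vertex false c, facet i j => c = i - j ∨ c = i - j - 1
  | vertex true c, facet i j => c = i + j ∨ c = i + j - 1
  | edge false i j, facet k l => (k = i ∨ k = i + 1) ∧ l = j
  | edge true i j, facet k l => k = i ∧ (l = j ∨ l = j + 1)
  | _, _ => False

theorem rank_lt_of_lt {s : ℕ} {x y : BiFace s} (h : x.lt y) : x.rank < y.rank := by
  cases x <;> cases y <;> simp_all [lt, rank]

theorem lt_trans' {s : ℕ} {x y z : BiFace s} (h : x.lt y) (h' : y.lt z) : x.lt z := by
  rcases x with _ | ⟨_ | _, c⟩ | ⟨_ | _, i, j⟩ | ⟨i, j⟩ | _ <;>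
  rcases y with _ | ⟨_ | _, c⟩ | ⟨_ | _, i, j⟩ | ⟨i, j⟩ | _ <;>
  rcases z with _ | ⟨_ | _, c⟩ | ⟨_ | _, i, j⟩ | ⟨i, j⟩ | _ <;>
  simp only [lt, endpoint] at h h' ⊢ <;> grind

instance (s : ℕ) : PartialOrder (BiFace s) where
  le x y := x = y ∨ x.lt y
  le_refl x := Or.inl rfl
  le_trans := by
    rintro x y z (rfl | h) (rfl | h')
    · exact Or.inl rfl
    · exact Or.inr h'
    · exact Or.inr h
    · exact Or.inr (lt_trans' h h')
  le_antisymm := by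
    rintro x y (rfl | h) (h' | h')
    · rfl
    · rfl
    · exact h'.symm
    · exact absurd ((rank_lt_of_lt h).trans (rank_lt_of_lt h')) (lt_irrefl _)

theorem le_iff {s : ℕ} {x y : BiFace s} : x ≤ y ↔ x = y ∨ x.lt y := Iff.rfl

theorem lt_iff {s : ℕ} {x y : BiFace s} : x < y ↔ x.lt y := by
  rw [lt_iff_le_and_ne]
  constructor
  · rintro ⟨rfl | h, hne⟩
    · exact absurd rfl hne
    · exact h
  · exact fun h => ⟨Or.inr h, fun he => (rank_lt_of_lt h).ne (congrArg _ he)⟩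

end BiFace

/-- The polyhedron of type `{4, 2s}` with the faces `BiFace s`. -/
abbrev biMap (s : ℕ) : RankedPoset.{0} where
  Face := BiFace s
  rank := BiFace.rank
  rank_strictMono := fun _ _ h => BiFace.rank_lt_of_lt (BiFace.lt_iff.1 h)

/-- The flags of `biMap s`: the end in the class `a` of the edge `edge o i j`, with one of the
two facets at this edge. -/
@[ext]
structure Corner (s : ℕ) where
  /-- The kind of the edge. -/
  o : Bool
  /-- The class of the vertex. -/
  a : Bool
  /-- The facet. -/
  b : Bool
  /-- The first coordinate. -/
  i : ZMod s
  /-- The second coordinate. -/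
  j : ZMod s

namespace Corner

variable {s : ℕ}

/-- The vertex of a corner. -/
def vertex (x : Corner s) : ZMod s := BiFace.endpoint x.a x.o x.i x.j

/-- The first coordinate of the facet of a corner. -/
def fst : Corner s → ZMod s
  | ⟨false, _, true, i, _⟩ => i + 1
  | ⟨_, _, _, i, _⟩ => i

/-- The second coordinate of the facet of a corner. -/
def snd : Corner s → ZMod s
  | ⟨true, _, true, _, j⟩ => j + 1
  | ⟨_, _, _, _, j⟩ => j

/-- Change of the vertex. -/
def flipVertex (x : Corner s) : Corner s := ⟨x.o, !x.a, x.b, x.i, x.j⟩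

/-- Change of the facet. -/
def flipFacet (x : Corner s) : Corner s := ⟨x.o, x.a, !x.b, x.i, x.j⟩

/-- Change of the edge. -/
def flipEdge : Corner s → Corner s
  | ⟨false, false, false, i, j⟩ => ⟨true, false, true, i, j - 1⟩
  | ⟨false, false, true, i, j⟩ => ⟨true, false, false, i + 1, j⟩
  | ⟨false, true, false, i, j⟩ => ⟨true, true, false, i, j⟩
  | ⟨false, true, true, i, j⟩ => ⟨true, true, true, i + 1, j - 1⟩
  | ⟨true, false, false, i, j⟩ => ⟨false, false, true, i - 1, j⟩
  | ⟨true, false, true, i, j⟩ => ⟨false, false, false, i, j + 1⟩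
  | ⟨true, true, false, i, j⟩ => ⟨false, true, false, i, j⟩
  | ⟨true, true, true, i, j⟩ => ⟨false, true, true, i - 1, j + 1⟩

theorem flipVertex_flipVertex (x : Corner s) : x.flipVertex.flipVertex = x := by
  simp [flipVertex]

theorem flipFacet_flipFacet (x : Corner s) : x.flipFacet.flipFacet = x := by
  simp [flipFacet]

theorem flipEdge_flipEdge (x : Corner s) : x.flipEdge.flipEdge = x := by
  rcases x with ⟨_ | _, _ | _, _ | _, i, j⟩ <;> simp [flipEdge]

theorem flipEdge_a (x : Corner s) : x.flipEdge.a = x.a := by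
  rcases x with ⟨_ | _, _ | _, _ | _, i, j⟩ <;> rfl

theorem flipEdge_o (x : Corner s) : x.flipEdge.o = !x.o := by
  rcases x with ⟨_ | _, _ | _, _ | _, i, j⟩ <;> rfl

theorem flipEdge_vertex (x : Corner s) : x.flipEdge.vertex = x.vertex := by
  rcases x with ⟨_ | _, _ | _, _ | _, i, j⟩ <;>
    simp only [flipEdge, vertex, BiFace.endpoint] <;> ring

theorem flipEdge_fst (x : Corner s) : x.flipEdge.fst = x.fst := by
  rcases x with ⟨_ | _, _ | _, _ | _, i, j⟩ <;> simp [flipEdge, fst]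

theorem flipEdge_snd (x : Corner s) : x.flipEdge.snd = x.snd := by
  rcases x with ⟨_ | _, _ | _, _ | _, i, j⟩ <;> simp [flipEdge, snd]

/-- A change of the edge or of the facet. -/
def StepAtVertex (x y : Corner s) : Prop := y = x.flipEdge ∨ y = x.flipFacet

/-- A change of the edge or of the vertex. -/
def StepAtFacet (x y : Corner s) : Prop := y = x.flipEdge ∨ y = x.flipVertex

/-- A change of the vertex, the edge or the facet. -/
def Step (x y : Corner s) : Prop := y = x.flipEdge ∨ y = x.flipVertex ∨ y = x.flipFacet

theorem StepAtVertex.symm {x y : Corner s} : StepAtVertex x y → StepAtVertex y x := by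
  rintro (rfl | rfl)
  · exact Or.inl (flipEdge_flipEdge x).symm
  · exact Or.inr (flipFacet_flipFacet x).symm

theorem StepAtFacet.symm {x y : Corner s} : StepAtFacet x y → StepAtFacet y x := by
  rintro (rfl | rfl)
  · exact Or.inl (flipEdge_flipEdge x).symm
  · exact Or.inr (flipVertex_flipVertex x).symm

theorem Step.symm {x y : Corner s} : Step x y → Step y x := by
  rintro (rfl | rfl | rfl)
  · exact Or.inl (flipEdge_flipEdge x).symm
  · exact Or.inr (Or.inl (flipVertex_flipVertex x).symm)
  · exact Or.inr (Or.inr (flipFacet_flipFacet x).symm)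

theorem StepAtVertex.step {x y : Corner s} : StepAtVertex x y → Step x y := by
  rintro (h | h)
  exacts [Or.inl h, Or.inr (Or.inr h)]

theorem StepAtFacet.step {x y : Corner s} : StepAtFacet x y → Step x y := by
  rintro (h | h)
  exacts [Or.inl h, Or.inr (Or.inl h)]

open Relation in
theorem reflTransGen_symm {α : Type*} {r : α → α → Prop} (h : ∀ {x y}, r x y → r y x) {x y : α}
    (hxy : ReflTransGen r x y) : ReflTransGen r y x := by
  induction hxy with
  | refl => exact .refl
  | tail _ hbc ih => exact .head (h hbc) ih

/-! ### Walks among the corners -/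

section Vertex

open Relation

theorem edgeStep (x : Corner s) : ReflTransGen StepAtVertex x x.flipEdge := .single (Or.inl rfl)

theorem facetStep (x : Corner s) : ReflTransGen StepAtVertex x x.flipFacet := .single (Or.inr rfl)

/-- Two edge changes and two facet changes about a vertex of class `false` shift the edge by (1, 1)
and keep i − j; the next lemma does the same for class `true`, where the shift is (−1, 1) and i + j
is kept. -/
theorem walk_vertex_zero (i j : ZMod s) :
    ReflTransGen StepAtVertex ⟨false, false, false, i, j⟩ ⟨false, false, false, i + 1, j + 1⟩ :=
  (((facetStep ⟨false, false, false, i, j⟩).trans (edgeStep ⟨false, false, true, i, j⟩)).trans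
    (facetStep ⟨true, false, false, i + 1, j⟩)).trans (edgeStep ⟨true, false, true, i + 1, j⟩)

theorem walk_vertex_one (i j : ZMod s) :
    ReflTransGen StepAtVertex ⟨false, true, false, i, j⟩ ⟨false, true, false, i - 1, j + 1⟩ :=
  (((edgeStep ⟨false, true, false, i, j⟩).trans (facetStep ⟨true, true, false, i, j⟩)).trans
    (edgeStep ⟨true, true, true, i, j⟩)).trans (facetStep ⟨false, true, true, i - 1, j + 1⟩)

theorem walk_vertex_zero_nat (i j : ZMod s) (n : ℕ) :
    ReflTransGen StepAtVertex ⟨false, false, false, i, j⟩ ⟨false, false, false, i + n, j + n⟩ := by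
  induction n with
  | zero => simpa using ReflTransGen.refl
  | succ n ih =>
    push_cast
    rw [← add_assoc, ← add_assoc]
    exact ih.trans (walk_vertex_zero _ _)

theorem walk_vertex_one_nat (i j : ZMod s) (n : ℕ) :
    ReflTransGen StepAtVertex ⟨false, true, false, i, j⟩ ⟨false, true, false, i - n, j + n⟩ := by
  induction n with
  | zero => simpa using ReflTransGen.refl
  | succ n ih =>
    push_cast
    rw [← add_assoc, ← sub_sub]
    exact ih.trans (walk_vertex_one _ _)

theorem walk_vertex_normal (x : Corner s) :
    ∃ i j, ReflTransGen StepAtVertex x ⟨false, x.a, false, i, j⟩ ∧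
      BiFace.endpoint x.a false i j = x.vertex := by
  rcases x with ⟨_ | _, _ | _, _ | _, i, j⟩
  · exact ⟨i, j, .refl, rfl⟩
  · exact ⟨i, j, facetStep ⟨false, false, true, i, j⟩, rfl⟩
  · exact ⟨i, j, .refl, rfl⟩
  · exact ⟨i, j, facetStep ⟨false, true, true, i, j⟩, rfl⟩
  · exact ⟨i, j + 1, (facetStep ⟨true, false, false, i, j⟩).trans
      (edgeStep ⟨true, false, true, i, j⟩), by simp only [vertex, BiFace.endpoint]; ring⟩
  · exact ⟨i, j + 1, edgeStep ⟨true, false, true, i, j⟩,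
      by simp only [vertex, BiFace.endpoint]; ring⟩
  · exact ⟨i, j, edgeStep ⟨true, true, false, i, j⟩, rfl⟩
  · exact ⟨i, j, (facetStep ⟨true, true, true, i, j⟩).trans (edgeStep ⟨true, true, false, i, j⟩),
      rfl⟩

/-- The corners at a vertex form a single cycle. -/
theorem walk_vertex [NeZero s] {x y : Corner s} (ha : x.a = y.a) (h : x.vertex = y.vertex) :
    ReflTransGen StepAtVertex x y := by
  obtain ⟨i, j, h1, h2⟩ := walk_vertex_normal x
  obtain ⟨k, l, h3, h4⟩ := walk_vertex_normal y
  refine h1.trans (.trans ?_ (reflTransGen_symm StepAtVertex.symm h3))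
  rw [h, ← h4, ← ha] at h2
  rw [← ha]
  cases hxa : x.a <;> simp only [hxa, BiFace.endpoint] at h2
  · convert walk_vertex_zero_nat i j (k - i).val using 2
    · rw [ZMod.natCast_zmod_val]; ring
    · rw [ZMod.natCast_zmod_val]; linear_combination h2
  · convert walk_vertex_one_nat i j (i - k).val using 2
    · rw [ZMod.natCast_zmod_val]; ring
    · rw [ZMod.natCast_zmod_val]; linear_combination -h2

end Vertex

section Facet

open Relation

theorem edgeStep' (x : Corner s) : ReflTransGen StepAtFacet x x.flipEdge := .single (Or.inl rfl)

theorem vertexStep (x : Corner s) : ReflTransGen StepAtFacet x x.flipVertex := .single (Or.inr rfl)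

theorem walk_facet_normal (x : Corner s) :
    ReflTransGen StepAtFacet x ⟨false, true, false, x.fst, x.snd⟩ := by
  have h1 : ∀ i j : ZMod s,
      ReflTransGen StepAtFacet ⟨true, true, false, i, j⟩ ⟨false, true, false, i, j⟩ :=
    fun i j => edgeStep' _
  have h2 : ∀ i j : ZMod s,
      ReflTransGen StepAtFacet ⟨true, false, false, i, j⟩ ⟨false, true, false, i, j⟩ :=
    fun i j => (vertexStep _).trans (h1 i j)
  have h3 : ∀ i j : ZMod s,
      ReflTransGen StepAtFacet ⟨false, false, true, i, j⟩ ⟨false, true, false, i + 1, j⟩ :=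
    fun i j => (edgeStep' _).trans (h2 (i + 1) j)
  have h4 : ∀ i j : ZMod s,
      ReflTransGen StepAtFacet ⟨false, true, true, i, j⟩ ⟨false, true, false, i + 1, j⟩ :=
    fun i j => (vertexStep _).trans (h3 i j)
  have h5 : ∀ i j : ZMod s,
      ReflTransGen StepAtFacet ⟨false, false, false, i, j⟩ ⟨false, true, false, i, j⟩ :=
    fun i j => vertexStep _
  have h6 : ∀ i j : ZMod s,
      ReflTransGen StepAtFacet ⟨true, false, true, i, j⟩ ⟨false, true, false, i, j + 1⟩ :=
    fun i j => (edgeStep' _).trans (h5 i (j + 1))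
  rcases x with ⟨_ | _, _ | _, _ | _, i, j⟩
  · exact h5 i j
  · exact h3 i j
  · exact .refl
  · exact h4 i j
  · exact h2 i j
  · exact h6 i j
  · exact h1 i j
  · exact (vertexStep _).trans (h6 i j)

/-- The corners at a facet form a single cycle. -/
theorem walk_facet {x y : Corner s} (h : x.fst = y.fst) (h' : x.snd = y.snd) :
    ReflTransGen StepAtFacet x y := by
  have h1 := walk_facet_normal x
  rw [h, h'] at h1
  exact h1.trans (reflTransGen_symm StepAtFacet.symm (walk_facet_normal y))

theorem walk_normal (x : Corner s) :
    ReflTransGen Step x ⟨false, true, false, x.fst, x.snd⟩ :=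
  ReflTransGen.mono (fun _ _ h => h.step) _ _ (walk_facet_normal x)

/-- The facets form a torus grid: crossing an edge of kind `false` changes the first coordinate of
the facet, one of kind `true` the second. -/
theorem walk_fst (i j : ZMod s) (n : ℕ) :
    ReflTransGen Step ⟨false, true, false, i, j⟩ ⟨false, true, false, i + n, j⟩ := by
  induction n with
  | zero => simpa using ReflTransGen.refl
  | succ n ih =>
    push_cast
    rw [← add_assoc]
    exact (ih.tail (c := ⟨false, true, true, i + n, j⟩) (Or.inr (Or.inr rfl))).trans
      (walk_normal _)

theorem walk_snd (i j : ZMod s) (n : ℕ) :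
    ReflTransGen Step ⟨false, true, false, i, j⟩ ⟨false, true, false, i, j + n⟩ := by
  induction n with
  | zero => simpa using ReflTransGen.refl
  | succ n ih =>
    push_cast
    rw [← add_assoc]
    exact ((ih.tail (c := ⟨true, true, false, i, j + n⟩) (Or.inl rfl)).tail
      (c := ⟨true, true, true, i, j + n⟩) (Or.inr (Or.inr rfl))).trans (walk_normal _)

theorem walk [NeZero s] (x y : Corner s) : ReflTransGen Step x y := by
  refine (walk_normal x).trans (.trans ?_ (reflTransGen_symm Step.symm (walk_normal y)))
  have h := (walk_fst x.fst x.snd (y.fst - x.fst).val).trans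
    (walk_snd _ _ (y.snd - x.snd).val)
  simpa using h

end Facet

end Corner

/-! ### The model is a polyhedron -/

namespace BiFace

open RankedPoset

variable {s : ℕ}

theorem biMap_lt {x y : (biMap s).Face} : x < y ↔ BiFace.lt x y := BiFace.lt_iff

theorem biMap_le {x y : (biMap s).Face} : x ≤ y ↔ x = y ∨ BiFace.lt x y := BiFace.le_iff

theorem biMap_rank (x : (biMap s).Face) : (biMap s).rank x = BiFace.rank x := rfl

theorem isFlagGraded_biMap (s : ℕ) : (biMap s).IsFlagGraded := by
  refine isFlagGraded_of_interpolation (x₀ := BiFace.empty) (x₁ := BiFace.whole) ?_ ?_ ?_ rfl rfl ?_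
  · intro x
    change BiFace.rank x ∈ _
    cases x <;> simp [BiFace.rank]
  · intro x
    rw [biMap_le]
    cases x <;> simp [BiFace.lt]
  · intro x
    rw [biMap_le]
    cases x <;> simp [BiFace.lt]
  · intro x y hxy hr
    rw [biMap_lt] at hxy
    rw [biMap_rank, biMap_rank] at hr
    suffices hs : ∃ z : BiFace s, BiFace.lt x z ∧ BiFace.lt z y ∧ z.rank = BiFace.rank x + 1 by
      obtain ⟨z, h1, h2, h3⟩ := hs
      exact ⟨z, biMap_lt.2 h1, biMap_lt.2 h2, h3⟩
    rcases x with _ | ⟨_ | _, c⟩ | ⟨o, i, j⟩ | ⟨i, j⟩ | _ <;>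
      rcases y with _ | ⟨t, d⟩ | ⟨_ | _, k, l⟩ | ⟨k, l⟩ | _ <;>
      simp only [BiFace.rank, BiFace.lt] at hr hxy <;> try (exfalso; omega)
    · exact ⟨.vertex false (k - l), by simp [BiFace.lt, BiFace.rank, endpoint]⟩
    · exact ⟨.vertex true (k + l), by simp [BiFace.lt, BiFace.rank, endpoint]⟩
    · exact ⟨.vertex true (k + l), by simp [BiFace.lt, BiFace.rank]⟩
    · exact ⟨.vertex true 0, by simp [BiFace.lt, BiFace.rank]⟩
    · rcases hxy with rfl | rfl
      · exact ⟨.edge false k l, by simp [BiFace.lt, BiFace.rank, endpoint]⟩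
      · exact ⟨.edge true k l, by simp [BiFace.lt, BiFace.rank, endpoint]⟩
    · exact ⟨.edge false c 0, by simp [BiFace.lt, BiFace.rank, endpoint]⟩
    · rcases hxy with rfl | rfl
      · exact ⟨.edge true k l, by simp [BiFace.lt, BiFace.rank, endpoint]⟩
      · exact ⟨.edge true k (l - 1), by
          simp only [BiFace.lt, BiFace.rank, endpoint]; grind⟩
    · exact ⟨.edge false c 0, by simp [BiFace.lt, BiFace.rank, endpoint]⟩
    · exact ⟨.facet i j, by cases o <;> simp [BiFace.lt, BiFace.rank]⟩

end BiFace

namespace Corner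

open RankedPoset BiFace

variable {s : ℕ}

/-- The vertex of a corner, as a face. -/
def vertexFace (x : Corner s) : (biMap s).Face := BiFace.vertex x.a x.vertex

/-- The edge of a corner, as a face. -/
def edgeFace (x : Corner s) : (biMap s).Face := BiFace.edge x.o x.i x.j

/-- The facet of a corner, as a face. -/
def facetFace (x : Corner s) : (biMap s).Face := BiFace.facet x.fst x.snd

theorem vertexFace_lt (x : Corner s) : x.vertexFace < x.edgeFace := biMap_lt.2 rfl

theorem edgeFace_lt (x : Corner s) : x.edgeFace < x.facetFace := by
  rw [biMap_lt]
  rcases x with ⟨_ | _, _ | _, _ | _, i, j⟩ <;>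
    simp [edgeFace, facetFace, BiFace.lt, Corner.fst, Corner.snd]

/-- The flag of a corner. -/
noncomputable def flagAt (x : Corner s) : Flag (biMap s).Face :=
  (exists_flag x.vertexFace_lt.le x.edgeFace_lt.le).choose

theorem flagAt_spec (x : Corner s) :
    x.vertexFace ∈ x.flagAt ∧ x.edgeFace ∈ x.flagAt ∧ x.facetFace ∈ x.flagAt :=
  (exists_flag x.vertexFace_lt.le x.edgeFace_lt.le).choose_spec

theorem exists_flagAt_eq (Φ : Flag (biMap s).Face) : ∃ x, flagAt x = Φ := by
  have hG := isFlagGraded_biMap s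
  obtain ⟨u, hu, hu'⟩ := hG.exists_mem Φ (i := 0) (by norm_num) (by norm_num)
  obtain ⟨e, he, he'⟩ := hG.exists_mem Φ (i := 1) (by norm_num) (by norm_num)
  obtain ⟨f, hf, hf'⟩ := hG.exists_mem Φ (i := 2) (by norm_num) (by norm_num)
  have h1 := biMap_lt.1 (flag_lt_of_rank_lt hu he (by omega))
  have h2 := biMap_lt.1 (flag_lt_of_rank_lt he hf (by omega))
  suffices hs : ∃ x : Corner s, x.vertexFace = u ∧ x.edgeFace = e ∧ x.facetFace = f by
    obtain ⟨x, rfl, rfl, rfl⟩ := hs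
    exact ⟨x, hG.flag_eq_of_mem hu' he' hf' x.flagAt_spec.1 x.flagAt_spec.2.1 x.flagAt_spec.2.2
      hu he hf⟩
  rw [biMap_rank] at hu' he' hf'
  rcases u with _ | ⟨t, c⟩ | _ | _ | _ <;> simp only [BiFace.rank] at hu' <;>
    try (exfalso; omega)
  rcases e with _ | _ | ⟨o, i, j⟩ | _ | _ <;> simp only [BiFace.rank] at he' <;>
    try (exfalso; omega)
  rcases f with _ | _ | _ | ⟨k, l⟩ | _ <;> simp only [BiFace.rank] at hf' <;>
    try (exfalso; omega)
  simp only [BiFace.lt] at h1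
  subst h1
  cases o <;> simp only [BiFace.lt] at h2
  · obtain ⟨rfl | rfl, rfl⟩ := h2
    · exact ⟨⟨false, t, false, _, _⟩, rfl, rfl, rfl⟩
    · exact ⟨⟨false, t, true, _, _⟩, rfl, rfl, rfl⟩
  · obtain ⟨rfl, rfl | rfl⟩ := h2
    · exact ⟨⟨true, t, false, _, _⟩, rfl, rfl, rfl⟩
    · exact ⟨⟨true, t, true, _, _⟩, rfl, rfl, rfl⟩

theorem eq_of_mem_flagAt {x : Corner s} {z : (biMap s).Face} (hz : z ∈ x.flagAt) :
    z = BiFace.empty ∨ z = x.vertexFace ∨ z = x.edgeFace ∨ z = x.facetFace ∨ z = BiFace.whole := by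
  have hs := x.flagAt_spec
  have := biMap_rank z
  cases z with
  | empty => exact Or.inl rfl
  | vertex t c => exact Or.inr (Or.inl (flag_eq_of_rank_eq hz hs.1 rfl))
  | edge o i j => exact Or.inr (Or.inr (Or.inl (flag_eq_of_rank_eq hz hs.2.1 rfl)))
  | facet i j => exact Or.inr (Or.inr (Or.inr (Or.inl (flag_eq_of_rank_eq hz hs.2.2 rfl))))
  | whole => exact Or.inr (Or.inr (Or.inr (Or.inr rfl)))

theorem flagAdj_of_flip {x y : Corner s} (i : ℤ)
    (h0 : i ≠ 0 → x.vertexFace = y.vertexFace) (h1 : i ≠ 1 → x.edgeFace = y.edgeFace)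
    (h2 : i ≠ 2 → x.facetFace = y.facetFace)
    (hne : x.vertexFace ≠ y.vertexFace ∨ x.edgeFace ≠ y.edgeFace ∨ x.facetFace ≠ y.facetFace) :
    (biMap s).FlagAdj i x.flagAt y.flagAt := by
  have hG := isFlagGraded_biMap s
  have hx := x.flagAt_spec
  have hy := y.flagAt_spec
  refine (hG.eq_or_flagAdj i fun z hz hz0 hz2 hzi => ?_).resolve_left fun he => ?_
  · rcases eq_of_mem_flagAt hz with rfl | rfl | rfl | rfl | rfl
    · exact absurd hz0 (by change ¬ (0 : ℤ) ≤ -1; norm_num)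
    · rw [h0 (Ne.symm hzi)]
      exact hy.1
    · rw [h1 (Ne.symm hzi)]
      exact hy.2.1
    · rw [h2 (Ne.symm hzi)]
      exact hy.2.2
    · exact absurd hz2 (by change ¬ (3 : ℤ) ≤ 2; norm_num)
  · rw [he] at hx
    rcases hne with h | h | h
    · exact h (flag_eq_of_rank_eq hx.1 hy.1 rfl)
    · exact h (flag_eq_of_rank_eq hx.2.1 hy.2.1 rfl)
    · exact h (flag_eq_of_rank_eq hx.2.2 hy.2.2 rfl)

theorem flipEdge_vertexFace (x : Corner s) : x.flipEdge.vertexFace = x.vertexFace := by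
  rw [vertexFace, vertexFace, flipEdge_a, flipEdge_vertex]

theorem flipEdge_facetFace (x : Corner s) : x.flipEdge.facetFace = x.facetFace := by
  rw [facetFace, facetFace, flipEdge_fst, flipEdge_snd]

theorem flipVertex_facetFace (x : Corner s) : x.flipVertex.facetFace = x.facetFace := by
  rcases x with ⟨_ | _, _ | _, _ | _, i, j⟩ <;> rfl

theorem flagAdj_flipEdge (x : Corner s) : (biMap s).FlagAdj 1 x.flagAt x.flipEdge.flagAt := by
  refine flagAdj_of_flip 1 (fun _ => x.flipEdge_vertexFace.symm) (fun h => absurd rfl h)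
    (fun _ => x.flipEdge_facetFace.symm) (Or.inr (Or.inl fun h => ?_))
  have h' := (BiFace.edge.inj h).1
  rw [flipEdge_o] at h'
  cases hx : x.o <;> simp [hx] at h'

theorem flagAdj_flipVertex (x : Corner s) :
    (biMap s).FlagAdj 0 x.flagAt x.flipVertex.flagAt := by
  refine flagAdj_of_flip 0 (fun h => absurd rfl h) (fun _ => rfl)
    (fun _ => x.flipVertex_facetFace.symm) (Or.inl fun h => ?_)
  have h' := (BiFace.vertex.inj h).1
  cases hx : x.a <;> simp [flipVertex, hx] at h'

theorem flagAdj_flipFacet (h1 : (1 : ZMod s) ≠ 0) (x : Corner s) :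
    (biMap s).FlagAdj 2 x.flagAt x.flipFacet.flagAt := by
  refine flagAdj_of_flip 2 (fun _ => rfl) (fun _ => rfl) (fun h => absurd rfl h)
    (Or.inr (Or.inr fun h => ?_))
  have h' := BiFace.facet.inj h
  rcases x with ⟨_ | _, _ | _, _ | _, i, j⟩ <;>
    simp [flipFacet, Corner.fst, Corner.snd, h1] at h'

end Corner

namespace BiFace

open RankedPoset

variable {s : ℕ}

/-- The three flips of corners are adjacencies of flags, so the walks of corners supply the
connectivity. The hypothesis `h1` keeps the two facets at an edge distinct. -/
theorem isPolyhedron_biMap [NeZero s] (h1 : (1 : ZMod s) ≠ 0) : (biMap s).IsPolyhedron := by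
  have hG := isFlagGraded_biMap s
  refine ⟨hG.rank_mem, hG.existsUnique_least, hG.existsUnique_greatest, hG.flag_rank,
    hG.strongly_connected_of ?_ ?_ ?_, ?_⟩
  · intro Φ Ψ z hz hΦ hΨ
    obtain ⟨x, rfl⟩ := Corner.exists_flagAt_eq Φ
    obtain ⟨y, rfl⟩ := Corner.exists_flagAt_eq Ψ
    obtain rfl : z = x.vertexFace := flag_eq_of_rank_eq hΦ x.flagAt_spec.1 hz
    have hxy : x.vertexFace = y.vertexFace := flag_eq_of_rank_eq hΨ y.flagAt_spec.1 rfl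
    have hw := Corner.walk_vertex (BiFace.vertex.inj hxy).1 (BiFace.vertex.inj hxy).2
    clear hΨ hxy
    induction hw with
    | refl => exact .refl
    | @tail a b h hab ih =>
      refine ih.tail ⟨?_, ?_⟩
      · rcases hab with rfl | rfl
        · exact ⟨1, a.flagAdj_flipEdge⟩
        · exact ⟨2, a.flagAdj_flipFacet h1⟩
      · have : ∀ c, Relation.ReflTransGen Corner.StepAtVertex x c →
            x.vertexFace = c.vertexFace := by
          intro c hc
          induction hc with
          | refl => rfl
          | @tail a b h hab ih =>
            rw [ih]
            rcases hab with rfl | rfl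
            · exact a.flipEdge_vertexFace.symm
            · rfl
        rw [this b (h.tail hab)]
        exact b.flagAt_spec.1
  · intro Φ Ψ z hz hΦ hΨ
    obtain ⟨x, rfl⟩ := Corner.exists_flagAt_eq Φ
    obtain ⟨y, rfl⟩ := Corner.exists_flagAt_eq Ψ
    obtain rfl : z = x.facetFace := flag_eq_of_rank_eq hΦ x.flagAt_spec.2.2 hz
    have hxy : x.facetFace = y.facetFace := flag_eq_of_rank_eq hΨ y.flagAt_spec.2.2 rfl
    have hw := Corner.walk_facet (BiFace.facet.inj hxy).1 (BiFace.facet.inj hxy).2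
    clear hΨ hxy
    induction hw with
    | refl => exact .refl
    | @tail a b h hab ih =>
      refine ih.tail ⟨?_, ?_⟩
      · rcases hab with rfl | rfl
        · exact ⟨1, a.flagAdj_flipEdge⟩
        · exact ⟨0, a.flagAdj_flipVertex⟩
      · have : ∀ c, Relation.ReflTransGen Corner.StepAtFacet x c →
            x.facetFace = c.facetFace := by
          intro c hc
          induction hc with
          | refl => rfl
          | @tail a b h hab ih =>
            rw [ih]
            rcases hab with rfl | rfl
            · exact a.flipEdge_facetFace.symm
            · exact a.flipVertex_facetFace.symm
        rw [this b (h.tail hab)]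
        exact b.flagAt_spec.2.2
  · intro Φ Ψ
    obtain ⟨x, rfl⟩ := Corner.exists_flagAt_eq Φ
    obtain ⟨y, rfl⟩ := Corner.exists_flagAt_eq Ψ
    refine Relation.ReflTransGen.lift Corner.flagAt (fun a b hab => ?_) _ _ (Corner.walk x y)
    rcases hab with rfl | rfl | rfl
    · exact ⟨1, a.flagAdj_flipEdge⟩
    · exact ⟨0, a.flagAdj_flipVertex⟩
    · exact ⟨2, a.flagAdj_flipFacet h1⟩
  · intro F G hFG hr
    rw [biMap_lt] at hFG
    rw [biMap_rank, biMap_rank] at hr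
    have hset : ∀ {p q : (biMap s).Face}, p ≠ q → (∀ H, BiFace.lt F H ∧ BiFace.lt H G ↔
        H = p ∨ H = q) → {H : (biMap s).Face | F < H ∧ H < G}.encard = 2 := by
      intro p q hpq h
      rw [← Set.encard_pair hpq]
      congr 1
      ext H
      change F < H ∧ H < G ↔ H = p ∨ H = q
      rw [biMap_lt, biMap_lt, h]
    rcases F with _ | ⟨_ | _, c⟩ | ⟨_ | _, i, j⟩ | ⟨i, j⟩ | _ <;>
      rcases G with _ | ⟨t, d⟩ | ⟨o, k, l⟩ | ⟨k, l⟩ | _ <;>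
      simp only [BiFace.rank, BiFace.lt] at hr hFG <;> try (exfalso; omega)
    · refine hset (p := .vertex false (endpoint false o k l))
        (q := .vertex true (endpoint true o k l)) (by simp) fun H => ?_
      rcases H with _ | ⟨_ | _, c⟩ | _ | _ | _ <;> simp [BiFace.lt]
    · rcases hFG with rfl | rfl
      · refine hset (p := .edge false k l) (q := .edge true k (l - 1)) (by simp) fun H => ?_
        rcases H with _ | _ | ⟨_ | _, i, j⟩ | _ | _ <;> simp [BiFace.lt, endpoint] <;> grind
      · refine hset (p := .edge false (k - 1) l) (q := .edge true k l) (by simp) fun H => ?_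
        rcases H with _ | _ | ⟨_ | _, i, j⟩ | _ | _ <;> simp [BiFace.lt, endpoint] <;> grind
    · rcases hFG with rfl | rfl
      · refine hset (p := .edge false k l) (q := .edge true k l) (by simp) fun H => ?_
        rcases H with _ | _ | ⟨_ | _, i, j⟩ | _ | _ <;> simp [BiFace.lt, endpoint] <;> grind
      · refine hset (p := .edge false (k - 1) l) (q := .edge true k (l - 1)) (by simp) fun H => ?_
        rcases H with _ | _ | ⟨_ | _, i, j⟩ | _ | _ <;> simp [BiFace.lt, endpoint] <;> grind
    · refine hset (p := .facet i j) (q := .facet (i + 1) j) (by simp [h1]) fun H => ?_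
      rcases H with _ | _ | _ | ⟨k, l⟩ | _ <;> simp [BiFace.lt]; grind
    · refine hset (p := .facet i j) (q := .facet i (j + 1)) (by simp [h1]) fun H => ?_
      rcases H with _ | _ | _ | ⟨k, l⟩ | _ <;> simp [BiFace.lt]; grind

end BiFace

/-! ### Reflections, faithfulness and type of the model -/

namespace BiFace

open RankedPoset

variable {s : ℕ}

/-- An involution that preserves incidence, as an automorphism. -/
def autOfInvolutive (f : BiFace s → BiFace s) (hf : ∀ x, f (f x) = x)
    (h : ∀ x y, x.lt y → (f x).lt (f y)) : (biMap s).Face ≃o (biMap s).Face where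
  toFun := f
  invFun := f
  left_inv := hf
  right_inv := hf
  map_rel_iff' := by
    have key : ∀ x y : BiFace s, x ≤ y → f x ≤ f y := by
      rintro x y (rfl | hxy)
      · exact le_rfl
      · exact Or.inr (h x y hxy)
    intro x y
    refine ⟨fun hxy => ?_, key x y⟩
    have := key _ _ hxy
    change f (f x) ≤ f (f y) at this
    rwa [hf, hf] at this

/-- The reflection that moves the base vertex. -/
def reflVertex : BiFace s → BiFace s
  | empty => empty
  | vertex t c => vertex (!t) c
  | edge false i j => edge false i (-j)
  | edge true i j => edge true i (-j - 1)
  | facet i j => facet i (-j)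
  | whole => whole

/-- The reflection that moves the base edge. -/
def reflEdge : BiFace s → BiFace s
  | empty => empty
  | vertex false c => vertex false c
  | vertex true c => vertex true (1 - c)
  | edge false i j => edge true (1 - j) (-i)
  | edge true i j => edge false (-j) (1 - i)
  | facet i j => facet (1 - j) (1 - i)
  | whole => whole

/-- The reflection that moves the base facet. -/
def reflFacet : BiFace s → BiFace s
  | empty => empty
  | vertex t c => vertex t (-c)
  | edge false i j => edge false (-i) (-j)
  | edge true i j => edge true (1 - i) (-j - 1)
  | facet i j => facet (1 - i) (-j)
  | whole => whole

/-- The distinguished generators of the automorphism group of `biMap s`. -/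
def refl (s : ℕ) : Fin 3 → ((biMap s).Face ≃o (biMap s).Face) :=
  ![autOfInvolutive reflVertex
      (by rintro (_ | ⟨_ | _, c⟩ | ⟨_ | _, i, j⟩ | ⟨i, j⟩ | _) <;> simp [reflVertex])
      (by
        rintro (_ | ⟨_ | _, c⟩ | ⟨_ | _, i, j⟩ | ⟨i, j⟩ | _)
          (_ | ⟨_ | _, d⟩ | ⟨_ | _, k, l⟩ | ⟨k, l⟩ | _) <;>
        simp [reflVertex, BiFace.lt, endpoint] <;> grind),
    autOfInvolutive reflEdge
      (by rintro (_ | ⟨_ | _, c⟩ | ⟨_ | _, i, j⟩ | ⟨i, j⟩ | _) <;> simp [reflEdge])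
      (by
        rintro (_ | ⟨_ | _, c⟩ | ⟨_ | _, i, j⟩ | ⟨i, j⟩ | _)
          (_ | ⟨_ | _, d⟩ | ⟨_ | _, k, l⟩ | ⟨k, l⟩ | _) <;>
        simp [reflEdge, BiFace.lt, endpoint] <;> grind),
    autOfInvolutive reflFacet
      (by rintro (_ | ⟨_ | _, c⟩ | ⟨_ | _, i, j⟩ | ⟨i, j⟩ | _) <;> simp [reflFacet])
      (by
        rintro (_ | ⟨_ | _, c⟩ | ⟨_ | _, i, j⟩ | ⟨i, j⟩ | _)
          (_ | ⟨_ | _, d⟩ | ⟨_ | _, k, l⟩ | ⟨k, l⟩ | _) <;>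
        simp [reflFacet, BiFace.lt, endpoint] <;> grind)]

/-- The base corner. -/
def baseCorner (s : ℕ) : Corner s := ⟨false, false, true, 0, 0⟩

theorem baseCorner_vertexFace : (baseCorner s).vertexFace = vertex false 0 := by
  simp [baseCorner, Corner.vertexFace, Corner.vertex, endpoint]

theorem baseCorner_edgeFace : (baseCorner s).edgeFace = edge false 0 0 := rfl

theorem baseCorner_facetFace : (baseCorner s).facetFace = facet 1 0 := by
  simp [baseCorner, Corner.facetFace, Corner.fst, Corner.snd]

/-- On the vertices these reflections act by the formulas of `IsRegularVertexAction.exists_equiv`,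
which is what the comparison with an arbitrary polyhedron needs. -/
theorem isGenerators_refl (h1 : (1 : ZMod s) ≠ 0) :
    (biMap s).IsGenerators (baseCorner s).flagAt (refl s) := by
  have hcase : ∀ x ∈ (baseCorner s).flagAt, x = BiFace.empty ∨ x = BiFace.vertex false 0 ∨
      x = BiFace.edge false 0 0 ∨ x = BiFace.facet 1 0 ∨ x = BiFace.whole := fun x hx => by
    have := Corner.eq_of_mem_flagAt hx
    rwa [baseCorner_vertexFace, baseCorner_edgeFace, baseCorner_facetFace] at this
  refine ⟨?_, ?_, ?_⟩
  · intro i x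
    change BiFace.rank (refl s i x) = BiFace.rank x
    fin_cases i
    · change BiFace.rank (reflVertex x) = _
      rcases x with _ | ⟨_ | _, c⟩ | ⟨_ | _, i, j⟩ | ⟨i, j⟩ | _ <;> rfl
    · change BiFace.rank (reflEdge x) = _
      rcases x with _ | ⟨_ | _, c⟩ | ⟨_ | _, i, j⟩ | ⟨i, j⟩ | _ <;> rfl
    · change BiFace.rank (reflFacet x) = _
      rcases x with _ | ⟨_ | _, c⟩ | ⟨_ | _, i, j⟩ | ⟨i, j⟩ | _ <;> rfl
  · intro i x hx hr
    change BiFace.rank x ≠ _ at hr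
    fin_cases i
    · change reflVertex x = x
      rcases hcase x hx with rfl | rfl | rfl | rfl | rfl <;> simp [reflVertex, BiFace.rank] at hr ⊢
    · change reflEdge x = x
      rcases hcase x hx with rfl | rfl | rfl | rfl | rfl <;> simp [reflEdge, BiFace.rank] at hr ⊢
    · change reflFacet x = x
      rcases hcase x hx with rfl | rfl | rfl | rfl | rfl <;> simp [reflFacet, BiFace.rank] at hr ⊢
  · intro i x hx hr
    change BiFace.rank x = _ at hr
    fin_cases i
    · change reflVertex x ≠ x
      rcases hcase x hx with rfl | rfl | rfl | rfl | rfl <;> simp [reflVertex, BiFace.rank] at hr ⊢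
    · change reflEdge x ≠ x
      rcases hcase x hx with rfl | rfl | rfl | rfl | rfl <;> simp [reflEdge, BiFace.rank] at hr ⊢
    · change reflFacet x ≠ x
      rcases hcase x hx with rfl | rfl | rfl | rfl | rfl <;>
        simp [reflFacet, BiFace.rank, h1.symm] at hr ⊢

/-- The vertices of the base facet determine i − j and i + j, and `h2` recovers i and j from them.
For even `s` the translation by (s/2, s/2) would fix all vertices. -/
theorem isVertexFaithful_biMap [NeZero s] (h1 : (1 : ZMod s) ≠ 0)
    (h2 : ∀ x : ZMod s, 2 * x = 0 → x = 0) : (biMap s).IsVertexFaithful := by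
  have h2' : (2 : ZMod s) ≠ 0 := fun h => h1 (h2 1 (by rw [mul_one, h]))
  intro g hg hfix
  have hv : ∀ t c, g (BiFace.vertex t c) = BiFace.vertex t c := fun t c =>
    hfix (BiFace.vertex t c) rfl
  have hrank : ∀ x, BiFace.rank (g x) = BiFace.rank x := hg
  have hlt : ∀ {x y : BiFace s}, BiFace.lt x y → BiFace.lt (g x) (g y) := fun {x y} h =>
    biMap_lt.1 (g.lt_iff_lt.2 (biMap_lt.2 h))
  have hfacet : g (BiFace.facet 1 0) = BiFace.facet 1 0 := by
    have hr := hrank (BiFace.facet 1 0)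
    have e1 := hlt (x := .vertex false 1) (y := .facet 1 0) (by simp [BiFace.lt])
    have e2 := hlt (x := .vertex false 0) (y := .facet 1 0) (by simp [BiFace.lt])
    have e3 := hlt (x := .vertex true 1) (y := .facet 1 0) (by simp [BiFace.lt])
    have e4 := hlt (x := .vertex true 0) (y := .facet 1 0) (by simp [BiFace.lt])
    rw [hv] at e1 e2 e3 e4
    generalize g (BiFace.facet 1 0) = y at *
    rcases y with _ | _ | _ | ⟨k, l⟩ | _ <;> simp only [BiFace.rank] at hr <;>
      try (exfalso; omega)
    simp only [BiFace.lt] at e1 e2 e3 e4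
    have hk : k - 1 = 0 := h2 _ (by grind)
    have hl : l = 0 := h2 _ (by grind)
    rw [hl, sub_eq_zero.1 hk]
  have hedge : g (BiFace.edge false 0 0) = BiFace.edge false 0 0 := by
    have hr := hrank (BiFace.edge false 0 0)
    have e1 := hlt (x := .vertex false 0) (y := .edge false 0 0) (by simp [BiFace.lt, endpoint])
    have e2 := hlt (x := .vertex true 0) (y := .edge false 0 0) (by simp [BiFace.lt, endpoint])
    have e3 := hlt (x := .edge false 0 0) (y := .facet 1 0) (by simp [BiFace.lt])
    rw [hv] at e1 e2
    rw [hfacet] at e3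
    generalize g (BiFace.edge false 0 0) = y at *
    rcases y with _ | _ | ⟨_ | _, k, l⟩ | _ | _ <;> simp only [BiFace.rank] at hr <;>
      try (exfalso; omega)
    · simp only [BiFace.lt, endpoint] at e1 e2 e3
      have hk : k = 0 := h2 _ (by grind)
      -- The other edge with the same ends, of kind `true`, is not on the base facet; the next case
      -- refutes it.
      rw [hk, ← e3.2]
    · simp only [BiFace.lt, endpoint] at e1 e2 e3
      grind
  refine (isPolyhedron_biMap h1).eq_one_of_fix_flag (Φ := (baseCorner s).flagAt) fun x hx => ?_
  have hc := Corner.eq_of_mem_flagAt hx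
  rw [baseCorner_vertexFace, baseCorner_edgeFace, baseCorner_facetFace] at hc
  have hG := isFlagGraded_biMap s
  rcases hc with rfl | rfl | rfl | rfl | rfl
  · exact hG.existsUnique_least.unique (hrank _) rfl
  · exact hv _ _
  · exact hedge
  · exact hfacet
  · exact hG.existsUnique_greatest.unique (hrank _) rfl

/-- The vertices, listed by their class and their position. -/
noncomputable def vertexEquiv (s : ℕ) : Bool × ZMod s ≃ (biMap s).vertices :=
  Equiv.ofBijective (fun x => ⟨BiFace.vertex x.1 x.2, rfl⟩) <| by
    constructor
    · rintro ⟨t, c⟩ ⟨t', c'⟩ h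
      have := BiFace.vertex.inj (congrArg Subtype.val h)
      exact Prod.ext this.1 this.2
    · rintro ⟨x, hx⟩
      change BiFace.rank x = 0 at hx
      rcases x with _ | ⟨t, c⟩ | _ | _ | _ <;> simp only [BiFace.rank] at hx <;>
        try (exfalso; omega)
      exact ⟨(t, c), rfl⟩

theorem encard_bool_prod [NeZero s] : ENat.card (Bool × ZMod s) = (2 * s : ℕ) := by
  rw [ENat.card_eq_coe_natCard, Nat.card_prod, Nat.card_zmod]
  simp

theorem encard_vertices_biMap [NeZero s] : (biMap s).vertices.encard = (2 * s : ℕ) := by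
  rw [← encard_bool_prod, ENat.card_congr (vertexEquiv s)]
  rfl

theorem hasType_biMap [NeZero s] (h1 : (1 : ZMod s) ≠ 0) :
    (biMap s).HasType 4 (2 * s : ℕ) := by
  constructor
  · intro F hF
    change BiFace.rank F = 2 at hF
    rcases F with _ | _ | _ | ⟨i, j⟩ | _ <;> simp only [BiFace.rank] at hF <;>
      try (exfalso; omega)
    have : {x : (biMap s).Face | (biMap s).rank x = 0 ∧ x < BiFace.facet i j} =
        {BiFace.vertex false (i - j), BiFace.vertex false (i - j - 1), BiFace.vertex true (i + j),
          BiFace.vertex true (i + j - 1)} := by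
      ext x
      change BiFace.rank x = 0 ∧ _ ↔ x = _ ∨ x = _ ∨ x = _ ∨ x = _
      rw [biMap_lt]
      rcases x with _ | ⟨_ | _, c⟩ | _ | _ | _ <;> simp [BiFace.rank, BiFace.lt]
    rw [this, Set.encard_insert_of_notMem, Set.encard_insert_of_notMem, Set.encard_pair]
    · norm_num
    · simp only [ne_eq, BiFace.vertex.injEq, true_and]
      exact fun h => h1 (by linear_combination h)
    · simp
    · simp only [Set.mem_insert_iff, Set.mem_singleton_iff, BiFace.vertex.injEq, true_and]
      rintro (h | h | h)
      · exact h1 (by linear_combination h)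
      · exact absurd h.1 (by decide)
      · exact absurd h.1 (by decide)
  · intro x hx
    change BiFace.rank x = 0 at hx
    rcases x with _ | ⟨t, c⟩ | _ | _ | _ <;> simp only [BiFace.rank] at hx <;>
      try (exfalso; omega)
    rw [← encard_bool_prod]
    -- At a given vertex, the kind and the second coordinate of an edge determine the first, by
    -- solving `endpoint` for it.
    let f : Bool × ZMod s → (biMap s).Face := fun x =>
      match t, x.1 with
      | false, false => BiFace.edge false (c + x.2) x.2
      | false, true => BiFace.edge true (c + x.2 + 1) x.2
      | true, o => BiFace.edge o (c - x.2) x.2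
    have hf : Function.Injective f := by
      rintro ⟨_ | _, i⟩ ⟨_ | _, j⟩ h <;> cases t <;> simp_all [f]
    rw [ENat.card_congr (Equiv.ofInjective f hf)]
    change _ = (Set.range f).encard
    congr 1
    ext e
    change BiFace.rank e = 1 ∧ _ ↔ ∃ y, f y = e
    rw [biMap_lt]
    constructor
    · rcases e with _ | _ | ⟨o, i, j⟩ | _ | _ <;> simp only [BiFace.rank, BiFace.lt] <;>
        try (intro h; exfalso; omega)
      rintro ⟨-, rfl⟩
      refine ⟨(o, j), ?_⟩
      cases t <;> cases o <;> simp [f, endpoint]; ring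
    · rintro ⟨⟨o, j⟩, rfl⟩
      cases t <;> cases o <;> simp [f, BiFace.rank, BiFace.lt, endpoint]; ring

end BiFace

/-! ### The toroidal map -/

namespace TorusFace

open RankedPoset

variable {s : ℕ}

theorem toroidal_lt {x y : (toroidalMap44 s).Face} : x < y ↔ TorusFace.lt x y := TorusFace.lt_iff

theorem isFlagGraded_toroidal (s : ℕ) : (toroidalMap44 s).IsFlagGraded := by
  refine isFlagGraded_of_interpolation (x₀ := TorusFace.empty) (x₁ := TorusFace.whole)
    ?_ ?_ ?_ rfl rfl ?_
  · intro (x : TorusFace s)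
    change TorusFace.rank x ∈ _
    cases x <;> simp [TorusFace.rank]
  · intro (x : TorusFace s)
    change TorusFace.empty = x ∨ TorusFace.lt TorusFace.empty x
    cases x <;> simp [TorusFace.lt]
  · intro (x : TorusFace s)
    change x = TorusFace.whole ∨ TorusFace.lt x TorusFace.whole
    cases x <;> simp [TorusFace.lt]
  · intro (x : TorusFace s) (y : TorusFace s) hxy hr
    have hxy' : x.lt y := toroidal_lt.1 hxy
    change x.rank + 2 ≤ y.rank at hr
    suffices hs : ∃ z : TorusFace s, x.lt z ∧ z.lt y ∧ z.rank = x.rank + 1 by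
      obtain ⟨z, h1, h2, h3⟩ := hs
      exact ⟨z, toroidal_lt.2 h1, toroidal_lt.2 h2, h3⟩
    clear hxy
    rcases x with _ | ⟨i, j⟩ | ⟨i, j⟩ | ⟨i, j⟩ | ⟨i, j⟩ | _ <;>
      rcases y with _ | ⟨k, l⟩ | ⟨k, l⟩ | ⟨k, l⟩ | ⟨k, l⟩ | _ <;>
      simp only [TorusFace.rank, TorusFace.lt] at hr hxy' <;> try (exfalso; omega)
    · exact ⟨.vertex k l, by simp [TorusFace.lt, TorusFace.rank]⟩
    · exact ⟨.vertex k l, by simp [TorusFace.lt, TorusFace.rank]⟩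
    · exact ⟨.vertex k l, by simp [TorusFace.lt, TorusFace.rank]⟩
    · exact ⟨.vertex 0 0, by simp [TorusFace.lt, TorusFace.rank]⟩
    · exact ⟨.hEdge k j, by simpa [TorusFace.lt, TorusFace.rank] using hxy'⟩
    · exact ⟨.hEdge i j, by simp [TorusFace.lt, TorusFace.rank]⟩
    · exact ⟨.square i j, by simp [TorusFace.lt, TorusFace.rank]⟩
    · exact ⟨.square i j, by simp [TorusFace.lt, TorusFace.rank]⟩

end TorusFace

/-! ### Petrie polygons of the toroidal map as diagonal zigzags -/

namespace Corner

open RankedPoset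

variable {s : ℕ}

/-- The first coordinate of the square of the toroidal map at a corner. -/
def sqFst (x : Corner s) : ZMod s := if x.o = true ∧ x.a = x.b then x.i - 1 else x.i

/-- The second coordinate of the square of the toroidal map at a corner. -/
def sqSnd (x : Corner s) : ZMod s := if x.o = false ∧ x.a = x.b then x.j - 1 else x.j

/-- The vertex of the toroidal map at a corner. -/
def torusVertex (x : Corner s) : TorusFace s := .vertex x.fst x.snd

/-- The edge of the toroidal map at a corner. -/
def torusEdge (x : Corner s) : TorusFace s := if x.o then .vEdge x.i x.j else .hEdge x.i x.j

/-- The square of the toroidal map at a corner. -/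
def torusSquare (x : Corner s) : TorusFace s := .square x.sqFst x.sqSnd

theorem torusVertex_lt (x : Corner s) : x.torusVertex.lt x.torusEdge := by
  rcases x with ⟨_ | _, _ | _, _ | _, i, j⟩ <;>
    simp [torusVertex, torusEdge, TorusFace.lt, fst, snd]

theorem torusEdge_lt (x : Corner s) : x.torusEdge.lt x.torusSquare := by
  rcases x with ⟨_ | _, _ | _, _ | _, i, j⟩ <;>
    simp [torusSquare, torusEdge, TorusFace.lt, sqFst, sqSnd]

theorem torusEdge_rank (x : Corner s) : x.torusEdge.rank = 1 := by
  rcases x with ⟨_ | _, _ | _, _ | _, i, j⟩ <;> rfl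

/-- The flag of the toroidal map at a corner. -/
noncomputable def torusFlag (x : Corner s) : Flag (toroidalMap44 s).Face :=
  (exists_flag (TorusFace.toroidal_lt.2 x.torusVertex_lt).le
    (TorusFace.toroidal_lt.2 x.torusEdge_lt).le).choose

theorem torusFlag_spec (x : Corner s) :
    x.torusVertex ∈ x.torusFlag ∧ x.torusEdge ∈ x.torusFlag ∧ x.torusSquare ∈ x.torusFlag :=
  (exists_flag (TorusFace.toroidal_lt.2 x.torusVertex_lt).le
    (TorusFace.toroidal_lt.2 x.torusEdge_lt).le).choose_spec

/-- The corners of the model also label the flags of the torus map: `b` selects an end of the edge,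
and comparing `a` with `b` selects the side on which the square lies. -/
theorem exists_torusFlag_eq (Φ : Flag (toroidalMap44 s).Face) : ∃ x, torusFlag x = Φ := by
  have hG := TorusFace.isFlagGraded_toroidal s
  obtain ⟨u, hu, hu'⟩ := hG.exists_mem Φ (i := 0) (by norm_num) (by norm_num)
  obtain ⟨e, he, he'⟩ := hG.exists_mem Φ (i := 1) (by norm_num) (by norm_num)
  obtain ⟨f, hf, hf'⟩ := hG.exists_mem Φ (i := 2) (by norm_num) (by norm_num)
  have h1 := TorusFace.toroidal_lt.1 (flag_lt_of_rank_lt hu he (by omega))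
  have h2 := TorusFace.toroidal_lt.1 (flag_lt_of_rank_lt he hf (by omega))
  suffices hs : ∃ x : Corner s, x.torusVertex = u ∧ x.torusEdge = e ∧ x.torusSquare = f by
    obtain ⟨x, rfl, rfl, rfl⟩ := hs
    exact ⟨x, hG.flag_eq_of_mem hu' he' hf' x.torusFlag_spec.1 x.torusFlag_spec.2.1
      x.torusFlag_spec.2.2 hu he hf⟩
  clear hu he hf
  change TorusFace.rank u = 0 at hu'
  change TorusFace.rank e = 1 at he'
  change TorusFace.rank f = 2 at hf'
  change TorusFace s at u e f
  rcases u with _ | ⟨i, j⟩ | _ | _ | _ | _ <;> simp only [TorusFace.rank] at hu' <;>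
    try (exfalso; omega)
  rcases f with _ | _ | _ | _ | ⟨m, n⟩ | _ <;> simp only [TorusFace.rank] at hf' <;>
    try (exfalso; omega)
  rcases e with _ | _ | ⟨k, l⟩ | ⟨k, l⟩ | _ | _ <;> simp only [TorusFace.rank] at he' <;>
    try (exfalso; omega)
  · simp only [TorusFace.lt] at h1 h2
    obtain ⟨h1 | h1, rfl⟩ := h1 <;> obtain ⟨rfl, h2 | h2⟩ := h2 <;> subst h1 <;> subst h2
    · exact ⟨⟨false, true, false, _, _⟩, rfl, rfl, by simp [torusSquare, sqFst, sqSnd]⟩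
    · exact ⟨⟨false, false, false, _, _⟩, rfl, rfl, by simp [torusSquare, sqFst, sqSnd]⟩
    · exact ⟨⟨false, false, true, _, _⟩, rfl, rfl, by simp [torusSquare, sqFst, sqSnd]⟩
    · exact ⟨⟨false, true, true, _, _⟩, rfl, rfl, by simp [torusSquare, sqFst, sqSnd]⟩
  · simp only [TorusFace.lt] at h1 h2
    obtain ⟨rfl, h1 | h1⟩ := h1 <;> obtain ⟨h2 | h2, rfl⟩ := h2 <;> subst h1 <;> subst h2
    · exact ⟨⟨true, true, false, _, _⟩, rfl, rfl, by simp [torusSquare, sqFst, sqSnd]⟩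
    · exact ⟨⟨true, false, false, _, _⟩, rfl, rfl, by simp [torusSquare, sqFst, sqSnd]⟩
    · exact ⟨⟨true, false, true, _, _⟩, rfl, rfl, by simp [torusSquare, sqFst, sqSnd]⟩
    · exact ⟨⟨true, true, true, _, _⟩, rfl, rfl, by simp [torusSquare, sqFst, sqSnd]⟩

theorem eq_of_mem_torusFlag {x : Corner s} {z : TorusFace s}
    (hz : (z : (toroidalMap44 s).Face) ∈ x.torusFlag) :
    z = .empty ∨ z = x.torusVertex ∨ z = x.torusEdge ∨ z = x.torusSquare ∨ z = .whole := by
  have hs := x.torusFlag_spec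
  cases z with
  | empty => exact Or.inl rfl
  | vertex i j => exact Or.inr (Or.inl (flag_eq_of_rank_eq hz hs.1 rfl))
  | hEdge i j =>
    exact Or.inr (Or.inr (Or.inl (flag_eq_of_rank_eq hz hs.2.1 x.torusEdge_rank.symm)))
  | vEdge i j =>
    exact Or.inr (Or.inr (Or.inl (flag_eq_of_rank_eq hz hs.2.1 x.torusEdge_rank.symm)))
  | square i j => exact Or.inr (Or.inr (Or.inr (Or.inl (flag_eq_of_rank_eq hz hs.2.2 rfl))))
  | whole => exact Or.inr (Or.inr (Or.inr (Or.inr rfl)))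

theorem torusFlagAdj_of_flip {x y : Corner s} (i : ℤ)
    (h0 : i ≠ 0 → x.torusVertex = y.torusVertex) (h1 : i ≠ 1 → x.torusEdge = y.torusEdge)
    (h2 : i ≠ 2 → x.torusSquare = y.torusSquare)
    (hne : x.torusVertex ≠ y.torusVertex ∨ x.torusEdge ≠ y.torusEdge ∨
      x.torusSquare ≠ y.torusSquare) :
    (toroidalMap44 s).FlagAdj i x.torusFlag y.torusFlag := by
  have hG := TorusFace.isFlagGraded_toroidal s
  have hx := x.torusFlag_spec
  have hy := y.torusFlag_spec
  refine (hG.eq_or_flagAdj i fun (z : TorusFace s) hz hz0 hz2 hzi => ?_).resolve_left fun he => ?_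
  · change z.rank ≠ i at hzi
    rcases eq_of_mem_torusFlag hz with rfl | rfl | rfl | rfl | rfl
    · exact absurd hz0 (by change ¬ (0 : ℤ) ≤ -1; norm_num)
    · rw [h0 (Ne.symm hzi)]
      exact hy.1
    · rw [h1 (by rw [torusEdge_rank] at hzi; exact Ne.symm hzi)]
      exact hy.2.1
    · rw [h2 (Ne.symm hzi)]
      exact hy.2.2
    · exact absurd hz2 (by change ¬ (3 : ℤ) ≤ 2; norm_num)
  · rw [he] at hx
    rcases hne with h | h | h
    · exact h (flag_eq_of_rank_eq hx.1 hy.1 rfl)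
    · exact h (flag_eq_of_rank_eq hx.2.1 hy.2.1 (x.torusEdge_rank.trans y.torusEdge_rank.symm))
    · exact h (flag_eq_of_rank_eq hx.2.2 hy.2.2 rfl)

theorem torusEdge_inj {x y : Corner s} (h : x.torusEdge = y.torusEdge) :
    x.o = y.o ∧ x.i = y.i ∧ x.j = y.j := by
  rcases x with ⟨_ | _, a, b, i, j⟩ <;> rcases y with ⟨_ | _, a', b', i', j'⟩ <;>
    simp_all [torusEdge]

theorem flipEdge_torusSquare (x : Corner s) : x.flipEdge.torusSquare = x.torusSquare := by
  rcases x with ⟨_ | _, _ | _, _ | _, i, j⟩ <;> simp [flipEdge, torusSquare, sqFst, sqSnd]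

theorem flipEdge_torusVertex (x : Corner s) : x.flipEdge.torusVertex = x.torusVertex := by
  rw [torusVertex, torusVertex, flipEdge_fst, flipEdge_snd]

theorem petrieStep_flipEdge (x : Corner s) :
    (toroidalMap44 s).PetrieStep x.torusFlag x.flipEdge.torusFlag := by
  refine Or.inl (torusFlagAdj_of_flip 1 (fun _ => x.flipEdge_torusVertex.symm)
    (fun h => absurd rfl h) (fun _ => x.flipEdge_torusSquare.symm) (Or.inr (Or.inl fun h => ?_)))
  have h' := (torusEdge_inj h).1
  rw [flipEdge_o] at h'
  cases hx : x.o <;> simp [hx] at h'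

/-- Changing both `a` and `b` keeps the square and changes only the point; changing `a` back then
changes only the square. Together this is the second kind of Petrie step. -/
theorem petrieStep_flipFacet (h1 : (1 : ZMod s) ≠ 0) (x : Corner s) :
    (toroidalMap44 s).PetrieStep x.torusFlag x.flipFacet.torusFlag := by
  refine Or.inr ⟨x.flipVertex.flipFacet.torusFlag, ?_, ?_⟩
  · refine torusFlagAdj_of_flip 0 (fun h => absurd rfl h) (fun _ => rfl) (fun _ => ?_)
      (Or.inl fun h => ?_)
    · rcases x with ⟨_ | _, _ | _, _ | _, i, j⟩ <;> rfl
    · have h' := TorusFace.vertex.inj h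
      rcases x with ⟨_ | _, _ | _, _ | _, i, j⟩ <;>
        simp [flipFacet, flipVertex, fst, snd, h1] at h'
  · refine torusFlagAdj_of_flip 2 (fun _ => ?_) (fun _ => rfl) (fun h => absurd rfl h)
      (Or.inr (Or.inr fun h => ?_))
    · rcases x with ⟨_ | _, _ | _, _ | _, i, j⟩ <;> rfl
    · have h' := TorusFace.square.inj h
      rcases x with ⟨_ | _, _ | _, _ | _, i, j⟩ <;>
        simp [flipFacet, flipVertex, sqFst, sqSnd, h1] at h'
      all_goals exact h1 (by linear_combination h')

/-- The Petrie polygon of the toroidal map at a corner. -/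
noncomputable def petrie (x : Corner s) : (toroidalMap44 s).PetriePolygon :=
  Quot.mk _ x.torusFlag

theorem petrie_eq_of_vertex [NeZero s] (h1 : (1 : ZMod s) ≠ 0) {x y : Corner s} (ha : x.a = y.a)
    (h : x.vertex = y.vertex) : x.petrie = y.petrie := by
  have hw := walk_vertex ha h
  clear ha h
  induction hw with
  | refl => rfl
  | @tail b c _ hbc ih =>
    rw [ih]
    rcases hbc with rfl | rfl
    · exact Quot.sound b.petrieStep_flipEdge
    · exact Quot.sound (b.petrieStep_flipFacet h1)

/-- The Petrie polygon at a corner is determined by the position of the square with respect to the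
vertex. -/
theorem vertex_eq_of_torus (x : Corner s) :
    (x.sqFst = x.fst ∧ x.sqSnd = x.snd ∧ x.a = true ∧ x.vertex = x.fst + x.snd) ∨
    (x.sqFst = x.fst - 1 ∧ x.sqSnd = x.snd - 1 ∧ x.a = true ∧ x.vertex = x.fst + x.snd - 1) ∨
    (x.sqFst = x.fst - 1 ∧ x.sqSnd = x.snd ∧ x.a = false ∧ x.vertex = x.fst - x.snd - 1) ∨
    (x.sqFst = x.fst ∧ x.sqSnd = x.snd - 1 ∧ x.a = false ∧ x.vertex = x.fst - x.snd) := by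
  rcases x with ⟨_ | _, _ | _, _ | _, i, j⟩ <;>
    simp [sqFst, sqSnd, fst, snd, vertex, BiFace.endpoint] <;> grind

theorem torusFlag_face_eq {x y : Corner s} {i : ℤ}
    (h : (toroidalMap44 s).FlagAdj i x.torusFlag y.torusFlag) :
    (i ≠ 0 → x.torusVertex = y.torusVertex) ∧ (i ≠ 1 → x.torusEdge = y.torusEdge) ∧
      (i ≠ 2 → x.torusSquare = y.torusSquare) := by
  have hx := x.torusFlag_spec
  have hy := y.torusFlag_spec
  refine ⟨fun hi => ?_, fun hi => ?_, fun hi => ?_⟩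
  · exact flag_eq_of_rank_eq ((h.2 x.torusVertex (Ne.symm hi)).1 hx.1) hy.1 rfl
  · exact flag_eq_of_rank_eq ((h.2 x.torusEdge
      (by change x.torusEdge.rank ≠ i; rw [torusEdge_rank]; exact Ne.symm hi)).1 hx.2.1) hy.2.1
      (x.torusEdge_rank.trans y.torusEdge_rank.symm)
  · exact flag_eq_of_rank_eq ((h.2 x.torusSquare (Ne.symm hi)).1 hx.2.2) hy.2.2 rfl

theorem ext_of_torus (h1 : (1 : ZMod s) ≠ 0) {x y : Corner s} (hv : x.torusVertex = y.torusVertex)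
    (he : x.torusEdge = y.torusEdge) (hf : x.torusSquare = y.torusSquare) : x = y := by
  obtain ⟨h2, h3, h4⟩ := torusEdge_inj he
  have hv' := TorusFace.vertex.inj hv
  have hf' := TorusFace.square.inj hf
  have hne : ∀ c : ZMod s, ¬ c = c - 1 := fun c h => h1 (by linear_combination h)
  rcases x with ⟨_ | _, _ | _, _ | _, i, j⟩ <;> rcases y with ⟨_ | _, _ | _, _ | _, i', j'⟩ <;>
    simp_all [fst, snd, sqFst, sqSnd]

theorem torusFlag_injective (h1 : (1 : ZMod s) ≠ 0) :
    Function.Injective (torusFlag : Corner s → _) := by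
  intro x y h
  have hx := x.torusFlag_spec
  have hy := y.torusFlag_spec
  rw [h] at hx
  exact ext_of_torus h1 (flag_eq_of_rank_eq hx.1 hy.1 rfl)
    (flag_eq_of_rank_eq hx.2.1 hy.2.1 (x.torusEdge_rank.trans y.torusEdge_rank.symm))
    (flag_eq_of_rank_eq hx.2.2 hy.2.2 rfl)

/-- A change of edge keeps the point and the square, whose relative position determines the zigzag
by `vertex_eq_of_torus`. In the other kind of step the edge stays, while point and square both
change, so `a` is kept. -/
theorem vertex_eq_of_petrieStep (h1 : (1 : ZMod s) ≠ 0) {x y : Corner s}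
    (h : (toroidalMap44 s).PetrieStep x.torusFlag y.torusFlag) :
    x.a = y.a ∧ x.vertex = y.vertex := by
  have hne : ∀ c : ZMod s, ¬ c = c - 1 := fun c h => h1 (by linear_combination h)
  rcases h with h | ⟨Χ, h, h'⟩
  · obtain ⟨e1, -, e2⟩ := torusFlag_face_eq h
    have e1 := TorusFace.vertex.inj (e1 (by norm_num))
    have e2 := TorusFace.square.inj (e2 (by norm_num))
    have hx := vertex_eq_of_torus x
    have hy := vertex_eq_of_torus y
    rw [← e1.1, ← e1.2, ← e2.1, ← e2.2] at hy
    have n1 := hne x.fst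
    have n2 := hne x.snd
    clear e1 e2 h hne
    grind
  · obtain ⟨z, rfl⟩ := exists_torusFlag_eq Χ
    obtain ⟨-, e1, e2⟩ := torusFlag_face_eq h
    obtain ⟨e3, e4, -⟩ := torusFlag_face_eq h'
    have e1 := torusEdge_inj (e1 (by norm_num))
    have e2 := TorusFace.square.inj (e2 (by norm_num))
    have e3 := TorusFace.vertex.inj (e3 (by norm_num))
    have e4 := torusEdge_inj (e4 (by norm_num))
    have n1 : x ≠ z := fun he => h.1 (he ▸ rfl)
    have n2 : z ≠ y := fun he => h'.1 (he ▸ rfl)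
    rcases x with ⟨o, a, b, i, j⟩
    rcases y with ⟨o', a', b', i', j'⟩
    rcases z with ⟨o'', a'', b'', i'', j''⟩
    simp only at e1 e4
    obtain ⟨rfl, rfl, rfl⟩ := e1
    obtain ⟨rfl, rfl, rfl⟩ := e4
    suffices ha : a = a' by
      subst ha
      exact ⟨rfl, rfl⟩
    cases o <;> cases a <;> cases b <;> cases a' <;> cases b' <;> cases a'' <;> cases b'' <;>
      simp_all [fst, snd, sqFst, sqSnd]

theorem petrie_eq_iff [NeZero s] (h1 : (1 : ZMod s) ≠ 0) {x y : Corner s} :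
    x.petrie = y.petrie ↔ x.a = y.a ∧ x.vertex = y.vertex := by
  refine ⟨fun h => ?_, fun h => petrie_eq_of_vertex h1 h.1 h.2⟩
  choose c hc using exists_torusFlag_eq (s := s)
  have hcx : ∀ x : Corner s, c x.torusFlag = x := fun x => torusFlag_injective h1 (hc _)
  -- The class and the index of the zigzag are invariant under Petrie steps, so they descend to the
  -- quotient and separate the polygons.
  let f : (toroidalMap44 s).PetriePolygon → Bool × ZMod s :=
    Quot.lift (fun Φ => ((c Φ).a, (c Φ).vertex)) fun Φ Ψ hs => by
      rw [← hc Φ, ← hc Ψ] at hs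
      have := vertex_eq_of_petrieStep h1 hs
      exact Prod.ext this.1 this.2
  have hf : ∀ x : Corner s, f x.petrie = (x.a, x.vertex) := fun x => by
    change ((c x.torusFlag).a, (c x.torusFlag).vertex) = _
    rw [hcx]
  have := congrArg f h
  rw [hf, hf] at this
  exact ⟨congrArg Prod.fst this, congrArg Prod.snd this⟩

theorem onPetrie_iff [NeZero s] (h1 : (1 : ZMod s) ≠ 0) (x : TorusFace s) (d : Corner s) :
    (toroidalMap44 s).OnPetrie x d.petrie ↔ x = .empty ∨ ∃ c : Corner s, c.a = d.a ∧
      c.vertex = d.vertex ∧ (x = c.torusVertex ∨ x = c.torusEdge) := by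
  constructor
  · rintro ⟨Φ, y, hZ, hy, hr, hxy⟩
    obtain ⟨c, rfl⟩ := exists_torusFlag_eq Φ
    have hcd := (petrie_eq_iff h1).1 hZ
    change TorusFace s at y
    change y.rank < 2 at hr
    have hxy' : x = y ∨ x.lt y := hxy
    by_cases hx : x = .empty
    · exact Or.inl hx
    refine Or.inr ?_
    rcases eq_of_mem_torusFlag hy with rfl | rfl | rfl | rfl | rfl
    · rcases hxy' with rfl | h
      · exact absurd rfl hx
      · cases x <;> simp [TorusFace.lt] at h
    · rcases hxy' with rfl | h
      · exact ⟨c, hcd.1, hcd.2, Or.inl rfl⟩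
      · cases x <;> simp [TorusFace.lt, torusVertex] at h
        exact absurd rfl hx
    · rcases hxy' with rfl | h
      · exact ⟨c, hcd.1, hcd.2, Or.inr rfl⟩
      -- The two ends of an edge are the points of `c` and `c.flipFacet`, which lie on the same
      -- polygon.
      · suffices hs : x = c.torusVertex ∨ x = c.flipFacet.torusVertex by
          rcases hs with hs | hs
          · exact ⟨c, hcd.1, hcd.2, Or.inl hs⟩
          · exact ⟨c.flipFacet, hcd.1, hcd.2, Or.inl hs⟩
        rcases c with ⟨_ | _, a, _ | _, i, j⟩ <;> cases x <;>
          simp [TorusFace.lt, torusVertex, torusEdge, flipFacet, fst, snd] at h hx ⊢ <;> grind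
    · exact absurd hr (by change ¬ (2 : ℤ) < 2; norm_num)
    · exact absurd hr (by change ¬ (3 : ℤ) < 2; norm_num)
  · rintro (rfl | ⟨c, ha, hc, rfl | rfl⟩)
    · refine ⟨d.torusFlag, d.torusVertex, rfl, d.torusFlag_spec.1, ?_, Or.inr ?_⟩
      · change (0 : ℤ) < 2
        norm_num
      · simp [TorusFace.lt, torusVertex]
    · refine ⟨c.torusFlag, c.torusVertex, petrie_eq_of_vertex h1 ha hc, c.torusFlag_spec.1, ?_,
        Or.inl rfl⟩
      change (0 : ℤ) < 2
      norm_num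
    · refine ⟨c.torusFlag, c.torusEdge, petrie_eq_of_vertex h1 ha hc, c.torusFlag_spec.2.1, ?_,
        Or.inl rfl⟩
      change c.torusEdge.rank < 2
      rw [torusEdge_rank]
      norm_num

/-- A corner at a given vertex. -/
def atVertex (t : Bool) (c : ZMod s) : Corner s := ⟨false, t, false, c, 0⟩

theorem atVertex_vertex (t : Bool) (c : ZMod s) : (atVertex t c).vertex = c := by
  cases t <;> simp [atVertex, vertex, BiFace.endpoint]

theorem onPetrie_vertex [NeZero s] (h1 : (1 : ZMod s) ≠ 0) (t : Bool) (c i j : ZMod s) :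
    (toroidalMap44 s).OnPetrie (TorusFace.vertex i j) (atVertex t c).petrie ↔
      BiFace.lt (.vertex t c) (.facet i j) := by
  rw [onPetrie_iff h1, atVertex_vertex]
  constructor
  · rintro (h | ⟨d, ha, rfl, h | h⟩)
    · exact absurd h (by simp)
    · obtain ⟨rfl, rfl⟩ := TorusFace.vertex.inj h
      obtain rfl : d.a = t := ha
      exact BiFace.biMap_lt.1 (d.vertexFace_lt.trans d.edgeFace_lt)
    · rcases d with ⟨_ | _, _, _, _, _⟩ <;> simp [torusEdge] at h
  · intro h
    refine Or.inr ?_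
    cases t <;> simp only [BiFace.lt] at h <;> rcases h with rfl | rfl
    · exact ⟨⟨false, false, false, i, j⟩, rfl, rfl, Or.inl rfl⟩
    · refine ⟨⟨false, false, true, i - 1, j⟩, rfl, ?_, Or.inl ?_⟩
      · simp only [vertex, BiFace.endpoint]; ring
      · simp [torusVertex, fst, snd]
    · exact ⟨⟨false, true, false, i, j⟩, rfl, rfl, Or.inl rfl⟩
    · refine ⟨⟨false, true, true, i - 1, j⟩, rfl, ?_, Or.inl ?_⟩
      · simp only [vertex, BiFace.endpoint]; ring
      · simp [torusVertex, fst, snd]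

theorem onPetrie_edge [NeZero s] (h1 : (1 : ZMod s) ≠ 0) (t : Bool) (c : ZMod s) (d : Corner s) :
    (toroidalMap44 s).OnPetrie d.torusEdge (atVertex t c).petrie ↔
      c = BiFace.endpoint t d.o d.i d.j := by
  rw [onPetrie_iff h1, atVertex_vertex]
  constructor
  · rintro (h | ⟨e, ha, rfl, h | h⟩)
    · have := congrArg TorusFace.rank h
      rw [torusEdge_rank] at this
      exact absurd this (by change ¬ (1 : ℤ) = -1; decide)
    · have := congrArg TorusFace.rank h
      rw [torusEdge_rank] at this
      exact absurd this (by change ¬ (1 : ℤ) = 0; decide)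
    · obtain ⟨h2, h3, h4⟩ := torusEdge_inj h
      obtain rfl : e.a = t := ha
      rw [h2, h3, h4]
      rfl
  · rintro rfl
    exact Or.inr ⟨⟨d.o, t, d.b, d.i, d.j⟩, rfl, rfl, Or.inr rfl⟩

end Corner

/-! ### The model as the dual of the Petrial -/

namespace BiFace

open RankedPoset

variable {s : ℕ}

/-- The faces of `biMap s` as faces of the Petrial of the toroidal map, with the order reversed. -/
noncomputable def toPetrial : BiFace s → (toroidalMap44 s).PetrialFace
  | empty => .old TorusFace.whole (by change ¬ (3 : ℤ) = 2; decide)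
  | vertex t c => .polygon (Corner.atVertex t c).petrie
  | edge false i j => .old (TorusFace.hEdge i j) (by change ¬ (1 : ℤ) = 2; decide)
  | edge true i j => .old (TorusFace.vEdge i j) (by change ¬ (1 : ℤ) = 2; decide)
  | facet i j => .old (TorusFace.vertex i j) (by change ¬ (0 : ℤ) = 2; decide)
  | whole => .old TorusFace.empty (by change ¬ (-1 : ℤ) = 2; decide)

theorem old_le_old {x y : TorusFace s} (hx : (toroidalMap44 s).rank x ≠ 2)
    (hy : (toroidalMap44 s).rank y ≠ 2) :
    (PetrialFace.old x hx : (toroidalMap44 s).PetrialFace) ≤ .old y hy ↔ x = y ∨ x.lt y := Iff.rfl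

theorem old_le_polygon {x : TorusFace s} (hx : (toroidalMap44 s).rank x ≠ 2)
    {Z : (toroidalMap44 s).PetriePolygon} :
    (PetrialFace.old x hx : (toroidalMap44 s).PetrialFace) ≤ .polygon Z ↔
      (toroidalMap44 s).OnPetrie x Z := Iff.rfl

theorem polygon_le_old {x : TorusFace s} (hx : (toroidalMap44 s).rank x ≠ 2)
    {Z : (toroidalMap44 s).PetriePolygon} :
    (PetrialFace.polygon Z : (toroidalMap44 s).PetrialFace) ≤ .old x hx ↔ x = .whole := by
  change (IsTop (x : (toroidalMap44 s).Face) ∧ 2 < TorusFace.rank x) ↔ _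
  constructor
  · rintro ⟨-, h⟩
    cases x <;> simp [TorusFace.rank] at h ⊢
  · rintro rfl
    refine ⟨fun (y : TorusFace s) => ?_, by simp [TorusFace.rank]⟩
    change y = .whole ∨ y.lt .whole
    cases y <;> simp [TorusFace.lt]

theorem polygon_le_polygon {Z W : (toroidalMap44 s).PetriePolygon} :
    (PetrialFace.polygon Z : (toroidalMap44 s).PetrialFace) ≤ .polygon W ↔ Z = W := Iff.rfl

/-- Points and segments on a Petrie polygon satisfy the equations in `BiFace.lt`, by
`onPetrie_vertex` and `onPetrie_edge`; all other incidences are those of the torus read backwards.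
-/
theorem toPetrial_le [NeZero s] (h1 : (1 : ZMod s) ≠ 0) (x y : BiFace s) :
    toPetrial y ≤ toPetrial x ↔ x ≤ y := by
  rw [le_iff]
  have hedge0 : ∀ t c i j, (toroidalMap44 s).OnPetrie (TorusFace.hEdge i j)
      (Corner.atVertex t c).petrie ↔ c = endpoint t false i j := fun t c i j =>
    Corner.onPetrie_edge h1 t c ⟨false, false, false, i, j⟩
  have hedge1 : ∀ t c i j, (toroidalMap44 s).OnPetrie (TorusFace.vEdge i j)
      (Corner.atVertex t c).petrie ↔ c = endpoint t true i j := fun t c i j =>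
    Corner.onPetrie_edge h1 t c ⟨true, false, false, i, j⟩
  have hwhole : ∀ c : Corner s, ¬ (toroidalMap44 s).OnPetrie TorusFace.whole c.petrie :=
    fun c h => absurd (OnPetrie.rank_lt h) (by change ¬ (3 : ℤ) < 2; decide)
  have hempty : ∀ c : Corner s, (toroidalMap44 s).OnPetrie TorusFace.empty c.petrie :=
    fun c => (Corner.onPetrie_iff h1 _ _).2 (Or.inl rfl)
  have hpet : ∀ t c t' c', (Corner.atVertex (s := s) t c).petrie = (Corner.atVertex t' c').petrie ↔
      t = t' ∧ c = c' := fun t c t' c' => by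
    rw [Corner.petrie_eq_iff h1, Corner.atVertex_vertex, Corner.atVertex_vertex]
    rfl
  rcases x with _ | ⟨t, c⟩ | ⟨_ | _, i, j⟩ | ⟨i, j⟩ | _ <;>
    rcases y with _ | ⟨t', c'⟩ | ⟨_ | _, k, l⟩ | ⟨k, l⟩ | _ <;>
    simp only [toPetrial, old_le_old, old_le_polygon, polygon_le_old, polygon_le_polygon, hedge0,
      hedge1, hwhole, hempty, hpet, Corner.onPetrie_vertex h1, BiFace.lt, TorusFace.lt,
      reduceCtorEq, false_or, or_false, or_true, ne_eq, not_true_eq_false, not_false_eq_true,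
      vertex.injEq, edge.injEq, facet.injEq, TorusFace.vertex.injEq, TorusFace.hEdge.injEq,
      TorusFace.vEdge.injEq, true_and, false_and, eq_comm]

theorem toPetrial_surjective [NeZero s] (h1 : (1 : ZMod s) ≠ 0) :
    Function.Surjective (toPetrial : BiFace s → _) := by
  rintro (⟨x, hx⟩ | Z)
  · change TorusFace s at x
    cases x with
    | empty => exact ⟨whole, rfl⟩
    | vertex i j => exact ⟨facet i j, rfl⟩
    | hEdge i j => exact ⟨edge false i j, rfl⟩
    | vEdge i j => exact ⟨edge true i j, rfl⟩
    | square i j => exact absurd rfl hx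
    | whole => exact ⟨empty, rfl⟩
  · obtain ⟨Φ, rfl⟩ := Quot.exists_rep Z
    obtain ⟨x, rfl⟩ := Corner.exists_torusFlag_eq Φ
    refine ⟨vertex x.a x.vertex, congrArg PetrialFace.polygon ?_⟩
    exact Corner.petrie_eq_of_vertex h1 rfl (Corner.atVertex_vertex _ _)

theorem biMap_isIsomorphic [NeZero s] (h1 : (1 : ZMod s) ≠ 0) :
    (biMap s).IsIsomorphic (toroidalMap44 s).petrial.dual := by
  have hle := toPetrial_le h1
  have hbij : Function.Bijective (toPetrial : BiFace s → _) :=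
    ⟨fun x y h => le_antisymm ((hle x y).1 h.ge) ((hle y x).1 h.le), toPetrial_surjective h1⟩
  refine ⟨⟨(Equiv.ofBijective _ hbij).trans OrderDual.toDual, fun {x y} => hle x y⟩, ?_⟩
  intro x
  rcases x with _ | ⟨t, c⟩ | ⟨_ | _, i, j⟩ | ⟨i, j⟩ | _ <;> rfl

end BiFace

namespace RankedPoset

/-! ### From a regular polyhedron to its action on the vertices -/

section Vertices

variable {P : RankedPoset.{u}} {Φ : Flag P.Face} {r : Fin 3 → (P.Face ≃o P.Face)}

namespace IsGenerators

/-- An automorphism that fixes the base faces next to a base face fixes this face or moves it like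
the generator of this rank. -/
theorem apply_eq_or (hP : P.IsPolyhedron) (hr : P.IsGenerators Φ r) (i : Fin 3)
    {g : P.Face ≃o P.Face} {x : P.Face} (hx : x ∈ Φ) (hxi : P.rank x = (i : ℕ))
    (hg : ∀ c ∈ Φ, P.rank c = (i : ℕ) - 1 ∨ P.rank c = (i : ℕ) + 1 → g c = c) :
    g x = x ∨ g x = r i x := by
  by_cases hgx : g x = x
  · exact Or.inl hgx
  have key : ∀ g : P.Face ≃o P.Face,
      (∀ c ∈ Φ, P.rank c = (i : ℕ) - 1 ∨ P.rank c = (i : ℕ) + 1 → g c = c) →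
      ∀ c ∈ Φ, (P.rank c = (i : ℕ) - 1 → c < g x) ∧ (P.rank c = (i : ℕ) + 1 → g x < c) := by
    intro g hg c hc
    refine ⟨fun h => ?_, fun h => ?_⟩
    · have := g.lt_iff_lt.2 (flag_lt_of_rank_lt hc hx (by omega))
      rwa [hg c hc (Or.inl h)] at this
    · have := g.lt_iff_lt.2 (flag_lt_of_rank_lt hx hc (by omega))
      rwa [hg c hc (Or.inr h)] at this
  refine Or.inr (hP.eq_of_between (by omega) (by omega) hx hxi (key g hg) hgx
    (key (r i) fun c hc h => hr.fix i c hc (by omega)) (hr.move i x hx hxi))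

theorem sq_apply (hP : P.IsPolyhedron) (hr : P.IsGenerators Φ r) (i : Fin 3) {x : P.Face}
    (hx : x ∈ Φ) : r i (r i x) = x := by
  by_cases hxi : P.rank x = (i : ℕ)
  · refine (hr.apply_eq_or hP i (g := r i * r i) hx hxi fun c hc h => ?_).resolve_right fun h => ?_
    · have := hr.fix i c hc (by omega)
      change r i (r i c) = c
      rw [this, this]
    · exact hr.move i x hx hxi ((r i).injective h)
  · rw [hr.fix i x hx hxi, hr.fix i x hx hxi]

theorem mul_self (hP : P.IsPolyhedron) (hr : P.IsGenerators Φ r) (i : Fin 3) : r i * r i = 1 :=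
  hP.eq_one_of_fix_flag fun _ hx => hr.sq_apply hP i hx

/-- The product `r j * r i` fixes the base faces next to `x`, so it sends `x` to `x` or to `r i x`;
the former is excluded because `r j` fixes `x`. -/
theorem apply_apply_of_ne (hP : P.IsPolyhedron) (hr : P.IsGenerators Φ r) {i j : Fin 3}
    (hij : (i : ℕ) + 1 < j ∨ (j : ℕ) + 1 < i) {x : P.Face} (hx : x ∈ Φ)
    (hxi : P.rank x = (i : ℕ)) : r j (r i x) = r i x := by
  have hjx : r j x = x := hr.fix j x hx (by omega)
  refine (hr.apply_eq_or hP i (g := r j * r i) hx hxi fun c hc h => ?_).resolve_left fun h => ?_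
  · change r j (r i c) = c
    rw [hr.fix i c hc (by omega), hr.fix j c hc (by omega)]
  · exact hr.move i x hx hxi ((r j).injective (h.trans hjx.symm))

theorem zero_mul_two (hP : P.IsPolyhedron) (hr : P.IsGenerators Φ r) :
    r 0 * r 2 = r 2 * r 0 := by
  have h : (r 0 * r 2) * (r 0 * r 2) = 1 := by
    refine hP.eq_one_of_fix_flag (Φ := Φ) fun x hx => ?_
    change r 0 (r 2 (r 0 (r 2 x))) = x
    by_cases h0 : P.rank x = ((0 : Fin 3) : ℕ)
    · rw [hr.fix 2 x hx (by rw [h0]; decide),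
        hr.apply_apply_of_ne hP (i := 0) (j := 2) (by decide) hx h0, hr.sq_apply hP 0 hx]
    by_cases h2 : P.rank x = ((2 : Fin 3) : ℕ)
    · rw [hr.apply_apply_of_ne hP (i := 2) (j := 0) (by decide) hx h2, hr.sq_apply hP 2 hx,
        hr.fix 0 x hx h0]
    · rw [hr.fix 2 x hx h2, hr.fix 0 x hx h0, hr.fix 2 x hx h2, hr.fix 0 x hx h0]
  rw [mul_eq_one_iff_eq_inv, mul_inv_rev, ← mul_eq_one_iff_eq_inv.1 (hr.mul_self hP 0),
    ← mul_eq_one_iff_eq_inv.1 (hr.mul_self hP 2)] at h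
  exact h

/-- The words in two involutions. -/
theorem _root_.Subgroup.exists_zpow_of_mem_closure_pair {G : Type*} [Group G] {a b : G}
    (ha : a * a = 1) (hb : b * b = 1) {g : G} (hg : g ∈ Subgroup.closure {a, b}) :
    ∃ i : ℤ, g = (a * b) ^ i ∨ g = (a * b) ^ i * b := by
  have hconj : ∀ i : ℤ, b * (a * b) ^ i = (a * b) ^ (-i) * b := by
    intro i
    have h1 : SemiconjBy b (a * b) (a * b)⁻¹ := by
      rw [SemiconjBy, mul_inv_rev, ← mul_eq_one_iff_eq_inv.1 ha, ← mul_eq_one_iff_eq_inv.1 hb,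
        mul_assoc]
    have := h1.zpow_right i
    rwa [inv_zpow, ← zpow_neg] at this
  induction hg using Subgroup.closure_induction with
  | mem x hx =>
    rcases hx with rfl | rfl
    · exact ⟨1, Or.inr (by rw [zpow_one, mul_assoc, hb, mul_one])⟩
    · exact ⟨0, Or.inr (by rw [zpow_zero, one_mul])⟩
  | one => exact ⟨0, Or.inl (zpow_zero _).symm⟩
  | mul x y _ _ hx hy =>
    obtain ⟨i, rfl | rfl⟩ := hx <;> obtain ⟨j, rfl | rfl⟩ := hy
    · exact ⟨i + j, Or.inl (zpow_add _ _ _).symm⟩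
    · exact ⟨i + j, Or.inr (by rw [zpow_add, mul_assoc])⟩
    · exact ⟨i - j, Or.inr (by rw [mul_assoc, hconj, ← mul_assoc, ← zpow_add, sub_eq_add_neg])⟩
    · exact ⟨i - j, Or.inl (by
        rw [mul_assoc, ← mul_assoc b, hconj, mul_assoc _ b b, hb, mul_one, ← zpow_add,
          sub_eq_add_neg])⟩
  | inv x _ hx =>
    obtain ⟨i, rfl | rfl⟩ := hx
    · exact ⟨-i, Or.inl (zpow_neg _ _).symm⟩
    · exact ⟨i, Or.inr (by
        rw [mul_inv_rev, ← mul_eq_one_iff_eq_inv.1 hb, ← zpow_neg, hconj, neg_neg])⟩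

theorem exists_zpow_of_fix_vertex (hP : P.IsPolyhedron) (hr : P.IsGenerators Φ r) {x : P.Face}
    (hx : x ∈ Φ) (hx0 : P.rank x = 0) {g : P.Face ≃o P.Face} (hg : g ∈ P.autGroup)
    (hgx : g x = x) : ∃ i : ℤ, g = (r 1 * r 2) ^ i ∨ g = (r 1 * r 2) ^ i * r 2 := by
  refine Subgroup.exists_zpow_of_mem_closure_pair (hr.mul_self hP 1) (hr.mul_self hP 2)
    (hr.mem_of_fix hP hx (fun i hi => ?_) hg hgx)
  fin_cases i
  · exact absurd hx0 hi
  · exact Subgroup.subset_closure (by simp)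
  · exact Subgroup.subset_closure (by simp)

theorem rot_mem (hr : P.IsGenerators Φ r) (i : ℤ) : (r 1 * r 2) ^ i ∈ P.autGroup :=
  Subgroup.zpow_mem _ (P.autGroup.mul_mem (hr.mem 1) (hr.mem 2)) i

theorem rot_fix (hr : P.IsGenerators Φ r) {x : P.Face} (hx : x ∈ Φ)
    (h : P.rank x ≠ 1 ∧ P.rank x ≠ 2) (i : ℤ) : ((r 1 * r 2) ^ i) x = x := by
  have : r 1 * r 2 ∈ MulAction.stabilizer (P.Face ≃o P.Face) x := by
    change r 1 (r 2 x) = x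
    rw [hr.fix 2 x hx h.2, hr.fix 1 x hx h.1]
  exact Subgroup.zpow_mem _ this i

/-- A rotation fixing the base edge either fixes the base flag or equals `r 2`. In the latter case
`r 2` commutes with the rotation, which then has square 1, and `r 2` or `r 1` would be trivial. -/
theorem rot_eq_one (hP : P.IsPolyhedron) (hr : P.IsGenerators Φ r) {e : P.Face} (he : e ∈ Φ)
    (he1 : P.rank e = 1) {i : ℤ} (hi : ((r 1 * r 2) ^ i) e = e) : (r 1 * r 2) ^ i = 1 := by
  obtain ⟨f, hf, hf2⟩ := hP.isFlagGraded.exists_mem Φ (i := 2) (by norm_num) (by norm_num)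
  have hfix : ∀ c ∈ Φ, P.rank c ≠ 2 → ((r 1 * r 2) ^ i) c = c := by
    intro c hc hc2
    by_cases hc1 : P.rank c = 1
    · rwa [flag_eq_of_rank_eq hc he (hc1.trans he1.symm)]
    · exact hr.rot_fix hc ⟨hc1, hc2⟩ i
  rcases hr.apply_eq_or hP 2 (g := (r 1 * r 2) ^ i) hf hf2 fun c hc h =>
    hfix c hc (by simp only [Fin.isValue, Fin.val_two, Nat.cast_ofNat] at h; omega) with h | h
  · refine hP.eq_one_of_fix_flag (Φ := Φ) fun c hc => ?_
    by_cases hc2 : P.rank c = 2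
    · rwa [flag_eq_of_rank_eq hc hf (hc2.trans hf2.symm)]
    · exact hfix c hc hc2
  · exfalso
    have h2 : (r 1 * r 2) ^ i = r 2 := by
      have : r 2 * (r 1 * r 2) ^ i = 1 := by
        refine hP.eq_one_of_fix_flag (Φ := Φ) fun c hc => ?_
        change r 2 (((r 1 * r 2) ^ i) c) = c
        by_cases hc2 : P.rank c = 2
        · rw [flag_eq_of_rank_eq hc hf (hc2.trans hf2.symm), h, hr.sq_apply hP 2 hf]
        · rw [hfix c hc hc2, hr.fix 2 c hc hc2]
      rw [mul_eq_one_iff_inv_eq, ← mul_eq_one_iff_eq_inv.1 (hr.mul_self hP 2)] at this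
      exact this.symm
    have hcomm : r 2 * (r 1 * r 2) = (r 1 * r 2) * r 2 := by
      have := (Commute.refl (r 1 * r 2)).zpow_left i
      rw [h2] at this
      exact this.eq
    have hsq : (r 1 * r 2) * (r 1 * r 2) = 1 := by
      rw [mul_assoc, hcomm, mul_assoc, hr.mul_self hP 2, mul_one, hr.mul_self hP 1]
    obtain ⟨m, rfl | rfl⟩ := Int.even_or_odd' i
    · rw [zpow_mul, zpow_ofNat, pow_two, hsq, one_zpow] at h2
      exact hr.move 2 f hf hf2 (by rw [← h2]; rfl)
    · rw [zpow_add, zpow_mul, zpow_ofNat, pow_two, hsq, one_zpow, one_mul, zpow_one,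
        mul_eq_right] at h2
      exact hr.move 1 e he he1 (by rw [h2]; rfl)

/-- The rotations act simply transitively on the edges at the base vertex: freely by `rot_eq_one`,
and transitively because `r 2` fixes the base edge, so that the reflections reach no further edges.
-/
theorem encard_edges (hP : P.IsPolyhedron) (hr : P.IsGenerators Φ r) {x : P.Face} (hx : x ∈ Φ)
    (hx0 : P.rank x = 0) :
    {e : P.Face | P.rank e = 1 ∧ x < e}.encard = ENat.card (Subgroup.zpowers (r 1 * r 2)) := by
  obtain ⟨e, he, he1⟩ := hP.isFlagGraded.exists_mem Φ (i := 1) (by norm_num) (by norm_num)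
  let F : Subgroup.zpowers (r 1 * r 2) → P.Face := fun g => g.1 e
  have hF : Function.Injective F := by
    rintro ⟨_, i, rfl⟩ ⟨_, j, rfl⟩ h
    change ((r 1 * r 2) ^ i) e = ((r 1 * r 2) ^ j) e at h
    have h1 : ((r 1 * r 2) ^ (-j + i)) e = e := by
      rw [zpow_add, zpow_neg]
      change ((r 1 * r 2) ^ j).symm (((r 1 * r 2) ^ i) e) = e
      rw [h, OrderIso.symm_apply_apply]
    have h2 := hr.rot_eq_one hP he he1 h1
    rw [zpow_add, zpow_neg, inv_mul_eq_one] at h2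
    exact Subtype.ext h2.symm
  rw [ENat.card_congr (Equiv.ofInjective F hF)]
  change _ = (Set.range F).encard
  congr 1
  ext e'
  constructor
  · rintro ⟨h1, hlt⟩
    obtain ⟨Ψ, hxΨ, heΨ⟩ := Flag.exists_mem_mem hlt.le
    obtain ⟨h, hh, hha, hm⟩ := hr.exists_map_eq hP
      (H := MulAction.stabilizer (P.Face ≃o P.Face) x) hx (fun i hi => hr.fix i x hx hi) hxΨ
    have hhe : h e = e' := flag_eq_of_rank_eq (hm e he) heΨ (by rw [hha e, he1, h1])
    obtain ⟨i, rfl | rfl⟩ := hr.exists_zpow_of_fix_vertex hP hx hx0 hha hh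
    · exact ⟨⟨_, i, rfl⟩, hhe⟩
    · refine ⟨⟨_, i, rfl⟩, ?_⟩
      change ((r 1 * r 2) ^ i) (r 2 e) = e' at hhe
      rwa [hr.fix 2 e he (by rw [he1]; decide)] at hhe
  · rintro ⟨⟨_, i, rfl⟩, rfl⟩
    refine ⟨(hr.rot_mem i e).trans he1, ?_⟩
    have := ((r 1 * r 2) ^ i).lt_iff_lt.2 (flag_lt_of_rank_lt hx he (by omega))
    rwa [hr.rot_fix hx (by omega)] at this

theorem isRegularVertexAction (hP : P.IsPolyhedron) (hF : P.IsVertexFaithful)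
    (hr : P.IsGenerators Φ r) {x : P.vertices} (hx : x.1 ∈ Φ) {p : ℕ∞} {q : ℕ}
    (hT : P.HasType p q) (hq : P.vertices.encard = q) :
    IsRegularVertexAction (P.vertexPerm ⟨r 0, hr.mem 0⟩) (P.vertexPerm ⟨r 1, hr.mem 1⟩)
      (P.vertexPerm ⟨r 2, hr.mem 2⟩) x q := by
  have hsq : ∀ i, P.vertexPerm ⟨r i, hr.mem i⟩ * P.vertexPerm ⟨r i, hr.mem i⟩ = 1 := fun i => by
    rw [← map_mul, ← map_one P.vertexPerm]
    exact congrArg _ (Subtype.ext (hr.mul_self hP i))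
  have hfix : ∀ i : Fin 3, i ≠ 0 → P.vertexPerm ⟨r i, hr.mem i⟩ x = x := fun i hi =>
    Subtype.ext (hr.fix i x.1 hx (by
      rw [show P.rank x.1 = 0 from x.2]
      exact fun h => hi (Fin.ext (by rw [Fin.val_zero]; omega))))
  have hcard := (hr.encard_edges hP hx x.2).symm.trans (hT.2 x.1 x.2)
  refine ⟨hsq 0, hsq 1, hsq 2, ?_, hfix 1 (by decide), hfix 2 (by decide), ?_, ?_, ?_, ?_, ?_, ?_⟩
  · rw [← map_mul, ← map_mul]
    exact congrArg _ (Subtype.ext (hr.zero_mul_two hP))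
  · exact fun h => hr.move 0 x.1 hx x.2 (congrArg Subtype.val h)
  · intro g hg hgx
    have hle : Subgroup.closure {P.vertexPerm ⟨r 0, hr.mem 0⟩, P.vertexPerm ⟨r 1, hr.mem 1⟩,
        P.vertexPerm ⟨r 2, hr.mem 2⟩} ≤ P.vertexPerm.range := by
      rw [Subgroup.closure_le]
      rintro _ (rfl | rfl | rfl) <;> exact ⟨_, rfl⟩
    obtain ⟨g, rfl⟩ := hle hg
    obtain ⟨i, hi⟩ := hr.exists_zpow_of_fix_vertex hP hx x.2 g.2 (congrArg Subtype.val hgx)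
    refine ⟨i, ?_⟩
    rw [← map_mul, ← map_zpow, ← map_mul]
    exact hi.imp (fun h => congrArg _ (Subtype.ext h)) fun h => congrArg _ (Subtype.ext h)
  · intro y
    obtain ⟨Ψ, hΨ⟩ := Flag.exists_mem y.1
    obtain ⟨z, hz, -⟩ := hP.existsUnique_least
    obtain ⟨h, ⟨k, hk, hkh⟩, -, hm⟩ := hr.exists_map_eq hP
      (H := ((Subgroup.closure {P.vertexPerm ⟨r 0, hr.mem 0⟩, P.vertexPerm ⟨r 1, hr.mem 1⟩,
        P.vertexPerm ⟨r 2, hr.mem 2⟩}).comap P.vertexPerm).map P.autGroup.subtype)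
      (hP.isFlagGraded.least_mem hz Φ) (fun i _ => ⟨⟨r i, hr.mem i⟩, by
        refine Subgroup.subset_closure ?_
        fin_cases i <;> simp, rfl⟩) (hP.isFlagGraded.least_mem hz Ψ)
    refine ⟨_, hk, Subtype.ext ?_⟩
    have : h x.1 = y.1 := flag_eq_of_rank_eq (hm x.1 hx) hΨ (by
      rw [← hkh]
      exact (k.2 x.1).trans (Eq.trans x.2 (Eq.symm y.2)))
    rwa [← hkh] at this
  · rw [← map_mul, orderOf_injective _ hF.vertexPerm_injective, ← Subgroup.orderOf_coe,
      ← Nat.card_zpowers]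
    -- Here `toNat` loses nothing, since by `hcard` the cardinality is the finite number `q`.
    change (ENat.card (Subgroup.zpowers (r 1 * r 2))).toNat = q
    rw [hcard]
    rfl
  · change (P.vertices.encard).toNat = q
    rw [hq]
    rfl
  · rw [Nat.pos_iff_ne_zero]
    rintro rfl
    rw [Nat.cast_zero, Set.encard_eq_zero] at hq
    exact (hq ▸ x.2 : x.1 ∈ (∅ : Set P.Face))

end IsGenerators

end Vertices

end RankedPoset

/-! ### Conclusion -/

theorem ZMod.eq_zero_of_two_mul_eq_zero {k : ℕ} (hk : Odd k) (x : ZMod k) (hx : 2 * x = 0) :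
    x = 0 := by
  obtain ⟨m, rfl⟩ := hk
  have h := ZMod.natCast_self (2 * m + 1)
  push_cast at h
  linear_combination x * h - (m : ZMod (2 * m + 1)) * hx

theorem ZMod.one_ne_zero_of_three_le {k : ℕ} (hk : 3 ≤ k) : (1 : ZMod k) ≠ 0 := by
  have : Fact (1 < k) := ⟨by omega⟩
  exact one_ne_zero

theorem RankedPoset.exists_isIsomorphic_biMap {P : RankedPoset.{u}} {p : ℕ∞} {q : ℕ}
    (hP : P.IsPolyhedron) (hR : P.IsRegular) (hF : P.IsVertexFaithful) (hT : P.HasType p q)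
    (hq : P.vertices.encard = q) :
    ∃ k, q = 2 * k ∧ Odd k ∧ 3 ≤ k ∧ P.IsIsomorphic (biMap k) := by
  obtain ⟨Φ⟩ : Nonempty (Flag P.Face) := inferInstance
  obtain ⟨r, hr⟩ := hR.exists_isGenerators hP Φ
  obtain ⟨x, hx, hx0⟩ := hP.isFlagGraded.exists_mem Φ (i := 0) (by norm_num) (by norm_num)
  have hA := hr.isRegularVertexAction hP hF (x := ⟨x, hx0⟩) hx hT hq
  obtain ⟨k, hqk, hodd, hk, e, h0, h2, h1, h1'⟩ := hA.exists_equiv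
  have : NeZero k := ⟨by omega⟩
  have hone := ZMod.one_ne_zero_of_three_le hk
  -- Both polyhedra label their vertices by `Bool × ZMod k`, and the generators agree in these
  -- labels.
  refine ⟨k, hqk, hodd, hk, isIsomorphic_of_vertices hP (BiFace.isPolyhedron_biMap hone) hF
    (BiFace.isVertexFaithful_biMap hone (ZMod.eq_zero_of_two_mul_eq_zero hodd)) hr
    (BiFace.isGenerators_refl hone) (e.symm.trans (BiFace.vertexEquiv k)) fun i y => ?_⟩
  obtain ⟨⟨t, c⟩, rfl⟩ := e.surjective y
  rw [Equiv.trans_apply, Equiv.trans_apply, e.symm_apply_apply]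
  refine Subtype.ext ?_
  rw [coe_vertexPerm]
  fin_cases i
  · change _ = BiFace.reflVertex (BiFace.vertex t c)
    change ((BiFace.vertexEquiv k (e.symm (P.vertexPerm ⟨r 0, hr.mem 0⟩ (e (t, c)))) :
      (biMap k).vertices) : BiFace k) = _
    rw [h0, e.symm_apply_apply]
    rfl
  · change _ = BiFace.reflEdge (BiFace.vertex t c)
    change ((BiFace.vertexEquiv k (e.symm (P.vertexPerm ⟨r 1, hr.mem 1⟩ (e (t, c)))) :
      (biMap k).vertices) : BiFace k) = _
    cases t
    · rw [h1, e.symm_apply_apply]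
      rfl
    · rw [h1', e.symm_apply_apply]
      rfl
  · change _ = BiFace.reflFacet (BiFace.vertex t c)
    change ((BiFace.vertexEquiv k (e.symm (P.vertexPerm ⟨r 2, hr.mem 2⟩ (e (t, c)))) :
      (biMap k).vertices) : BiFace k) = _
    rw [h2, e.symm_apply_apply]
    rfl

theorem mainTheorem6 :
    (∀ (P : RankedPoset.{u}) (p : ℕ∞) (q : ℕ),
      P.IsPolyhedron → P.IsRegular → P.IsVertexFaithful →
      P.HasType p q → P.vertices.encard = q →
        6 ≤ q ∧ Even q ∧ Odd (q / 2) ∧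
          P.IsIsomorphic (toroidalMap44 (q / 2)).petrial.dual) ∧
    (∀ q : ℕ, 6 ≤ q → Even q → Odd (q / 2) →
      (toroidalMap44 (q / 2)).petrial.dual.IsPolyhedron ∧
      (toroidalMap44 (q / 2)).petrial.dual.IsRegular ∧
      (toroidalMap44 (q / 2)).petrial.dual.IsVertexFaithful ∧
      (toroidalMap44 (q / 2)).petrial.dual.HasType 4 q ∧
      (toroidalMap44 (q / 2)).petrial.dual.vertices.encard = q) := by
  constructor
  · intro P p q hP hR hF hT hq
    obtain ⟨k, rfl, hodd, hk, hiso⟩ := RankedPoset.exists_isIsomorphic_biMap hP hR hF hT hq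
    have : NeZero k := ⟨by omega⟩
    rw [Nat.mul_div_cancel_left k two_pos]
    exact ⟨by omega, even_two_mul k, hodd,
      hiso.trans (BiFace.biMap_isIsomorphic (ZMod.one_ne_zero_of_three_le hk))⟩
  · intro q h6 heven hodd
    obtain ⟨k, hk⟩ := heven
    obtain rfl : q = 2 * k := by omega
    rw [Nat.mul_div_cancel_left k two_pos] at hodd ⊢
    have : NeZero k := ⟨by omega⟩
    have hone := ZMod.one_ne_zero_of_three_le (k := k) (by omega)
    have hiso := BiFace.biMap_isIsomorphic hone
    have hP := BiFace.isPolyhedron_biMap hone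
    exact ⟨hiso.isPolyhedron hP, hiso.isRegular ((BiFace.isGenerators_refl hone).isRegular hP),
      hiso.isVertexFaithful
        (BiFace.isVertexFaithful_biMap hone (ZMod.eq_zero_of_two_mul_eq_zero hodd)),
      hiso.hasType (BiFace.hasType_biMap hone),
      hiso.encard_vertices.trans BiFace.encard_vertices_biMap⟩
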